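/- Let $X$ be a compact smooth manifold-with-boundary of dimension $d\ge 1$, with a boundary collar, i.e. a smooth embedding of $\dot X=[0,1)_\rho\times\partial X$ onto an open subset of $X$ with $(0,\theta)\mapsto\theta$; identify $\dot X$ with its image. Assume that the coordinate $\rho$ on $\dot X$ extends to a smooth function $\rho:X\to[0,\infty)$ vanishing exactly on $\partial X$, and put $r=1/\rho$. For $S=X$, $\dot X$ or $[0,1)_\rho$, a b-vector field on $S$ is a smooth vector field on $S$ (smooth up to and including the boundary) which is tangent to the boundary $\{\rho=0\}$; $\operatorname{Diff}^m_{\mathrm b}(S)$ is the set of finite linear combinations, with (real) coefficients in $C^\infty(S)$, of compositions of at most $m$ b-vector fields, acting on smooth functions on the interior of $S$. Elements of $\operatorname{Diff}^m_{\mathrm b}([0,1)_\rho)$ act on functions on $\dot X^\circ=(0,1)\times\partial X$ in the variable $\rho$ only. No uniformity as $\rho\to1^-$ is required in any space on $\dot X$ or $[0,1)_\rho$. Sections of $\operatorname{Sym}^2{}^{\mathrm{sc}}T^*\dot X$ that are smooth on $\dot X$ are the symmetric 2-tensors $\kappa$ on $\dot X^\circ$ such that $\kappa(\rho V,\rho W)\in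 C^\infty(\dot X)$ for all b-vector fields $V,W$ on $\dot X$. For $k=\infty$, a space with the weight $\rho^{k}$ means the intersection over all $j\in\mathbb N$ of the same space with the weight $\rho^j$. Let $h=g_{\partial X}$ be a smooth Riemannian metric on $\partial X$, let $g_0=\mathrm dr^2+r^2h$ be the exactly conic metric on $\dot X^\circ$, and let $g$ be a smooth Riemannian metric on $X^\circ$ such that, for some $\gimel\in\mathbb N\cup\{\infty\}$ and $\gimel_0\in\mathbb N_{+}\cup\{\infty\}$, on $\dot X^\circ$ $$g-g_0\in\rho^{1+\gimel}C^\infty([0,1)_\rho)\,\mathrm dr^2+\rho^{1+\gimel_0}C^\infty(\dot X;\operatorname{Sym}^2{}^{\mathrm{sc}}T^*\dot X).$$ Let $\triangle_g$, $\triangle_{g_0}$, $\triangle_{h}$ denote the positive semidefinite Laplace--Beltrami operators. Then the following hold. (1) On $\dot X^\circ$, $$\triangle_{g_0}=-\frac{\partial^2}{\partial r^2}-\frac{d-1}{r}\frac{\partial}{\partial r}+\frac1{r^2}\triangle_{h},$$ this operator lies in $\rho^2\operatorname{Diff}^2_{\mathrm b}(\dot X)$, and for every $c<1$ its restriction to the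 collar $\{\rho<c\}\subset\dot X$ is the restriction of an element of $\rho^2\operatorname{Diff}^2_{\mathrm b}(X)$. (2) There are $A\in\rho^{3+\gimel}\operatorname{Diff}^2_{\mathrm b}([0,1)_\rho)$ and $B\in\rho^{3+\gimel_0}\operatorname{Diff}^2_{\mathrm b}(\dot X)$ with $$\triangle_g-\triangle_{g_0}=A+B\quad\text{on }\dot X^\circ,$$ and for every $c<1$ the restriction of $B$ to the collar $\{\rho<c\}\subset\dot X$ is the restriction of an element of $\rho^{3+\gimel_0}\operatorname{Diff}^2_{\mathrm b}(X)$. -/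

import Mathlib

open Set
open scoped Manifold ContDiff

noncomputable section

/-! ### Bilinear forms, Riemannian metrics and the Laplace--Beltrami operator -/

section Metric

variable {E : Type*} [NormedAddCommGroup E] [NormedSpace ℝ E]
  {H : Type*} [TopologicalSpace H] (I : ModelWithCorners ℝ E H)
  {M : Type*} [TopologicalSpace M] [ChartedSpace H M]
  {E' : Type*} [NormedAddCommGroup E'] [NormedSpace ℝ E']
  {H' : Type*} [TopologicalSpace H'] (I' : ModelWithCorners ℝ E' H')
  {M' : Type*} [TopologicalSpace M'] [ChartedSpace H' M']

/-- A (not necessarily smooth) field of bilinear forms on the tangent spaces of `M`. -/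
abbrev BilinField (I : ModelWithCorners ℝ E H) (M : Type*) [TopologicalSpace M]
    [ChartedSpace H M] : Type _ :=
  ∀ x : M, TangentSpace I x →L[ℝ] TangentSpace I x →L[ℝ] ℝ

/-- A (not necessarily smooth) vector field on `M`. -/
abbrev VField (I : ModelWithCorners ℝ E H) (M : Type*) [TopologicalSpace M]
    [ChartedSpace H M] : Type _ :=
  ∀ x : M, TangentSpace I x

/-- The pullback `f^* k`, that is `(f^* k)_x (v, w) = k_{f x} (df v, df w)`. -/
def pullbackForm (f : M → M') (k : BilinField I' M') : BilinField I M :=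
  fun x => (ContinuousLinearMap.precomp ℝ (mfderiv I I' f x)).comp
    ((k (f x)).comp (mfderiv I I' f x))

theorem pullbackForm_apply (f : M → M') (k : BilinField I' M') (x : M) (v w : TangentSpace I x) :
    pullbackForm I I' f k x v w = k (f x) (mfderiv I I' f x v) (mfderiv I I' f x w) := rfl

/-- `g` is a smooth Riemannian metric on the open set `U`. -/
structure IsRiemannianOn [IsManifold I ∞ M] (g : BilinField I M) (U : Set M) : Prop where
  symm : ∀ x ∈ U, ∀ v w : TangentSpace I x, g x v w = g x w v
  pos : ∀ x ∈ U, ∀ v : TangentSpace I x, v ≠ 0 → 0 < g x v v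
  contMDiffOn : ContMDiffOn I (I.prod 𝓘(ℝ, E →L[ℝ] E →L[ℝ] ℝ)) ∞
    (fun x => Bundle.TotalSpace.mk' (E →L[ℝ] E →L[ℝ] ℝ)
      (E := fun x : M => TangentSpace I x →L[ℝ] TangentSpace I x →L[ℝ] ℝ) x (g x)) U

/-- The matrix `(g_{ij})` of `g` at the point with coordinates `y`, in the chart at `p` and the
linear coordinates of `E` given by a basis. -/
def gramInChart [FiniteDimensional ℝ E] (g : BilinField I M) (p : M) (y : E) :
    Matrix (Fin (Module.finrank ℝ E)) (Fin (Module.finrank ℝ E)) ℝ :=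
  Matrix.of fun i j =>
    g ((extChartAt I p).symm y)
      (mfderivWithin 𝓘(ℝ, E) I (extChartAt I p).symm (range I) y (Module.finBasis ℝ E i))
      (mfderivWithin 𝓘(ℝ, E) I (extChartAt I p).symm (range I) y (Module.finBasis ℝ E j))

/-- The positive semidefinite Laplace--Beltrami operator
`Δ_g u = - |g|^{-1/2} ∑ i, ∂_i (∑ j, |g|^{1/2} g^{ij} ∂_j u)`, evaluated at `p` in the chart
at `p`. It is meant at interior points `p` of `M` near which `g` is a smooth metric. -/
def laplaceBeltrami [FiniteDimensional ℝ E] (g : BilinField I M) (u : M → ℝ) (p : M) : ℝ :=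
  -((Real.sqrt (gramInChart I g p (extChartAt I p p)).det)⁻¹ *
    ∑ i, fderiv ℝ
      (fun y : E => ∑ j, Real.sqrt (gramInChart I g p y).det * (gramInChart I g p y)⁻¹ i j *
        fderiv ℝ (fun z : E => u ((extChartAt I p).symm z)) y (Module.finBasis ℝ E j))
      (extChartAt I p p) (Module.finBasis ℝ E i))

end Metric

/-! ### The b-calculus on a set `S` with boundary-defining function `ρ`

Here `S` is a manifold with boundary sitting in `M`, its boundary is `{x ∈ S | ρ x = 0}` and its
interior `{x ∈ S | 0 < ρ x}`. The theory is used for `[0,1) ⊆ ℝ`, for `[0,1) × Y ⊆ ℝ × Y` and for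
the whole of a manifold with boundary. Smoothness on `S` is up to and including the boundary. -/

section BCalculus

variable {E : Type*} [NormedAddCommGroup E] [NormedSpace ℝ E]
  {H : Type*} [TopologicalSpace H] (I : ModelWithCorners ℝ E H)
  {M : Type*} [TopologicalSpace M] [ChartedSpace H M]

/-- `u` is a smooth function on the interior of `S`. -/
def IsSmoothInterior (S : Set M) (ρ : M → ℝ) (u : M → ℝ) : Prop :=
  ContMDiffOn I 𝓘(ℝ, ℝ) ∞ u {x ∈ S | 0 < ρ x}

/-- `f ∈ ρ^k C^∞(S)`, for a function `f` on the interior of `S`. For `k = ∞` this is the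
intersection of all `ρ^j C^∞(S)`, that is `f` is Schwartz at the boundary. -/
def MemRhoSmooth (S : Set M) (ρ : M → ℝ) (k : ℕ∞) (f : M → ℝ) : Prop :=
  ∀ j : ℕ, (j : ℕ∞) ≤ k → ∃ a : M → ℝ, ContMDiffOn I 𝓘(ℝ, ℝ) ∞ a S ∧
    ∀ x ∈ S, 0 < ρ x → f x = ρ x ^ j * a x

/-- `V` is a b-vector field on `S`: smooth up to the boundary and tangent to it, `dρ(V) = 0`. -/
structure IsBField [IsManifold I ∞ M] (S : Set M) (ρ : M → ℝ) (V : VField I M) : Prop where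
  contMDiffOn : ContMDiffOn I I.tangent ∞ (fun x => (⟨x, V x⟩ : TangentBundle I M)) S
  tangent : ∀ x ∈ S, ρ x = 0 → mfderivWithin I 𝓘(ℝ, ℝ) ρ S x (V x) = (0 : ℝ)

/-- The derivative `V u` of a function along a vector field. -/
def vfDeriv (V : VField I M) (u : M → ℝ) : M → ℝ :=
  fun x => (mfderiv I 𝓘(ℝ, ℝ) u x (V x) : ℝ)

/-- `P ∈ Diff_b^m(S)`: on smooth functions on the interior, `P` is a linear combination, with
coefficients in `C^∞(S)`, of compositions of at most `m` b-vector fields. -/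
def IsDiffB [IsManifold I ∞ M] (S : Set M) (ρ : M → ℝ) (m : ℕ)
    (P : (M → ℝ) → M → ℝ) : Prop :=
  ∃ (N : ℕ) (a : Fin N → M → ℝ) (L : Fin N → List (VField I M)),
    (∀ i, ContMDiffOn I 𝓘(ℝ, ℝ) ∞ (a i) S) ∧
    (∀ i, (L i).length ≤ m ∧ ∀ V ∈ L i, IsBField I S ρ V) ∧
    ∀ u : M → ℝ, IsSmoothInterior I S ρ u → ∀ x ∈ S, 0 < ρ x →
      P u x = ∑ i, a i x * (L i).foldr (fun V w => vfDeriv I V w) u x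

/-- `P ∈ ρ^k Diff_b^m(S)`; for `k = ∞` this is the intersection of all `ρ^j Diff_b^m(S)`. -/
def IsWeightedDiffB [IsManifold I ∞ M] (S : Set M) (ρ : M → ℝ) (k : ℕ∞) (m : ℕ)
    (P : (M → ℝ) → M → ℝ) : Prop :=
  ∀ j : ℕ, (j : ℕ∞) ≤ k → ∃ Q : (M → ℝ) → M → ℝ, IsDiffB I S ρ m Q ∧
    ∀ u : M → ℝ, IsSmoothInterior I S ρ u → ∀ x ∈ S, 0 < ρ x → P u x = ρ x ^ j * Q u x

/-- `κ ∈ ρ^k C^∞(S; Sym² (sc-cotangent bundle))`: a field of symmetric bilinear forms over the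
interior such that `κ(ρ V, ρ W) ∈ ρ^k C^∞(S)` for all b-vector fields `V`, `W`, so that
`ρ V`, `ρ W` are arbitrary sc-vector fields. -/
structure MemScSymTwo [IsManifold I ∞ M] (S : Set M) (ρ : M → ℝ) (k : ℕ∞)
    (κ : BilinField I M) : Prop where
  symm : ∀ x ∈ S, 0 < ρ x → ∀ v w : TangentSpace I x, κ x v w = κ x w v
  smooth : ∀ V W : VField I M, IsBField I S ρ V → IsBField I S ρ W →
    MemRhoSmooth I S ρ k (fun x => κ x (ρ x • V x) (ρ x • W x))

end BCalculus

/-! ### The boundary collar and the exactly conic metric -/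

section Collar

/-- The model with corners of `ℝ × Y`, for an `n`-dimensional manifold `Y` without boundary. -/
abbrev cylModel (n : ℕ) :
    ModelWithCorners ℝ (ℝ × EuclideanSpace ℝ (Fin n)) (ModelProd ℝ (EuclideanSpace ℝ (Fin n))) :=
  𝓘(ℝ, ℝ).prod (𝓡 n)

/-- The cylinder `[0,1) × Y`. -/
abbrev cyl (Y : Type*) : Set (ℝ × Y) := Ico (0 : ℝ) 1 ×ˢ univ

/-- The interior `(0,1) × Y` of the cylinder. -/
abbrev cylInterior (Y : Type*) : Set (ℝ × Y) := Ioo (0 : ℝ) 1 ×ˢ univ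

/-- `φ` restricts to a boundary collar of `X`, that is a smooth embedding of `[0,1) × Y` onto an
open subset of `X` which identifies `{0} × Y` with the boundary of `X`, and `ρ` is a smooth
function on `X`, nonnegative and vanishing exactly on the boundary, which extends the coordinate
`(s, θ) ↦ s` of the collar. -/
structure IsBoundaryCollar (n : ℕ)
    {X : Type*} [TopologicalSpace X] [ChartedSpace (EuclideanHalfSpace (n + 1)) X]
    {Y : Type*} [TopologicalSpace Y] [ChartedSpace (EuclideanSpace ℝ (Fin n)) Y]
    (φ : ℝ × Y → X) (ρ : X → ℝ) : Prop where
  contMDiffOn : ContMDiffOn (cylModel n) (𝓡∂ (n + 1)) ∞ φ (cyl Y)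
  isOpen_image : IsOpen (φ '' cyl Y)
  exists_inverse : ∃ ψ : X → ℝ × Y,
    ContMDiffOn (𝓡∂ (n + 1)) (cylModel n) ∞ ψ (φ '' cyl Y) ∧ ∀ p ∈ cyl Y, ψ (φ p) = p
  image_boundary : φ '' ({(0 : ℝ)} ×ˢ univ) = (𝓡∂ (n + 1)).boundary X
  rho_contMDiff : ContMDiff (𝓡∂ (n + 1)) 𝓘(ℝ, ℝ) ∞ ρ
  rho_nonneg : ∀ x, 0 ≤ ρ x
  rho_eq_zero_iff : ∀ x, ρ x = 0 ↔ x ∈ (𝓡∂ (n + 1)).boundary X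
  rho_collar : ∀ p ∈ cyl Y, ρ (φ p) = p.1

/-- The form `dr² = ρ^{-4} dρ²` on `(0,1) × Y`, where `r = ρ^{-1}`. -/
def drSq (n : ℕ) (Y : Type*) [TopologicalSpace Y] [ChartedSpace (EuclideanSpace ℝ (Fin n)) Y] :
    BilinField (cylModel n) (ℝ × Y) :=
  fun p => (p.1 ^ 4)⁻¹ • pullbackForm (cylModel n) 𝓘(ℝ, ℝ) (Prod.fst : ℝ × Y → ℝ)
    (fun _ => ContinuousLinearMap.mul ℝ ℝ) p

/-- The exactly conic metric `g₀ = dr² + r² h` on `(0,1) × Y`, where `r = ρ^{-1}`. -/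
def conicMetric {n : ℕ} {Y : Type*} [TopologicalSpace Y]
    [ChartedSpace (EuclideanSpace ℝ (Fin n)) Y] (h : BilinField (𝓡 n) Y) : BilinField (cylModel n) (ℝ × Y) :=
  fun p => drSq n Y p + (p.1 ^ 2)⁻¹ • pullbackForm (cylModel n) (𝓡 n) (Prod.snd : ℝ × Y → Y) h p

/-- `P`, an operator on functions on `(0,1) × Y`, belongs to `ρ^k Diff_b^m([0,1) × Y)`, and on
each smaller collar `{ρ < c}`, `c < 1`, it is the restriction of an element of
`ρ^k Diff_b^m(X)`. -/
def IsCollarWeightedDiffB (n : ℕ)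
    {X : Type*} [TopologicalSpace X] [ChartedSpace (EuclideanHalfSpace (n + 1)) X]
    {Y : Type*} [TopologicalSpace Y] [ChartedSpace (EuclideanSpace ℝ (Fin n)) Y]
    [IsManifold (𝓡∂ (n + 1)) ∞ X] [IsManifold (𝓡 n) ∞ Y]
    (φ : ℝ × Y → X) (ρ : X → ℝ) (k : ℕ∞) (m : ℕ) (P : (ℝ × Y → ℝ) → ℝ × Y → ℝ) : Prop :=
  IsWeightedDiffB (cylModel n) (cyl Y) Prod.fst k m P ∧
  ∀ c : ℝ, c < 1 → ∃ Q : (X → ℝ) → X → ℝ, IsWeightedDiffB (𝓡∂ (n + 1)) univ ρ k m Q ∧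
    ∀ u : X → ℝ, IsSmoothInterior (𝓡∂ (n + 1)) univ ρ u →
      ∀ s ∈ Ioo (0 : ℝ) c, ∀ θ : Y, P (u ∘ φ) (s, θ) = Q u (φ (s, θ))

end Collar

end

/-! Set ρ = eᵗ. Then ρ∂_ρ and the angular coordinate fields form a coordinate frame V_a in (t, θ).
In this frame a metric near the boundary has Gram matrix ρ⁻²K, where K is its Gram matrix in the
sc-frame ρV_a. For the metrics considered here K is smooth and invertible up to ρ = 0, although the
metric itself blows up there. The divergence formula then gives Δ = -ρ²(∑ K^{ab} V_a V_b + ∑ c^b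
V_b), with c^b an explicit expression in K⁻¹, det K, their V-derivatives and ρ⁻¹V_aρ
(`flatLaplacian_conformal`, `laplaceBeltrami_frame`). So Δ lies in ρ² Diff_b².

Perturbations are controlled by the ideal ρ^j C^∞. It is stable under b-vector fields because V(ρ^j)
= jρ^j(ρ⁻¹Vρ), and congruence modulo it passes to determinants, inverses and the coefficients c^b
(`CongrMod`). Changing K by ρ^j C^∞ therefore changes Δ by ρ^{2+j} Diff_b²
(`isDiffBNear_laplaceBeltrami_sub`).

The purely radial operator A comes from an intermediate metric f(ρ)dr² + r²h. In the coordinates (r,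
θ) its volume density and inverse separate variables, so its Laplacian differs from the conic one
only by derivatives in r (`laplaceBeltrami_warpedMetric_radial`), and 1/f - 1 in ρ^{1+k} C^∞ gives
the weight 3+k. The choice f = 1+F may fail to be positive away from the boundary. Hence F is cut
off near ρ = 0 (`exists_small_cutoff`); the discarded part vanishes near the boundary, lies in every
ρ^j C^∞, and is added to κ. This combined error produces B.

Two globalizations remain. Local operators are patched by a partition of unity on the compact
manifold Y (`isDiffB_of_isDiffBNear`), and operators on the collar are carried to X by cutting off
coefficients and vector fields (`isCollarWeightedDiffB`). Since the Laplace–Beltrami operator is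
defined at each point in the chart at that point, every computation in other coordinates rests on
its invariance, which follows from Δu = -½ tr_g(L_{grad u} g) (`flatLaplacian_eq_trace`,
`flatLaplacian_comp`). -/

noncomputable section

set_option linter.unusedSectionVars false

/-! ### The Laplace--Beltrami operator in linear coordinates -/

section Flat

open Filter Topology Matrix

variable {E : Type*} [NormedAddCommGroup E] [NormedSpace ℝ E]
  {E₂ : Type*} [NormedAddCommGroup E₂] [NormedSpace ℝ E₂]
  {ι : Type*} [Fintype ι] [DecidableEq ι]
  {ι₂ : Type*} [Fintype ι₂] [DecidableEq ι₂]

/-- The expression of the Laplace--Beltrami operator in the linear coordinates of a basis, for a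
metric with Gram matrix `G`. -/
def flatLaplacian (b : ι → E) (G : E → Matrix ι ι ℝ) (u : E → ℝ) (y : E) : ℝ :=
  -((Real.sqrt (G y).det)⁻¹ *
    ∑ i, fderiv ℝ (fun z : E => ∑ j, Real.sqrt (G z).det * (G z)⁻¹ i j * fderiv ℝ u z (b j)) y (b i))

/-- The determinant as a continuous multilinear function of the rows. -/
def detMultilinear (ι : Type*) [Fintype ι] [DecidableEq ι] :
    ContinuousMultilinearMap ℝ (fun _ : ι => ι → ℝ) ℝ where
  toMultilinearMap := (Matrix.detRowAlternating (R := ℝ) (n := ι)).toMultilinearMap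
  cont := by
    change Continuous fun M : Matrix ι ι ℝ => M.det
    exact continuous_id.matrix_det

/-- The determinant is multilinear in the rows, so its derivative varies one row at a time. Each
resulting determinant is a Cramer expression, whose coefficients are adjugate entries. -/
theorem hasFDerivAt_det {A : E → Matrix ι ι ℝ} {A' : E →L[ℝ] (ι → ι → ℝ)} {y : E}
    (hA : HasFDerivAt (fun z => (A z : ι → ι → ℝ)) A' y) :
    DifferentiableAt ℝ (fun z => (A z).det) y ∧
    ∀ v, fderiv ℝ (fun z => (A z).det) y v = ∑ i, ∑ j, (A y).adjugate j i * A' v i j := by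
  have h := ((detMultilinear ι).hasFDerivAt (x := A y)).comp y hA
  have h' : HasFDerivAt (fun z => (A z).det) (((detMultilinear ι).linearDeriv (A y)).comp A') y := h
  refine ⟨h'.differentiableAt, fun v => ?_⟩
  rw [h'.fderiv]
  refine (ContinuousMultilinearMap.linearDeriv_apply (detMultilinear ι) (A y) (A' v)).trans ?_
  refine Finset.sum_congr rfl fun i _ => ?_
  change ((A y).updateRow i (A' v i)).det = _
  rw [← Matrix.cramer_transpose_apply, Matrix.cramer_eq_adjugate_mulVec, Matrix.mulVec,
    dotProduct]
  refine Finset.sum_congr rfl fun j _ => ?_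
  rw [← Matrix.adjugate_transpose]; rfl

theorem differentiableAt_matrix {A : E → Matrix ι ι ℝ} {y : E}
    (hA : ∀ i j, DifferentiableAt ℝ (fun z => A z i j) y) :
    DifferentiableAt ℝ (fun z => (A z : ι → ι → ℝ)) y :=
  differentiableAt_pi.2 fun i => differentiableAt_pi.2 fun j => hA i j

theorem differentiableAt_det {A : E → Matrix ι ι ℝ} {y : E}
    (hA : ∀ i j, DifferentiableAt ℝ (fun z => A z i j) y) :
    DifferentiableAt ℝ (fun z => (A z).det) y :=
  (hasFDerivAt_det (differentiableAt_matrix hA).hasFDerivAt).1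

/-- Jacobi's formula. -/
theorem fderiv_det {A : E → Matrix ι ι ℝ} {y : E}
    (hA : ∀ i j, DifferentiableAt ℝ (fun z => A z i j) y) (v : E) :
    fderiv ℝ (fun z => (A z).det) y v =
      ∑ i, ∑ j, (A y).adjugate j i * fderiv ℝ (fun z => A z i j) y v := by
  rw [(hasFDerivAt_det (differentiableAt_matrix hA).hasFDerivAt).2]
  refine Finset.sum_congr rfl fun i _ => Finset.sum_congr rfl fun j _ => ?_
  have h : HasFDerivAt (fun z => A z i j)
      (((ContinuousLinearMap.proj j : (ι → ℝ) →L[ℝ] ℝ).comp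
        (ContinuousLinearMap.proj i : (ι → ι → ℝ) →L[ℝ] ι → ℝ)).comp
        (fderiv ℝ (fun z => (A z : ι → ι → ℝ)) y)) y :=
    ContinuousLinearMap.hasFDerivAt
      ((ContinuousLinearMap.proj j : (ι → ℝ) →L[ℝ] ℝ).comp
        (ContinuousLinearMap.proj i : (ι → ι → ℝ) →L[ℝ] ι → ℝ)) |>.comp y
      (differentiableAt_matrix hA).hasFDerivAt
  rw [h.fderiv]; rfl

/-- The Gram matrix of a bilinear form. -/
def gramMatrix (b : ι → E) (B : E →L[ℝ] E →L[ℝ] ℝ) : Matrix ι ι ℝ :=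
  Matrix.of fun i j => B (b i) (b j)

theorem gramMatrix_isHermitian (b : ι → E) (B : E →L[ℝ] E →L[ℝ] ℝ) (hs : ∀ v w, B v w = B w v) :
    (gramMatrix b B).IsHermitian :=
  Matrix.IsHermitian.ext fun i j => by simp [gramMatrix, hs (b i) (b j)]

theorem gramMatrix_posDef (b : Module.Basis ι ℝ E) (B : E →L[ℝ] E →L[ℝ] ℝ)
    (hs : ∀ v w, B v w = B w v) (hp : ∀ v, v ≠ 0 → 0 < B v v) : (gramMatrix b B).PosDef := by
  refine Matrix.PosDef.of_dotProduct_mulVec_pos (gramMatrix_isHermitian b B hs) fun x hx => ?_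
  have h : star x ⬝ᵥ (gramMatrix b B *ᵥ x) = B (∑ i, x i • b i) (∑ i, x i • b i) := by
    simp only [dotProduct, mulVec, gramMatrix, map_sum, map_smul,
      Finset.mul_sum, Pi.star_apply, star_trivial, Matrix.of_apply, _root_.sum_apply, _root_.smul_apply, smul_eq_mul]
    rw [Finset.sum_comm]
    refine Finset.sum_congr rfl fun i _ => Finset.sum_congr rfl fun j _ => ?_
    ring
  rw [h]
  refine hp _ fun h0 => hx ?_
  have := Fintype.linearIndependent_iff.1 b.linearIndependent x h0
  exact funext this

theorem gramMatrix_det_pos (b : Module.Basis ι ℝ E) (B : E →L[ℝ] E →L[ℝ] ℝ)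
    (hs : ∀ v w, B v w = B w v) (hp : ∀ v, v ≠ 0 → 0 < B v v) : 0 < (gramMatrix b B).det :=
  (gramMatrix_posDef b B hs hp).det_pos

theorem symm_inv {G : Matrix ι ι ℝ} (hG : G.IsHermitian) (i j : ι) : G⁻¹ i j = G⁻¹ j i := by
  have := congrFun (congrFun hG.inv j) i
  simpa using this

/-- The trace of a bilinear form with respect to an inner product does not depend on the basis. -/
theorem trace_gram_comp (b : Module.Basis ι ℝ E) (b₂ : Module.Basis ι₂ ℝ E₂)
    (G₂ S₂ : E₂ →L[ℝ] E₂ →L[ℝ] ℝ) (G₁ S₁ : E →L[ℝ] E →L[ℝ] ℝ)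
    (J : E →L[ℝ] E₂) (K : E₂ →L[ℝ] E) (hJK : ∀ x, J (K x) = x) (hKJ : ∀ x, K (J x) = x)
    (hG : ∀ v w, G₁ v w = G₂ (J v) (J w)) (hS : ∀ v w, S₁ v w = S₂ (J v) (J w))
    (hdet : IsUnit (gramMatrix b₂ G₂).det) :
    ((gramMatrix b G₁)⁻¹ * (gramMatrix b S₁)ᵀ).trace =
      ((gramMatrix b₂ G₂)⁻¹ * (gramMatrix b₂ S₂)ᵀ).trace := by
  set P : Matrix ι₂ ι ℝ := LinearMap.toMatrix b b₂ J
  set Q : Matrix ι ι₂ ℝ := LinearMap.toMatrix b₂ b K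
  have hPQ : P * Q = 1 := by
    rw [← LinearMap.toMatrix_comp, ← LinearMap.toMatrix_id b₂]
    congr 1; ext x; exact hJK x
  have hQP : Q * P = 1 := by
    rw [← LinearMap.toMatrix_comp, ← LinearMap.toMatrix_id b]
    congr 1; ext x; exact hKJ x
  have hJ : ∀ i, J (b i) = ∑ k, P k i • b₂ k := fun i => by
    simp only [P, LinearMap.toMatrix_apply]
    exact (b₂.sum_repr (J (b i))).symm
  -- Both forms change by the same congruence P ᵀ · P. The inverse of the first changes by Q = P⁻¹,
  -- and the factors cancel under the cyclic trace.
  have key : ∀ (B₁ : E →L[ℝ] E →L[ℝ] ℝ) (B₂ : E₂ →L[ℝ] E₂ →L[ℝ] ℝ),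
      (∀ v w, B₁ v w = B₂ (J v) (J w)) → gramMatrix b B₁ = Pᵀ * gramMatrix b₂ B₂ * P := by
    intro B₁ B₂ h
    ext i j
    simp only [gramMatrix, Matrix.of_apply, h, hJ, map_sum, map_smul, _root_.sum_apply,
      _root_.smul_apply, smul_eq_mul, Matrix.mul_apply, Matrix.transpose_apply, Finset.sum_mul]
    refine Finset.sum_congr rfl fun k _ => ?_
    rw [Finset.mul_sum]
    refine Finset.sum_congr rfl fun l _ => ?_
    ring
  rw [key G₁ G₂ hG, key S₁ S₂ hS]
  have hinv : (Pᵀ * gramMatrix b₂ G₂ * P)⁻¹ = Q * (gramMatrix b₂ G₂)⁻¹ * Qᵀ := by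
    apply Matrix.inv_eq_right_inv
    calc Pᵀ * gramMatrix b₂ G₂ * P * (Q * (gramMatrix b₂ G₂)⁻¹ * Qᵀ)
        = Pᵀ * (gramMatrix b₂ G₂ * ((P * Q) * (gramMatrix b₂ G₂)⁻¹)) * Qᵀ := by
          simp only [Matrix.mul_assoc]
      _ = (Q * P)ᵀ := by
          rw [hPQ, Matrix.one_mul, Matrix.mul_nonsing_inv _ hdet, Matrix.mul_one,
            Matrix.transpose_mul]
      _ = 1 := by rw [hQP, Matrix.transpose_one]
  rw [hinv]
  calc (Q * (gramMatrix b₂ G₂)⁻¹ * Qᵀ * (Pᵀ * gramMatrix b₂ S₂ * P)ᵀ).trace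
      = (Q * ((gramMatrix b₂ G₂)⁻¹ * ((P * Q)ᵀ * (gramMatrix b₂ S₂)ᵀ * P))).trace := by
        simp only [Matrix.mul_assoc, Matrix.transpose_mul, Matrix.transpose_transpose]
    _ = ((gramMatrix b₂ G₂)⁻¹ * ((P * Q)ᵀ * (gramMatrix b₂ S₂)ᵀ * (P * Q))).trace := by
        rw [Matrix.trace_mul_comm]; simp only [Matrix.mul_assoc]
    _ = _ := by rw [hPQ]; simp

end Flat

/-! ### Divergence form, Lie derivatives and coordinate invariance -/

section FlatInvariance

open Filter Topology Matrix

variable {E : Type*} [NormedAddCommGroup E] [NormedSpace ℝ E]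
  {E₂ : Type*} [NormedAddCommGroup E₂] [NormedSpace ℝ E₂]
  {ι : Type*} [Fintype ι] [DecidableEq ι]
  {ι₂ : Type*} [Fintype ι₂] [DecidableEq ι₂]

/-- The components of the gradient. -/
theorem sum_gram_inv_mul (b : Module.Basis ι ℝ E) (B : E →L[ℝ] E →L[ℝ] ℝ)
    (hs : ∀ v w, B v w = B w v) (hdet : IsUnit (gramMatrix b B).det) (v : E) (i : ι) :
    ∑ j, (gramMatrix b B)⁻¹ i j * B v (b j) = b.repr v i := by
  have h : ∀ j, B v (b j) = (gramMatrix b B *ᵥ (b.repr v)) j := fun j => by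
    conv_lhs => rw [← b.sum_repr v]
    simp only [map_sum, map_smul, _root_.sum_apply, _root_.smul_apply, smul_eq_mul, mulVec,
      dotProduct, gramMatrix, Matrix.of_apply]
    exact Finset.sum_congr rfl fun k _ => by rw [hs (b j) (b k), mul_comm]
  have : ((gramMatrix b B)⁻¹ *ᵥ (gramMatrix b B *ᵥ (b.repr v))) i = b.repr v i := by
    rw [Matrix.mulVec_mulVec, Matrix.nonsing_inv_mul _ hdet, Matrix.one_mulVec]
  rw [← this]
  simp only [h]; rfl

/-- Raising the index of ℓ gives its Riesz representative. With ℓ = du this exhibits the gradient by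
a formula from which its differentiability can be read off. -/
theorem bilin_eq_of_basis (b : Module.Basis ι ℝ E) (B : E →L[ℝ] E →L[ℝ] ℝ)
    (hs : ∀ v w, B v w = B w v) (hdet : IsUnit (gramMatrix b B).det) (ℓ : E →L[ℝ] ℝ) (w : E) :
    B (∑ i, (∑ j, (gramMatrix b B)⁻¹ i j * ℓ (b j)) • b i) w = ℓ w := by
  have h : ((B (∑ i, (∑ j, (gramMatrix b B)⁻¹ i j * ℓ (b j)) • b i) : E →L[ℝ] ℝ) : E →ₗ[ℝ] ℝ)
      = (ℓ : E →ₗ[ℝ] ℝ) := by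
    refine b.ext fun k => ?_
    have : (gramMatrix b B *ᵥ ((gramMatrix b B)⁻¹ *ᵥ fun j => ℓ (b j))) k = ℓ (b k) := by
      rw [Matrix.mulVec_mulVec, Matrix.mul_nonsing_inv _ hdet, Matrix.one_mulVec]
    simp only [ContinuousLinearMap.coe_coe, map_sum, map_smul, _root_.sum_apply,
      _root_.smul_apply, smul_eq_mul]
    rw [← this]
    conv_rhs => rw [mulVec, dotProduct]
    refine Finset.sum_congr rfl fun i _ => ?_
    rw [gramMatrix, Matrix.of_apply, hs (b k) (b i), mul_comm]; rfl
  exact LinearMap.congr_fun h w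

theorem differentiableAt_matrix_inv {A : E → Matrix ι ι ℝ} {y : E}
    (hA : ∀ i j, DifferentiableAt ℝ (fun z => A z i j) y) (hdet : (A y).det ≠ 0) (i j : ι) :
    DifferentiableAt ℝ (fun z => (A z)⁻¹ i j) y := by
  simp only [Matrix.inv_def, Matrix.smul_apply, Ring.inverse_eq_inv', smul_eq_mul,
    Matrix.adjugate_apply]
  refine ((differentiableAt_det hA).inv hdet).mul (differentiableAt_det fun k l => ?_)
  by_cases hk : k = j
  · subst hk; simp
  · simp only [Matrix.updateRow_ne hk]; exact hA k l

/-- An operator is the sum of the rank-one operators built from the dual basis and its values on the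
basis, so differentiability can be tested on basis vectors. -/
theorem differentiableAt_clm_of_basis {F : Type*} [NormedAddCommGroup F] [NormedSpace ℝ F]
    (b : Module.Basis ι ℝ E) {L : E₂ → E →L[ℝ] F} {y : E₂}
    (hL : ∀ i, DifferentiableAt ℝ (fun z => L z (b i)) y) : DifferentiableAt ℝ L y := by
  have : FiniteDimensional ℝ E := b.finiteDimensional_of_finite
  let c : ι → E →L[ℝ] ℝ := fun i => LinearMap.toContinuousLinearMap (b.coord i)
  have h : L = fun z => ∑ i, ContinuousLinearMap.smulRightL ℝ E F (c i) (L z (b i)) := by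
    funext z
    ext v
    conv_lhs => rw [← b.sum_repr v]
    rw [map_sum, _root_.sum_apply]
    refine Finset.sum_congr rfl fun i _ => ?_
    rw [map_smul]; rfl
  rw [h]
  exact DifferentiableAt.fun_sum fun i _ =>
    (ContinuousLinearMap.smulRightL ℝ E F (c i)).differentiableAt.comp y (hL i)

/-- A field of bilinear forms is differentiable if its components are. -/
theorem differentiableAt_of_gram (b : Module.Basis ι ℝ E) {B : E₂ → E →L[ℝ] E →L[ℝ] ℝ} {y : E₂}
    (hB : ∀ i j, DifferentiableAt ℝ (fun z => B z (b i) (b j)) y) : DifferentiableAt ℝ B y :=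
  differentiableAt_clm_of_basis b fun i => differentiableAt_clm_of_basis b fun j => hB i j

/-- The Lie derivative of a field of bilinear forms along a vector field. -/
def lieForm (B : E → E →L[ℝ] E →L[ℝ] ℝ) (v : E → E) (y : E) : E →L[ℝ] E →L[ℝ] ℝ :=
  fderiv ℝ B y (v y) + (B y).comp (fderiv ℝ v y) +
    (ContinuousLinearMap.precomp ℝ (fderiv ℝ v y)).comp (B y)

theorem lieForm_apply (B : E → E →L[ℝ] E →L[ℝ] ℝ) (v : E → E) (y w w' : E) :
    lieForm B v y w w' = fderiv ℝ B y (v y) w w' + B y (fderiv ℝ v y w) w' +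
      B y w (fderiv ℝ v y w') := rfl

theorem fderiv_clm_apply₂ {F : Type*} [NormedAddCommGroup F] [NormedSpace ℝ F]
    {B : F → E →L[ℝ] E →L[ℝ] ℝ} {p q : F → E} {y : F}
    (hB : DifferentiableAt ℝ B y) (hp : DifferentiableAt ℝ p y) (hq : DifferentiableAt ℝ q y)
    (x : F) :
    fderiv ℝ (fun z => B z (p z) (q z)) y x =
      fderiv ℝ B y x (p y) (q y) + B y (fderiv ℝ p y x) (q y) + B y (p y) (fderiv ℝ q y x) := by
  rw [fderiv_clm_apply (hB.clm_apply hp) hq, fderiv_clm_apply hB hp]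
  simp only [_root_.add_apply, ContinuousLinearMap.comp_apply,
    ContinuousLinearMap.flip_apply]
  ring

theorem fderiv_gram {B : E → E →L[ℝ] E →L[ℝ] ℝ} {y : E} (hB : DifferentiableAt ℝ B y)
    (v w w' : E) : fderiv ℝ (fun z => B z w w') y v = fderiv ℝ B y v w w' := by
  rw [fderiv_clm_apply₂ hB (differentiableAt_const _) (differentiableAt_const _)]
  simp

/-- The Laplace--Beltrami operator is `-1/2` times the trace of the Lie derivative of the metric
along the gradient. -/
theorem flatLaplacian_eq_trace (b : Module.Basis ι ℝ E) {B : E → E →L[ℝ] E →L[ℝ] ℝ} {v : E → E}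
    {u : E → ℝ} {y : E}
    (hs : ∀ᶠ z in 𝓝 y, ∀ w w', B z w w' = B z w' w)
    (hp : ∀ᶠ z in 𝓝 y, ∀ w, w ≠ 0 → 0 < B z w w)
    (hB : DifferentiableAt ℝ B y) (hv : DifferentiableAt ℝ v y)
    (hgrad : ∀ᶠ z in 𝓝 y, ∀ w, B z (v z) w = fderiv ℝ u z w) :
    flatLaplacian b (fun z => gramMatrix b (B z)) u y =
      -(1 / 2) * ((gramMatrix b (B y))⁻¹ * (gramMatrix b (lieForm B v y))ᵀ).trace := by
  have : FiniteDimensional ℝ E := b.finiteDimensional_of_finite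
  let c : ι → E →L[ℝ] ℝ := fun i => LinearMap.toContinuousLinearMap (b.coord i)
  have hc : ∀ i x, c i x = b.repr x i := fun i x => rfl
  set D : E → ℝ := fun z => (gramMatrix b (B z)).det with hD
  have hGd : ∀ i j, DifferentiableAt ℝ (fun z => gramMatrix b (B z) i j) y := fun i j =>
    (hB.clm_apply (differentiableAt_const (b i))).clm_apply (differentiableAt_const (b j))
  have hDd : DifferentiableAt ℝ D y := differentiableAt_det hGd
  have hsy := hs.self_of_nhds
  have hDpos : 0 < D y := gramMatrix_det_pos b (B y) hsy hp.self_of_nhds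
  have hunit : IsUnit (gramMatrix b (B y)).det := hDpos.ne'.isUnit
  -- The inner sum is √D times the i-th component of the gradient, so the operator becomes the
  -- divergence of v with respect to the density √D.
  have hcomp : ∀ i, (fun z => ∑ j, Real.sqrt (D z) * (gramMatrix b (B z))⁻¹ i j *
      fderiv ℝ u z (b j)) =ᶠ[𝓝 y] fun z => Real.sqrt (D z) * c i (v z) := fun i => by
    filter_upwards [hs, hp, hgrad] with z h1 h2 h3
    rw [hc, ← sum_gram_inv_mul b (B z) h1 (gramMatrix_det_pos b (B z) h1 h2).ne'.isUnit,
      Finset.mul_sum]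
    exact Finset.sum_congr rfl fun j _ => by rw [h3, mul_assoc]
  have hcd : ∀ i, DifferentiableAt ℝ (fun z => c i (v z)) y := fun i =>
    (c i).differentiableAt.comp y hv
  have hcf : ∀ i x, fderiv ℝ (fun z => c i (v z)) y x = c i (fderiv ℝ v y x) := fun i x => by
    have : HasFDerivAt (fun z => c i (v z)) ((c i).comp (fderiv ℝ v y)) y :=
      (c i).hasFDerivAt.comp y hv.hasFDerivAt
    rw [this.fderiv]; rfl
  have hsum : ∀ (ℓ : E →L[ℝ] ℝ) (x : E), ∑ i, c i x * ℓ (b i) = ℓ x := fun ℓ x => by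
    conv_rhs => rw [← b.sum_repr x]
    simp only [hc, map_sum, map_smul, smul_eq_mul]
  have hsq : DifferentiableAt ℝ (fun z => Real.sqrt (D z)) y := hDd.sqrt hDpos.ne'
  have hsqpos : 0 < Real.sqrt (D y) := Real.sqrt_pos.2 hDpos
  have hinv : ∀ i j, D y * (gramMatrix b (B y))⁻¹ i j = (gramMatrix b (B y)).adjugate i j :=
    fun i j => by
      rw [Matrix.inv_def, Matrix.smul_apply, Ring.inverse_eq_inv', smul_eq_mul, ← mul_assoc]
      change D y * (D y)⁻¹ * _ = _
      rw [mul_inv_cancel₀ hDpos.ne', one_mul]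
  have hsymm : ∀ i j, (gramMatrix b (B y))⁻¹ i j = (gramMatrix b (B y))⁻¹ j i :=
    symm_inv (gramMatrix_isHermitian b (B y) hsy)
  have hDv : fderiv ℝ D y (v y) =
      D y * ∑ i, ∑ j, (gramMatrix b (B y))⁻¹ i j * fderiv ℝ B y (v y) (b i) (b j) := by
    rw [hD, fderiv_det hGd, Finset.mul_sum]
    refine Finset.sum_congr rfl fun i _ => ?_
    rw [Finset.mul_sum]
    refine Finset.sum_congr rfl fun j _ => ?_
    rw [← hinv, hsymm j i, mul_assoc]
    congr 2
    exact fderiv_gram hB _ _ _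
  have hT : ∀ i, ∑ j, (gramMatrix b (B y))⁻¹ i j * B y (fderiv ℝ v y (b i)) (b j) =
      c i (fderiv ℝ v y (b i)) := fun i => sum_gram_inv_mul b (B y) hsy hunit _ i
  have hL : flatLaplacian b (fun z => gramMatrix b (B z)) u y =
      -((Real.sqrt (D y))⁻¹ * ∑ i, fderiv ℝ (fun z => Real.sqrt (D z) * c i (v z)) y (b i)) := by
    unfold flatLaplacian
    refine congrArg (fun x => -((Real.sqrt (D y))⁻¹ * x)) (Finset.sum_congr rfl fun i _ => ?_)
    exact congrArg (fun φ : E →L[ℝ] ℝ => φ (b i)) (hcomp i).fderiv_eq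
  have hsum1 : ∑ i, fderiv ℝ (fun z => Real.sqrt (D z) * c i (v z)) y (b i) =
      fderiv ℝ D y (v y) / (2 * Real.sqrt (D y)) +
        Real.sqrt (D y) * ∑ i, c i (fderiv ℝ v y (b i)) := by
    have : ∀ i, fderiv ℝ (fun z => Real.sqrt (D z) * c i (v z)) y (b i) =
        c i (v y) * fderiv ℝ (fun z => Real.sqrt (D z)) y (b i) +
          Real.sqrt (D y) * c i (fderiv ℝ v y (b i)) := fun i => by
      rw [fderiv_fun_mul hsq (hcd i)]
      simp only [_root_.add_apply, _root_.smul_apply, smul_eq_mul, hcf]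
      ring
    rw [Finset.sum_congr rfl fun i _ => this i, Finset.sum_add_distrib, hsum, ← Finset.mul_sum,
      fderiv_sqrt hDd hDpos.ne']
    simp only [_root_.smul_apply, smul_eq_mul]
    ring
  -- Differentiating the metric contributes the logarithmic derivative of D by Jacobi's formula;
  -- each of the two remaining terms of the Lie derivative has trace ∑ ∂_i vⁱ. The total is twice
  -- the divergence.
  have hR : ((gramMatrix b (B y))⁻¹ * (gramMatrix b (lieForm B v y))ᵀ).trace =
      fderiv ℝ D y (v y) / D y + 2 * ∑ i, c i (fderiv ℝ v y (b i)) := by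
    have h1 : ((gramMatrix b (B y))⁻¹ * (gramMatrix b (lieForm B v y))ᵀ).trace =
        ∑ i, ∑ j, (gramMatrix b (B y))⁻¹ i j * lieForm B v y (b i) (b j) := by
      simp only [Matrix.trace, Matrix.diag_apply, Matrix.mul_apply, Matrix.transpose_apply]
      rfl
    have h3 : ∑ i, ∑ j, (gramMatrix b (B y))⁻¹ i j * B y (b i) (fderiv ℝ v y (b j)) =
        ∑ i, c i (fderiv ℝ v y (b i)) := by
      rw [Finset.sum_comm]
      refine Finset.sum_congr rfl fun j _ => ?_
      rw [← hT j]
      exact Finset.sum_congr rfl fun i _ => by rw [hsymm i j, hsy (b i)]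
    simp only [h1, lieForm_apply, mul_add, Finset.sum_add_distrib]
    rw [h3, Finset.sum_congr rfl fun i _ => hT i, hDv, mul_div_cancel_left₀ _ hDpos.ne']
    ring
  rw [hL, hsum1, hR]
  have hq : Real.sqrt (D y) * Real.sqrt (D y) = D y := Real.mul_self_sqrt hDpos.le
  have h4 : (Real.sqrt (D y))⁻¹ * (fderiv ℝ D y (v y) / (2 * Real.sqrt (D y))) =
      fderiv ℝ D y (v y) / (2 * D y) := by
    rw [← mul_div_assoc, inv_mul_eq_div, div_div]
    congr 1
    linarith
  rw [mul_add, h4, inv_mul_cancel_left₀ hsqpos.ne']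
  field_simp

/-- Invariance of the Laplace--Beltrami operator under changes of coordinates. -/
theorem flatLaplacian_comp (b : Module.Basis ι ℝ E) (b₂ : Module.Basis ι₂ ℝ E₂)
    {T : E → E₂} {S : E₂ → E} {y : E} {B₁ : E → E →L[ℝ] E →L[ℝ] ℝ} {B₂ : E₂ → E₂ →L[ℝ] E₂ →L[ℝ] ℝ}
    {u₁ : E → ℝ} {u₂ : E₂ → ℝ}
    (hT : ContDiffAt ℝ ∞ T y) (hS : ContDiffAt ℝ ∞ S (T y))
    (hST : ∀ᶠ z in 𝓝 y, S (T z) = z) (hTS : ∀ᶠ z in 𝓝 (T y), T (S z) = z)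
    (hB : ∀ᶠ z in 𝓝 y, ∀ w w', B₁ z w w' = B₂ (T z) (fderiv ℝ T z w) (fderiv ℝ T z w'))
    (hB₂ : DifferentiableAt ℝ B₂ (T y))
    (hs : ∀ᶠ z in 𝓝 (T y), ∀ w w', B₂ z w w' = B₂ z w' w)
    (hp : ∀ᶠ z in 𝓝 (T y), ∀ w, w ≠ 0 → 0 < B₂ z w w)
    (hu₂ : ContDiffAt ℝ 2 u₂ (T y)) (hu : u₁ =ᶠ[𝓝 y] fun z => u₂ (T z)) :
    flatLaplacian b (fun z => gramMatrix b (B₁ z)) u₁ y =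
      flatLaplacian b₂ (fun z => gramMatrix b₂ (B₂ z)) u₂ (T y) := by
  have hne : (∞ : WithTop ℕ∞) ≠ 0 := by simp
  have h2le : (1 + 1 : WithTop ℕ∞) ≤ ∞ := by
    rw [one_add_one_eq_two]; exact ENat.LEInfty.out
  have hTy : ContinuousAt T y := hT.continuousAt
  have hTev : ∀ᶠ z in 𝓝 y, ContDiffAt ℝ 1 T z :=
    (hT.of_le (by exact_mod_cast le_top : (1 : WithTop ℕ∞) ≤ ∞)).eventually (by simp)
  have hSev : ∀ᶠ z in 𝓝 (T y), ContDiffAt ℝ 1 S z :=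
    (hS.of_le (by exact_mod_cast le_top : (1 : WithTop ℕ∞) ≤ ∞)).eventually (by simp)
  have huev : ∀ᶠ z in 𝓝 (T y), ContDiffAt ℝ 2 u₂ z := hu₂.eventually (by simp)
  have hKJ : ∀ᶠ z in 𝓝 y, ∀ w, fderiv ℝ S (T z) (fderiv ℝ T z w) = w := by
    filter_upwards [hTev, hTy.eventually hSev, hST.eventually_nhds] with z h1 h2 h3 w
    have h4 := ((h2.differentiableAt one_ne_zero).hasFDerivAt.comp z
      (h1.differentiableAt one_ne_zero).hasFDerivAt).congr_of_eventuallyEq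
        (show (fun x => x) =ᶠ[𝓝 z] S ∘ T from h3.mono fun x hx => hx.symm)
    have h5 := h4.unique (hasFDerivAt_id z)
    exact congrArg (fun φ : E →L[ℝ] E => φ w) h5
  have hJK : ∀ᶠ z in 𝓝 y, ∀ w, fderiv ℝ T z (fderiv ℝ S (T z) w) = w := by
    filter_upwards [hTev, hTy.eventually hSev, hTy.eventually hTS.eventually_nhds, hST]
      with z h1 h2 h3 h6 w
    have h1' : HasFDerivAt T (fderiv ℝ T z) (S (T z)) := by
      rw [h6]; exact (h1.differentiableAt one_ne_zero).hasFDerivAt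
    have h4 := (h1'.comp (T z) (h2.differentiableAt one_ne_zero).hasFDerivAt).congr_of_eventuallyEq
        (show (fun x => x) =ᶠ[𝓝 (T z)] T ∘ S from h3.mono fun x hx => hx.symm)
    have h5 := h4.unique (hasFDerivAt_id (T z))
    exact congrArg (fun φ : E₂ →L[ℝ] E₂ => φ w) h5
  -- the gradient in the second coordinates
  set v₂ : E₂ → E₂ := fun z =>
    ∑ i, (∑ j, (gramMatrix b₂ (B₂ z))⁻¹ i j * fderiv ℝ u₂ z (b₂ j)) • b₂ i with hv₂def
  have hgrad₂ : ∀ᶠ z in 𝓝 (T y), ∀ w, B₂ z (v₂ z) w = fderiv ℝ u₂ z w := by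
    filter_upwards [hs, hp] with z h1 h2 w
    exact bilin_eq_of_basis b₂ (B₂ z) h1 (gramMatrix_det_pos b₂ (B₂ z) h1 h2).ne'.isUnit _ w
  have hdet : 0 < (gramMatrix b₂ (B₂ (T y))).det :=
    gramMatrix_det_pos b₂ _ hs.self_of_nhds hp.self_of_nhds
  have hdu : DifferentiableAt ℝ (fderiv ℝ u₂) (T y) :=
    (hu₂.fderiv_right (m := 1) (by norm_num)).differentiableAt one_ne_zero
  have hv₂ : DifferentiableAt ℝ v₂ (T y) :=
    DifferentiableAt.fun_sum fun i _ => DifferentiableAt.smul_const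
      (DifferentiableAt.fun_sum fun j _ =>
        (differentiableAt_matrix_inv (A := fun z => gramMatrix b₂ (B₂ z))
          (fun k l => (hB₂.clm_apply (differentiableAt_const (b₂ k))).clm_apply
            (differentiableAt_const (b₂ l))) hdet.ne' i j).mul
        (hdu.clm_apply (differentiableAt_const (b₂ j)))) _
  -- the gradient in the first coordinates
  set v₁ : E → E := fun z => fderiv ℝ S (T z) (v₂ (T z)) with hv₁def
  have hTd : DifferentiableAt ℝ T y := hT.differentiableAt hne
  have hdT : DifferentiableAt ℝ (fderiv ℝ T) y :=
    (hT.fderiv_right (m := 1) h2le).differentiableAt one_ne_zero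
  have hdS : DifferentiableAt ℝ (fderiv ℝ S) (T y) :=
    (hS.fderiv_right (m := 1) h2le).differentiableAt one_ne_zero
  have hv₂T : DifferentiableAt ℝ (fun z => v₂ (T z)) y := hv₂.comp y hTd
  have hv₁ : DifferentiableAt ℝ v₁ y :=
    (show DifferentiableAt ℝ (fun z => fderiv ℝ S (T z)) y from hdS.comp y hTd).clm_apply hv₂T
  have hgrad₁ : ∀ᶠ z in 𝓝 y, ∀ w, B₁ z (v₁ z) w = fderiv ℝ u₁ z w := by
    filter_upwards [hB, hJK, hTy.eventually hgrad₂, hu.eventually_nhds, hTev,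
      hTy.eventually huev] with z h1 h2 h3 h4 h5 h6 w
    rw [h1, h2, h3]
    have h7 : HasFDerivAt u₁ ((fderiv ℝ u₂ (T z)).comp (fderiv ℝ T z)) z :=
      ((h6.differentiableAt two_ne_zero).hasFDerivAt.comp z
        (h5.differentiableAt one_ne_zero).hasFDerivAt).congr_of_eventuallyEq h4
    rw [h7.fderiv]; rfl
  have hs₁ : ∀ᶠ z in 𝓝 y, ∀ w w', B₁ z w w' = B₁ z w' w := by
    filter_upwards [hB, hTy.eventually hs] with z h1 h2 w w'
    rw [h1, h1, h2]
  have hp₁ : ∀ᶠ z in 𝓝 y, ∀ w, w ≠ 0 → 0 < B₁ z w w := by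
    filter_upwards [hB, hTy.eventually hp, hKJ] with z h1 h2 h3 w hw
    rw [h1]
    refine h2 _ fun h0 => hw ?_
    rw [← h3 w, h0, map_zero]
  have hB₂T : DifferentiableAt ℝ (fun z => B₂ (T z)) y :=
    DifferentiableAt.comp (g := B₂) y hB₂ hTd
  have hTw : ∀ w, DifferentiableAt ℝ (fun z => fderiv ℝ T z w) y := fun w =>
    hdT.clm_apply (differentiableAt_const w)
  have hBe : ∀ w w', (fun z => B₁ z w w') =ᶠ[𝓝 y]
      fun z => B₂ (T z) (fderiv ℝ T z w) (fderiv ℝ T z w') := fun w w' =>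
    hB.mono fun z hz => hz w w'
  have hB₁ : DifferentiableAt ℝ B₁ y := differentiableAt_of_gram b fun i j =>
    ((hB₂T.clm_apply (hTw (b i))).clm_apply (hTw (b j))).congr_of_eventuallyEq (hBe _ _)
  rw [flatLaplacian_eq_trace b hs₁ hp₁ hB₁ hv₁ hgrad₁, flatLaplacian_eq_trace b₂ hs hp hB₂ hv₂ hgrad₂]
  congr 1
  refine trace_gram_comp b b₂ _ _ _ _ (fderiv ℝ T y) (fderiv ℝ S (T y)) hJK.self_of_nhds
    hKJ.self_of_nhds hB.self_of_nhds (fun w w' => ?_) hdet.ne'.isUnit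
  -- The rest is naturality of the Lie derivative. It needs symmetry of the second derivative of T
  -- in order to exchange the direction v₁ with the argument w.
  have hsymm := (hT.isSymmSndFDerivAt (by simpa using ENat.LEInfty.out))
  have hJv : fderiv ℝ T y (v₁ y) = v₂ (T y) := hJK.self_of_nhds _
  -- Obtained by differentiating the relation T′v₁ = v₂ ∘ T between the two gradients.
  have hkey : ∀ w, fderiv ℝ (fderiv ℝ T) y (v₁ y) w + fderiv ℝ T y (fderiv ℝ v₁ y w) =
      fderiv ℝ v₂ (T y) (fderiv ℝ T y w) := fun w => by
    have h1 : (fun z => fderiv ℝ T z (v₁ z)) =ᶠ[𝓝 y] fun z => v₂ (T z) :=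
      hJK.mono fun z hz => hz _
    have h2 := h1.fderiv_eq (𝕜 := ℝ)
    rw [fderiv_clm_apply hdT hv₁] at h2
    have h3 : HasFDerivAt (fun z => v₂ (T z)) ((fderiv ℝ v₂ (T y)).comp (fderiv ℝ T y)) y :=
      hv₂.hasFDerivAt.comp y hTd.hasFDerivAt
    rw [h3.fderiv] at h2
    have h4 := congrArg (fun φ : E →L[ℝ] E₂ => φ w) h2
    simp only [_root_.add_apply, ContinuousLinearMap.comp_apply,
      ContinuousLinearMap.flip_apply] at h4
    rw [← h4, hsymm.eq (v₁ y) w, add_comm]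
  have hBy : ∀ p q, B₁ y p q = B₂ (T y) (fderiv ℝ T y p) (fderiv ℝ T y q) := hB.self_of_nhds
  -- The two terms containing T″ are exactly those absorbed by `hkey` when the Lie derivatives are
  -- compared.
  have hDB : fderiv ℝ B₁ y (v₁ y) w w' =
      fderiv ℝ B₂ (T y) (v₂ (T y)) (fderiv ℝ T y w) (fderiv ℝ T y w') +
        B₂ (T y) (fderiv ℝ (fderiv ℝ T) y (v₁ y) w) (fderiv ℝ T y w') +
        B₂ (T y) (fderiv ℝ T y w) (fderiv ℝ (fderiv ℝ T) y (v₁ y) w') := by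
    rw [← fderiv_gram hB₁, (hBe w w').fderiv_eq, fderiv_clm_apply₂ hB₂T (hTw w) (hTw w')]
    have h3 : HasFDerivAt (fun z => B₂ (T z)) ((fderiv ℝ B₂ (T y)).comp (fderiv ℝ T y)) y :=
      HasFDerivAt.comp (g := B₂) y hB₂.hasFDerivAt hTd.hasFDerivAt
    have h4 : ∀ w, fderiv ℝ (fun z => fderiv ℝ T z w) y (v₁ y) =
        fderiv ℝ (fderiv ℝ T) y (v₁ y) w := fun w => by
      rw [fderiv_clm_apply hdT (differentiableAt_const w)]
      simp
    rw [h3.fderiv, h4, h4, ContinuousLinearMap.comp_apply, hJv]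
  rw [lieForm_apply, lieForm_apply, hDB, hBy, hBy, ← hkey w, ← hkey w']
  simp only [map_add, _root_.add_apply]
  ring

end FlatInvariance

/-! ### The Laplace–Beltrami operator in arbitrary local coordinates -/

section ManifoldInvariance

open Filter Topology

variable {E : Type*} [NormedAddCommGroup E] [NormedSpace ℝ E]
  {H : Type*} [TopologicalSpace H] {I : ModelWithCorners ℝ E H}
  {M : Type*} [TopologicalSpace M] [ChartedSpace H M]
  {E₂ : Type*} [NormedAddCommGroup E₂] [NormedSpace ℝ E₂]
  {ι₂ : Type*} [Fintype ι₂] [DecidableEq ι₂]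

theorem bilinField_congr (g : BilinField I M) {x x' : M} (h : x = x') (v w : E) :
    (g x : E →L[ℝ] E →L[ℝ] ℝ) v w = (g x' : E →L[ℝ] E →L[ℝ] ℝ) v w := by
  subst h; rfl

theorem mfderiv_comp_leftInverse {E' : Type*} [NormedAddCommGroup E'] [NormedSpace ℝ E']
    {H' : Type*} [TopologicalSpace H'] {I' : ModelWithCorners ℝ E' H'}
    {N : Type*} [TopologicalSpace N] [ChartedSpace H' N] {f : M → N} {f' : N → M} {x : M}
    (hf : MDifferentiableAt I I' f x) (hf' : MDifferentiableAt I' I f' (f x))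
    (h : ∀ᶠ z in 𝓝 x, f' (f z) = z) (v : TangentSpace I x) :
    (mfderiv I' I f' (f x) (mfderiv I I' f x v) : E) = v := by
  have h1 := mfderiv_comp x hf' hf
  have h2 : mfderiv I I (f' ∘ f) x = mfderiv I I (fun z => z) x :=
    Filter.EventuallyEq.mfderiv_eq (show f' ∘ f =ᶠ[𝓝 x] fun z => z from h)
  have h3 : mfderiv I I (fun z : M => z) x = ContinuousLinearMap.id ℝ (TangentSpace I x) :=
    mfderiv_id
  have h4 : (mfderiv I I (f' ∘ f) x : E →L[ℝ] E) v =
    (mfderiv I' I f' (f x) (mfderiv I I' f x v) : E) := by rw [h1]; rfl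
  rw [← h4, h2, h3]; rfl

/-- The Laplace--Beltrami operator in arbitrary local coordinates `τ` with local inverse `Φ`. -/
theorem laplaceBeltrami_eq_flatLaplacian [FiniteDimensional ℝ E] [IsManifold I ∞ M]
    (b₂ : Module.Basis ι₂ ℝ E₂) {g : BilinField I M} {u : M → ℝ} {q : M}
    (hq : I.IsInteriorPoint q) {τ : M → E₂} {Φ : E₂ → M}
    (hτ : ContMDiffAt I 𝓘(ℝ, E₂) ∞ τ q) (hΦ : ContMDiffAt 𝓘(ℝ, E₂) I ∞ Φ (τ q))
    (hΦτ : ∀ᶠ x in 𝓝 q, Φ (τ x) = x) (hτΦ : ∀ᶠ z in 𝓝 (τ q), τ (Φ z) = z)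
    (hs : ∀ᶠ x in 𝓝 q, ∀ v w : TangentSpace I x, g x v w = g x w v)
    (hp : ∀ᶠ x in 𝓝 q, ∀ v : TangentSpace I x, v ≠ 0 → 0 < g x v v)
    (hg : ∀ i j, DifferentiableAt ℝ
      (fun z => pullbackForm 𝓘(ℝ, E₂) I Φ g z (b₂ i : E₂) (b₂ j : E₂)) (τ q))
    (hu : ContDiffAt ℝ 2 (fun z => u (Φ z)) (τ q)) :
    laplaceBeltrami I g u q =
      flatLaplacian b₂ (fun z => gramMatrix b₂ (pullbackForm 𝓘(ℝ, E₂) I Φ g z))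
        (fun z => u (Φ z)) (τ q) := by
  have hone : (1 : WithTop ℕ∞) ≤ ∞ := ENat.LEInfty.out
  have : IsManifold I 1 M := IsManifold.of_le hone
  set e := extChartAt I q with he
  have hΦq : Φ (τ q) = q := hΦτ.self_of_nhds
  have heq : e.symm (e q) = q := extChartAt_to_inv q
  -- This is where interiority of q enters: near e q the derivatives within `range I` in the Gram
  -- matrix are full derivatives, as are those taken by `fderiv`.
  have hrange : range I ∈ 𝓝 (e q) := mem_interior_iff_mem_nhds.1 hq
  have hrangeev : ∀ᶠ z in 𝓝 (e q), range I ∈ 𝓝 z := eventually_mem_nhds_iff.2 hrange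
  have htarget : e.target ∈ 𝓝 (e q) := by
    have := extChartAt_target_mem_nhdsWithin (I := I) q
    rwa [nhdsWithin_eq_nhds.2 hrange] at this
  have hsymm : ContMDiffAt 𝓘(ℝ, E) I ∞ e.symm (e q) :=
    (contMDiffOn_extChartAt_symm q).contMDiffAt htarget
  have hsymm' : ∀ᶠ z in 𝓝 (e q), ContMDiffAt 𝓘(ℝ, E) I 1 e.symm z :=
    (contMDiffAt_iff_contMDiffAt_nhds (by simp)).1 (hsymm.of_le hone)
  have hesymm : Tendsto e.symm (𝓝 (e q)) (𝓝 q) := by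
    have := hsymm.continuousAt.tendsto
    rwa [heq] at this
  have hΦt : Tendsto Φ (𝓝 (τ q)) (𝓝 q) := by
    have := hΦ.continuousAt.tendsto
    rwa [hΦq] at this
  have hτ' : ∀ᶠ x in 𝓝 q, ContMDiffAt I 𝓘(ℝ, E₂) 1 τ x := 
    (contMDiffAt_iff_contMDiffAt_nhds (by simp)).1 (hτ.of_le hone)
  have hΦ' : ∀ᶠ z in 𝓝 (τ q), ContMDiffAt 𝓘(ℝ, E₂) I 1 Φ z := 
    (contMDiffAt_iff_contMDiffAt_nhds (by simp)).1 (hΦ.of_le hone)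
  -- T and S are the transition maps between the preferred chart at q and the coordinates τ; the
  -- invariance lemma is applied to them.
  set T : E → E₂ := fun z => τ (e.symm z) with hTdef
  set S : E₂ → E := fun z => e (Φ z) with hSdef
  have hTq : T (e q) = τ q := by rw [hTdef]; exact congrArg τ heq
  have hT : ContDiffAt ℝ ∞ T (e q) := by
    rw [← contMDiffAt_iff_contDiffAt]
    exact ContMDiffAt.comp (e q) (by rw [heq]; exact hτ) hsymm
  have hS : ContDiffAt ℝ ∞ S (τ q) := by
    rw [← contMDiffAt_iff_contDiffAt]
    exact ContMDiffAt.comp (τ q) (by rw [hΦq]; exact contMDiffAt_extChartAt) hΦ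
  have hTt : Tendsto T (𝓝 (e q)) (𝓝 (τ q)) := hτ.continuousAt.tendsto.comp hesymm
  have hST : ∀ᶠ z in 𝓝 (e q), S (T z) = z := by
    filter_upwards [hesymm.eventually hΦτ, htarget] with z h1 h2
    rw [hSdef, hTdef]
    simp only [h1]
    exact e.right_inv h2
  have hTS : ∀ᶠ z in 𝓝 (τ q), T (S z) = z := by
    filter_upwards [hτΦ, hΦt.eventually (extChartAt_source_mem_nhds (I := I) q)] with z h1 h2
    rw [hSdef, hTdef]
    simp only [e.left_inv h2, h1]
  have hL : laplaceBeltrami I g u q =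
      flatLaplacian (Module.finBasis ℝ E) (fun z => gramMatrix (Module.finBasis ℝ E)
        ((ContinuousLinearMap.precomp ℝ (mfderivWithin 𝓘(ℝ, E) I e.symm (range I) z)).comp
          ((g (e.symm z)).comp (mfderivWithin 𝓘(ℝ, E) I e.symm (range I) z))))
        (fun z => u (e.symm z)) (e q) := rfl
  rw [hL, ← hTq]
  rw [← hTq] at hS hTS hg hu hΦt hΦ' hΦ hτΦ
  refine flatLaplacian_comp (Module.finBasis ℝ E) b₂ hT hS hST hTS ?_
    (differentiableAt_of_gram b₂ hg) ?_ ?_ hu ?_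
  · filter_upwards [hrangeev, hsymm', hesymm.eventually hτ', hT.continuousAt.eventually hΦ',
      hesymm.eventually hΦτ, (hesymm.eventually hΦτ.eventually_nhds),
      (hesymm.eventually hΦτ).eventually_nhds] with z h1 h2 h3 h4 h5 h6 h7 w w'
    have hTz : MDifferentiableAt 𝓘(ℝ, E) 𝓘(ℝ, E₂) T z :=
      (h3.comp z h2).mdifferentiableAt one_ne_zero
    have h8 : mfderivWithin 𝓘(ℝ, E) I e.symm (range I) z = mfderiv 𝓘(ℝ, E) I e.symm z :=
      mfderivWithin_of_mem_nhds h1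
    have h9 : mfderiv 𝓘(ℝ, E) I (Φ ∘ T) z = mfderiv 𝓘(ℝ, E) I e.symm z :=
      Filter.EventuallyEq.mfderiv_eq (show Φ ∘ T =ᶠ[𝓝 z] e.symm from h7)
    have h10 := mfderiv_comp z (h4.mdifferentiableAt one_ne_zero) hTz
    have h11 : ∀ x : E, (mfderivWithin 𝓘(ℝ, E) I e.symm (range I) z x : E) =
        mfderiv 𝓘(ℝ, E₂) I Φ (T z) (fderiv ℝ T z x) := fun x => by
      have h12 : (mfderiv 𝓘(ℝ, E) I e.symm z : E →L[ℝ] E) =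
        (mfderiv 𝓘(ℝ, E) I (Φ ∘ T) z : E →L[ℝ] E) := h9.symm
      rw [h8]
      refine (congrArg (fun φ : E →L[ℝ] E => φ x) h12).trans ?_
      rw [h10, mfderiv_eq_fderiv]; rfl
    have h13 := bilinField_congr g h5.symm
      (mfderivWithin 𝓘(ℝ, E) I e.symm (range I) z w) (mfderivWithin 𝓘(ℝ, E) I e.symm (range I) z w')
    refine h13.trans ?_
    have h14 := h11 w
    have h15 := h11 w'
    change (g (Φ (T z)) : E →L[ℝ] E →L[ℝ] ℝ) (mfderivWithin 𝓘(ℝ, E) I e.symm (range I) z w : E)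
      (mfderivWithin 𝓘(ℝ, E) I e.symm (range I) z w' : E) = _
    rw [h14, h15]; rfl
  · filter_upwards [hΦt.eventually hs] with z h1 w w'
    exact h1 _ _
  · filter_upwards [hΦt.eventually hp, hΦt.eventually hτ', hΦ', hτΦ.eventually_nhds]
      with z h1 h2 h3 h4 w hw
    refine h1 _ fun h0 => hw ?_
    have := mfderiv_comp_leftInverse (h3.mdifferentiableAt one_ne_zero)
      (h2.mdifferentiableAt one_ne_zero) h4 w
    refine this.symm.trans ?_
    refine (congrArg (fun x => (mfderiv I 𝓘(ℝ, E₂) τ (Φ z) x : E₂)) h0).trans ?_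
    exact map_zero (mfderiv I 𝓘(ℝ, E₂) τ (Φ z))
  · filter_upwards [hesymm.eventually hΦτ] with z hz
    exact congrArg u hz.symm

end ManifoldInvariance

/-! ### Expansion for a metric ρ⁻²K -/

section Expansion

open Filter Topology Matrix

variable {E : Type*} [NormedAddCommGroup E] [NormedSpace ℝ E]
  {ι : Type*} [Fintype ι] [DecidableEq ι]

theorem inv_smul_matrix (c : ℝ) (hc : c ≠ 0) (K : Matrix ι ι ℝ) (hK : K.det ≠ 0) :
    (c⁻¹ • K)⁻¹ = c • K⁻¹ := by
  apply Matrix.inv_eq_right_inv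
  rw [Matrix.smul_mul, Matrix.mul_smul, smul_smul, inv_mul_cancel₀ hc, one_smul,
    Matrix.mul_nonsing_inv _ hK.isUnit]

/-- The coefficient of `∂_j` in the Laplace--Beltrami operator of the metric `ρ⁻² K`, divided by
`-ρ²`; here `D i` stands for the derivative in the direction of the `i`-th coordinate. -/
def firstOrderCoeff (Kinv : ι → ι → ℝ) (det ρ : ℝ) (DKinv : ι → ι → ι → ℝ) (Ddet Dρ : ι → ℝ)
    (j : ι) : ℝ :=
  ∑ i, (DKinv i i j + 2⁻¹ * det⁻¹ * Ddet i * Kinv i j +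
    (2 - Fintype.card ι : ℝ) * ρ⁻¹ * Dρ i * Kinv i j)

/-- The inverse metric is ρ²K⁻¹, so one factor ρ² comes out of the whole operator. The first order
terms arise by differentiating K⁻¹ and the logarithm of the remaining density; ρ enters them only
through ρ⁻¹ dρ, which stays bounded along a b-frame. -/
theorem flatLaplacian_conformal (b : ι → E) {ρ : E → ℝ} {K G : E → Matrix ι ι ℝ} {u : E → ℝ} {y : E}
    (hG : ∀ᶠ z in 𝓝 y, G z = (ρ z ^ 2)⁻¹ • K z)
    (hK : ∀ i j, DifferentiableAt ℝ (fun z => K z i j) y)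
    (hdet : 0 < (K y).det) (hρ : DifferentiableAt ℝ ρ y) (hρy : 0 < ρ y)
    (hu : ContDiffAt ℝ 2 u y) :
    flatLaplacian b G u y =
      -(ρ y ^ 2 * (∑ i, ∑ j, (K y)⁻¹ i j * fderiv ℝ (fun z => fderiv ℝ u z (b j)) y (b i) +
        ∑ j, firstOrderCoeff (fun i j => (K y)⁻¹ i j) (K y).det (ρ y)
          (fun k i j => fderiv ℝ (fun z => (K z)⁻¹ i j) y (b k))
          (fun k => fderiv ℝ (fun z => (K z).det) y (b k))
          (fun k => fderiv ℝ ρ y (b k)) j * fderiv ℝ u y (b j))) := by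
  set N : ℕ := Fintype.card ι with hN
  have hdK : DifferentiableAt ℝ (fun z => (K z).det) y := differentiableAt_det hK
  have hρev : ∀ᶠ z in 𝓝 y, 0 < ρ z := hρ.continuousAt.eventually (lt_mem_nhds hρy)
  have hdev : ∀ᶠ z in 𝓝 y, 0 < (K z).det := hdK.continuousAt.eventually (lt_mem_nhds hdet)
  -- In dimension N the density is ρ^{-N}√(det K), and the inverse metric adds ρ². The exponent 2 -
  -- N may be negative, whence the integer power.
  set W : E → ℝ := fun z => Real.sqrt (K z).det * ρ z ^ (2 - N : ℤ) with hW
  have hsqrt : ∀ᶠ z in 𝓝 y, Real.sqrt (G z).det * ρ z ^ 2 = W z := by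
    filter_upwards [hG, hρev] with z h1 h2
    rw [h1, Matrix.det_smul, ← hN, Real.sqrt_mul (by positivity), hW]
    simp only []
    rw [zpow_sub₀ h2.ne']
    have : Real.sqrt (((ρ z ^ 2)⁻¹) ^ N) = (ρ z ^ N)⁻¹ := by
      rw [show ((ρ z ^ 2)⁻¹) ^ N = ((ρ z ^ N)⁻¹) ^ 2 by
        rw [inv_pow, inv_pow, ← pow_mul, ← pow_mul, mul_comm]]
      exact Real.sqrt_sq (by positivity)
    rw [this, zpow_natCast]
    have : ρ z ^ (2 : ℤ) = ρ z ^ 2 := by norm_cast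
    rw [this]
    ring
  have hsqd : DifferentiableAt ℝ (fun z => Real.sqrt (K z).det) y := hdK.sqrt hdet.ne'
  have hpow : HasFDerivAt (fun z => ρ z ^ (2 - N : ℤ))
      ((((2 - N : ℤ) : ℝ) * ρ y ^ ((2 - N : ℤ) - 1)) • fderiv ℝ ρ y) y :=
    (hasDerivAt_zpow (2 - N : ℤ) (ρ y) (Or.inl hρy.ne')).comp_hasFDerivAt y hρ.hasFDerivAt
  have hWd : DifferentiableAt ℝ W y := hsqd.mul hpow.differentiableAt
  have hsq : 0 < Real.sqrt (K y).det := Real.sqrt_pos.2 hdet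
  -- Only the logarithmic derivative of W is needed: the factor W itself combines with the outer
  -- (√det G)⁻¹ to give ρ².
  have hWf : ∀ v, fderiv ℝ W y v = W y * (2⁻¹ * ((K y).det)⁻¹ * fderiv ℝ (fun z => (K z).det) y v +
      (2 - N : ℝ) * (ρ y)⁻¹ * fderiv ℝ ρ y v) := fun v => by
    rw [hW, fderiv_fun_mul hsqd hpow.differentiableAt, hpow.fderiv, fderiv_sqrt hdK hdet.ne',
      zpow_sub_one₀ hρy.ne']
    simp only [_root_.add_apply, _root_.smul_apply, smul_eq_mul]
    have : (1 / (2 * Real.sqrt (K y).det)) = Real.sqrt (K y).det * (2⁻¹ * ((K y).det)⁻¹) := by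
      nth_rewrite 3 [← Real.mul_self_sqrt hdet.le]
      field_simp
    rw [this]
    push_cast
    ring
  have hKi : ∀ i j, DifferentiableAt ℝ (fun z => (K z)⁻¹ i j) y := fun i j =>
    differentiableAt_matrix_inv hK hdet.ne' i j
  have hdu : ∀ j, DifferentiableAt ℝ (fun z => fderiv ℝ u z (b j)) y := fun j =>
    ((hu.fderiv_right (m := 1) (by norm_num)).differentiableAt one_ne_zero).clm_apply
      (differentiableAt_const _)
  have hfun : ∀ i, (fun z => ∑ j, Real.sqrt (G z).det * (G z)⁻¹ i j * fderiv ℝ u z (b j)) =ᶠ[𝓝 y]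
      fun z => ∑ j, W z * ((K z)⁻¹ i j * fderiv ℝ u z (b j)) := fun i => by
    filter_upwards [hG, hρev, hsqrt, hdev] with z h1 h2 h3 h4
    refine Finset.sum_congr rfl fun j _ => ?_
    have h5 : (G z)⁻¹ i j = ρ z ^ 2 * (K z)⁻¹ i j := by
      rw [h1, inv_smul_matrix _ (by positivity) _ h4.ne']; rfl
    rw [h5, ← h3]
    ring
  have hder : ∀ i, fderiv ℝ (fun z => ∑ j, Real.sqrt (G z).det * (G z)⁻¹ i j * fderiv ℝ u z (b j))
      y (b i) = W y * ∑ j, ((2⁻¹ * ((K y).det)⁻¹ * fderiv ℝ (fun z => (K z).det) y (b i) +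
        (2 - N : ℝ) * (ρ y)⁻¹ * fderiv ℝ ρ y (b i)) * ((K y)⁻¹ i j * fderiv ℝ u y (b j)) +
        (fderiv ℝ (fun z => (K z)⁻¹ i j) y (b i) * fderiv ℝ u y (b j) +
        (K y)⁻¹ i j * fderiv ℝ (fun z => fderiv ℝ u z (b j)) y (b i))) := fun i => by
    rw [(hfun i).fderiv_eq, fderiv_fun_sum (A := fun j z => W z * ((K z)⁻¹ i j * fderiv ℝ u z (b j)))
      fun j _ => hWd.mul ((hKi i j).fun_mul (hdu j)),
      _root_.sum_apply, Finset.mul_sum]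
    refine Finset.sum_congr rfl fun j _ => ?_
    rw [fderiv_fun_mul hWd ((hKi i j).fun_mul (hdu j)), fderiv_fun_mul (hKi i j) (hdu j)]
    simp only [_root_.add_apply, _root_.smul_apply, smul_eq_mul, hWf]
    ring
  have hpre : (Real.sqrt (G y).det)⁻¹ * W y = ρ y ^ 2 := by
    rw [← hsqrt.self_of_nhds]
    have : 0 < Real.sqrt (G y).det := by
      rw [hG.self_of_nhds, Matrix.det_smul]
      exact Real.sqrt_pos.2 (by positivity)
    rw [inv_mul_cancel_left₀ this.ne']
  unfold flatLaplacian
  rw [Finset.sum_congr rfl fun i _ => hder i, ← Finset.mul_sum, ← mul_assoc, hpre]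
  congr 2
  simp only [firstOrderCoeff, Finset.sum_mul]
  rw [Finset.sum_comm, Finset.sum_comm (f := fun i j => (K y)⁻¹ i j *
    fderiv ℝ (fun z => fderiv ℝ u z (b j)) y (b i)), ← Finset.sum_add_distrib]
  refine Finset.sum_congr rfl fun i _ => ?_
  rw [← Finset.sum_add_distrib]
  refine Finset.sum_congr rfl fun j _ => ?_
  rw [← hN]
  ring

end Expansion

/-! ### Congruence modulo ρ^j C^∞ up to the boundary -/

section SmoothAlgebra

open Filter Topology

variable {E : Type*} [NormedAddCommGroup E] [NormedSpace ℝ E]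
  {H : Type*} [TopologicalSpace H] {I : ModelWithCorners ℝ E H}
  {M : Type*} [TopologicalSpace M] [ChartedSpace H M]
  {ι : Type*} [Fintype ι] [DecidableEq ι]

/-- The derivative along a vector field of a function which is smooth on `S`, up to the boundary. -/
def vfDerivWithin (I : ModelWithCorners ℝ E H) (S : Set M) (V : VField I M) (f : M → ℝ) : M → ℝ :=
  fun x => (mfderivWithin I 𝓘(ℝ, ℝ) f S x (V x) : ℝ)

theorem vfDerivWithin_of_mem_nhds {S : Set M} {V : VField I M} {f : M → ℝ} {x : M} (hx : S ∈ 𝓝 x) :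
    vfDerivWithin I S V f x = vfDeriv I V f x := by
  unfold vfDerivWithin vfDeriv
  rw [mfderivWithin_of_mem_nhds hx]

/-- Vf is the fibre component of the tangent map of f composed with the section V. Derivatives
within S are used so that smoothness includes boundary points. -/
theorem contMDiffOn_vfDerivWithin [IsManifold I ∞ M] {S : Set M} (hS : UniqueMDiffOn I S)
    {V : VField I M} (hV : ContMDiffOn I I.tangent ∞ (fun x => (⟨x, V x⟩ : TangentBundle I M)) S)
    {f : M → ℝ} (hf : ContMDiffOn I 𝓘(ℝ, ℝ) ∞ f S) :
    ContMDiffOn I 𝓘(ℝ, ℝ) ∞ (vfDerivWithin I S V f) S := by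
  have h1 : ContMDiffOn I.tangent 𝓘(ℝ, ℝ).tangent ∞ (tangentMapWithin I 𝓘(ℝ, ℝ) f S)
      (Bundle.TotalSpace.proj ⁻¹' S) := by
    have : IsManifold I 1 M := IsManifold.of_le (n := ∞) ENat.LEInfty.out
    exact hf.contMDiffOn_tangentMapWithin (by simp) hS
  have h2 := h1.comp hV (fun x hx => hx)
  exact (contMDiff_snd_tangentBundle_modelSpace ℝ 𝓘(ℝ, ℝ)).comp_contMDiffOn h2

theorem ContMDiffOn.mdiff {S : Set M} {f : M → ℝ} (hf : ContMDiffOn I 𝓘(ℝ, ℝ) ∞ f S) {x : M}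
    (hx : x ∈ S) : MDifferentiableWithinAt I 𝓘(ℝ, ℝ) f S x :=
  (hf x hx).mdifferentiableWithinAt (by simp)

section Rules

variable {S : Set M} (hS : UniqueMDiffOn I S) {V : VField I M} {f g : M → ℝ}
  (hf : ContMDiffOn I 𝓘(ℝ, ℝ) ∞ f S) (hg : ContMDiffOn I 𝓘(ℝ, ℝ) ∞ g S) {x : M} (hx : x ∈ S)

include hS hf hg hx in
theorem vfDerivWithin_add :
    vfDerivWithin I S V (fun z => f z + g z) x = vfDerivWithin I S V f x + vfDerivWithin I S V g x := by
  have h := (hf.mdiff hx).hasMFDerivWithinAt.add (hg.mdiff hx).hasMFDerivWithinAt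
  unfold vfDerivWithin
  rw [show (fun z => f z + g z) = f + g from rfl, h.mfderivWithin (hS x hx)]
  rfl

include hS hf hg hx in
theorem vfDerivWithin_mul :
    vfDerivWithin I S V (fun z => f z * g z) x =
      f x * vfDerivWithin I S V g x + g x * vfDerivWithin I S V f x := by
  have h := (hf.mdiff hx).hasMFDerivWithinAt.mul (hg.mdiff hx).hasMFDerivWithinAt
  unfold vfDerivWithin
  rw [show (fun z => f z * g z) = f * g from rfl, h.mfderivWithin (hS x hx)]
  rfl

include hS hf hx in
theorem vfDerivWithin_pow (j : ℕ) :
    vfDerivWithin I S V (fun z => f z ^ j) x = j * f x ^ (j - 1) * vfDerivWithin I S V f x := by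
  have h := (hasDerivAt_pow j (f x)).hasFDerivAt.hasMFDerivAt.comp_hasMFDerivWithinAt x
    (hf.mdiff hx).hasMFDerivWithinAt
  unfold vfDerivWithin
  rw [show (fun z => f z ^ j) = (fun y => y ^ j) ∘ f from rfl, h.mfderivWithin (hS x hx)]
  exact mul_comm _ _

end Rules

theorem vfDerivWithin_congr {S : Set M} {V : VField I M} {f g : M → ℝ} (h : ∀ x ∈ S, f x = g x)
    {x : M} (hx : x ∈ S) : vfDerivWithin I S V f x = vfDerivWithin I S V g x := by
  unfold vfDerivWithin
  rw [mfderivWithin_congr h (h x hx)]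
  rfl

/-- `f` and `f'` are smooth on `S` and agree modulo `ρ^j C^∞(S)`. -/
structure CongrMod (I : ModelWithCorners ℝ E H) (S : Set M) (ρ : M → ℝ) (j : ℕ) (f f' : M → ℝ) :
    Prop where
  left : ContMDiffOn I 𝓘(ℝ, ℝ) ∞ f S
  right : ContMDiffOn I 𝓘(ℝ, ℝ) ∞ f' S
  exists_eq : ∃ m : M → ℝ, ContMDiffOn I 𝓘(ℝ, ℝ) ∞ m S ∧ ∀ x ∈ S, f x = f' x + ρ x ^ j * m x

namespace CongrMod

variable {S : Set M} {ρ : M → ℝ} {j : ℕ} {f f' g g' : M → ℝ}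

theorem refl (hf : ContMDiffOn I 𝓘(ℝ, ℝ) ∞ f S) : CongrMod I S ρ j f f :=
  ⟨hf, hf, fun _ => 0, contMDiffOn_const, fun x _ => by simp⟩

theorem add (h : CongrMod I S ρ j f f') (h' : CongrMod I S ρ j g g') :
    CongrMod I S ρ j (fun x => f x + g x) (fun x => f' x + g' x) := by
  obtain ⟨hf, hf', m, hm, hfm⟩ := h
  obtain ⟨hg, hg', n, hn, hgn⟩ := h'
  exact ⟨hf.add hg, hf'.add hg', fun x => m x + n x, hm.add hn, fun x hx => by
    rw [hfm x hx, hgn x hx]; ring⟩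

theorem mul (h : CongrMod I S ρ j f f') (h' : CongrMod I S ρ j g g') :
    CongrMod I S ρ j (fun x => f x * g x) (fun x => f' x * g' x) := by
  obtain ⟨hf, hf', m, hm, hfm⟩ := h
  obtain ⟨hg, hg', n, hn, hgn⟩ := h'
  exact ⟨hf.mul hg, hf'.mul hg', fun x => f x * n x + m x * g' x, (hf.mul hn).add (hm.mul hg'),
    fun x hx => by
      have h1 := hgn x hx
      have h2 := hfm x hx
      linear_combination f x * h1 + g' x * h2⟩

theorem sum {α : Type*} (s : Finset α) {f f' : α → M → ℝ}
    (h : ∀ a ∈ s, CongrMod I S ρ j (f a) (f' a)) :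
    CongrMod I S ρ j (fun x => ∑ a ∈ s, f a x) (fun x => ∑ a ∈ s, f' a x) := by
  classical
  induction s using Finset.induction_on with
  | empty => simpa using refl contMDiffOn_const
  | insert a s ha ih =>
    simp only [Finset.sum_insert ha]
    exact (h a (Finset.mem_insert_self _ _)).add (ih fun b hb => h b (Finset.mem_insert_of_mem hb))

theorem prod {α : Type*} (s : Finset α) {f f' : α → M → ℝ}
    (h : ∀ a ∈ s, CongrMod I S ρ j (f a) (f' a)) :
    CongrMod I S ρ j (fun x => ∏ a ∈ s, f a x) (fun x => ∏ a ∈ s, f' a x) := by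
  classical
  induction s using Finset.induction_on with
  | empty => simpa using refl contMDiffOn_const
  | insert a s ha ih =>
    simp only [Finset.prod_insert ha]
    exact (h a (Finset.mem_insert_self _ _)).mul (ih fun b hb => h b (Finset.mem_insert_of_mem hb))

/-- The Leibniz formula is a polynomial in the entries, and congruences respect sums and products.
-/
theorem det {K K' : M → Matrix ι ι ℝ}
    (h : ∀ a b, CongrMod I S ρ j (fun x => K x a b) (fun x => K' x a b)) :
    CongrMod I S ρ j (fun x => (K x).det) (fun x => (K' x).det) := by
  simp only [Matrix.det_apply']
  exact sum _ fun σ _ => (refl contMDiffOn_const).mul (prod _ fun i _ => h _ _)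

theorem adjugate {K K' : M → Matrix ι ι ℝ}
    (h : ∀ a b, CongrMod I S ρ j (fun x => K x a b) (fun x => K' x a b)) (a b : ι) :
    CongrMod I S ρ j (fun x => (K x).adjugate a b) (fun x => (K' x).adjugate a b) := by
  simp only [Matrix.adjugate_apply]
  refine det fun k l => ?_
  by_cases hk : k = b
  · subst hk
    simpa using refl contMDiffOn_const
  · simp only [Matrix.updateRow_ne hk]; exact h k l

/-- From 1/f - 1/f′ = -(f - f′)/(f f′), where the reciprocals remain smooth because neither function
vanishes on S. -/
theorem inv (h : CongrMod I S ρ j f f') (hf : ∀ x ∈ S, f x ≠ 0) (hf' : ∀ x ∈ S, f' x ≠ 0) :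
    CongrMod I S ρ j (fun x => (f x)⁻¹) (fun x => (f' x)⁻¹) := by
  obtain ⟨h1, h2, m, hm, hfm⟩ := h
  have h1' := h1.inv₀ hf
  have h2' := h2.inv₀ hf'
  refine ⟨h1', h2', fun x => -(m x * ((f x)⁻¹ * (f' x)⁻¹)), (hm.mul (h1'.mul h2')).neg,
    fun x hx => ?_⟩
  have h3 := hf x hx
  have h4 := hf' x hx
  have h5 : ρ x ^ j * m x = f x - f' x := by rw [hfm x hx]; ring
  have h6 : ρ x ^ j * -(m x * ((f x)⁻¹ * (f' x)⁻¹)) =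
    -((f x - f' x) * ((f x)⁻¹ * (f' x)⁻¹)) := by rw [← h5]; ring
  rw [h6]
  field_simp
  ring

theorem matrix_inv {K K' : M → Matrix ι ι ℝ}
    (h : ∀ a b, CongrMod I S ρ j (fun x => K x a b) (fun x => K' x a b))
    (hK : ∀ x ∈ S, (K x).det ≠ 0) (hK' : ∀ x ∈ S, (K' x).det ≠ 0) (a b : ι) :
    CongrMod I S ρ j (fun x => (K x)⁻¹ a b) (fun x => (K' x)⁻¹ a b) := by
  simp only [Matrix.inv_def, Matrix.smul_apply, Ring.inverse_eq_inv', smul_eq_mul]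
  exact ((det h).inv hK hK').mul (adjugate h a b)

/-- The relation Vρ = ρβ gives V(ρ^j m) = ρ^j(Vm + jβm): a b-vector field loses no power of ρ. A
derivative transversal to the boundary would lose one. -/
theorem vfDerivWithin [IsManifold I ∞ M] (hS : UniqueMDiffOn I S)
    {V : VField I M} (hV : ContMDiffOn I I.tangent ∞ (fun x => (⟨x, V x⟩ : TangentBundle I M)) S)
    (hρ : ContMDiffOn I 𝓘(ℝ, ℝ) ∞ ρ S) {β : M → ℝ} (hβ : ContMDiffOn I 𝓘(ℝ, ℝ) ∞ β S)
    (hVρ : ∀ x ∈ S, _root_.vfDerivWithin I S V ρ x = ρ x * β x) (h : CongrMod I S ρ j f f') :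
    CongrMod I S ρ j (_root_.vfDerivWithin I S V f) (_root_.vfDerivWithin I S V f') := by
  obtain ⟨h1, h2, m, hm, hfm⟩ := h
  have hp : ContMDiffOn I 𝓘(ℝ, ℝ) ∞ (fun x => ρ x ^ j) S := hρ.pow j
  refine ⟨contMDiffOn_vfDerivWithin hS hV h1, contMDiffOn_vfDerivWithin hS hV h2,
    fun x => _root_.vfDerivWithin I S V m x + j * (β x * m x),
    (contMDiffOn_vfDerivWithin hS hV hm).add (contMDiffOn_const.mul (hβ.mul hm)), fun x hx => ?_⟩
  rw [vfDerivWithin_congr hfm hx, vfDerivWithin_add (g := fun z => ρ z ^ j * m z) hS h2 (hp.mul hm) hx,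
    vfDerivWithin_mul hS hp hm hx, vfDerivWithin_pow hS hρ hx, hVρ x hx]
  rcases j with _ | j
  · simp
  · simp only [Nat.add_sub_cancel, pow_succ]
    ring

end CongrMod

/-- The first order coefficients, in a frame `V`, of the Laplace--Beltrami operator with Gram
matrix `ρ⁻² K`, up to the factor `-ρ²`. Here `β i = ρ⁻¹ V_i ρ`. -/
def frameCoeff (I : ModelWithCorners ℝ E H) (S : Set M) (V : ι → VField I M) (β : ι → M → ℝ)
    (K : M → Matrix ι ι ℝ) (j : ι) (x : M) : ℝ :=
  ∑ i, (vfDerivWithin I S (V i) (fun z => (K z)⁻¹ i j) x +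
    2⁻¹ * ((K x).det)⁻¹ * vfDerivWithin I S (V i) (fun z => (K z).det) x * (K x)⁻¹ i j +
    (2 - Fintype.card ι : ℝ) * β i x * (K x)⁻¹ i j)

/-- The coefficient is assembled from K⁻¹, det K and their b-derivatives by ring operations, all
compatible with the congruence. -/
theorem CongrMod.frameCoeff [IsManifold I ∞ M] {S : Set M} {ρ : M → ℝ} {j : ℕ}
    (hS : UniqueMDiffOn I S) {V : ι → VField I M}
    (hV : ∀ i, ContMDiffOn I I.tangent ∞ (fun x => (⟨x, V i x⟩ : TangentBundle I M)) S)
    (hρ : ContMDiffOn I 𝓘(ℝ, ℝ) ∞ ρ S) {β : ι → M → ℝ}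
    (hβ : ∀ i, ContMDiffOn I 𝓘(ℝ, ℝ) ∞ (β i) S)
    (hVρ : ∀ i, ∀ x ∈ S, _root_.vfDerivWithin I S (V i) ρ x = ρ x * β i x)
    {K K' : M → Matrix ι ι ℝ}
    (h : ∀ a b, CongrMod I S ρ j (fun x => K x a b) (fun x => K' x a b))
    (hK : ∀ x ∈ S, (K x).det ≠ 0) (hK' : ∀ x ∈ S, (K' x).det ≠ 0) (b : ι) :
    CongrMod I S ρ j (_root_.frameCoeff I S V β K b) (_root_.frameCoeff I S V β K' b) := by
  have hi := fun a => CongrMod.matrix_inv h hK hK' a b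
  exact CongrMod.sum _ fun a _ => ((((hi a).vfDerivWithin hS (hV a) hρ (hβ a) (hVρ a)).add
    ((((CongrMod.refl contMDiffOn_const).mul ((CongrMod.det h).inv hK hK')).mul
      ((CongrMod.det h).vfDerivWithin hS (hV a) hρ (hβ a) (hVρ a))).mul (hi a))).add
    (((CongrMod.refl contMDiffOn_const).mul (CongrMod.refl (hβ a))).mul (hi a)))

end SmoothAlgebra

/-! ### The local b-frame on the cylinder -/

section CollarFrame

open Filter Topology

variable {n : ℕ} {Y : Type*} [TopologicalSpace Y] [ChartedSpace (EuclideanSpace ℝ (Fin n)) Y]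

/-- The index set of a frame of `ℝ × Y`. -/
abbrev CylIndex (n : ℕ) : Type := Unit ⊕ Fin (Module.finrank ℝ (EuclideanSpace ℝ (Fin n)))

/-- The standard basis of the model space of `ℝ × Y`. -/
def cylBasis (n : ℕ) : Module.Basis (CylIndex n) ℝ (ℝ × EuclideanSpace ℝ (Fin n)) :=
  (Module.Basis.singleton Unit ℝ).prod (Module.finBasis ℝ (EuclideanSpace ℝ (Fin n)))

@[simp] theorem cylBasis_inl (n : ℕ) (i : Unit) : cylBasis n (Sum.inl i) = ((1 : ℝ), 0) := by
  ext <;> simp [cylBasis]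

@[simp] theorem cylBasis_inr (n : ℕ) (i) :
    cylBasis n (Sum.inr i) = ((0 : ℝ), Module.finBasis ℝ (EuclideanSpace ℝ (Fin n)) i) := by
  ext <;> simp [cylBasis]

/-- The chart of `ℝ × Y` which is the identity on `ℝ` and the chart at `θ₀` on `Y`. -/
abbrev cylChart (θ₀ : Y) : PartialEquiv (ℝ × Y) (ℝ × EuclideanSpace ℝ (Fin n)) :=
  extChartAt (cylModel n) ((0 : ℝ), θ₀)

theorem cylChart_eq (θ₀ : Y) :
    cylChart (n := n) θ₀ = (PartialEquiv.refl ℝ).prod (extChartAt (𝓡 n) θ₀) := by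
  rw [cylChart, extChartAt_prod, extChartAt_model_space_eq_id]

theorem cylChart_apply (θ₀ : Y) (p : ℝ × Y) :
    cylChart (n := n) θ₀ p = (p.1, extChartAt (𝓡 n) θ₀ p.2) := by
  rw [cylChart_eq]; rfl

theorem cylChart_symm_apply (θ₀ : Y) (z : ℝ × EuclideanSpace ℝ (Fin n)) :
    (cylChart (n := n) θ₀).symm z = (z.1, (extChartAt (𝓡 n) θ₀).symm z.2) := by
  rw [cylChart_eq]; rfl

theorem mem_cylChart_source (θ₀ : Y) (p : ℝ × Y) :
    p ∈ (cylChart (n := n) θ₀).source ↔ p.2 ∈ (extChartAt (𝓡 n) θ₀).source := by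
  rw [cylChart_eq]; simp

theorem mem_cylChart_target (θ₀ : Y) (z : ℝ × EuclideanSpace ℝ (Fin n)) :
    z ∈ (cylChart (n := n) θ₀).target ↔ z.2 ∈ (extChartAt (𝓡 n) θ₀).target := by
  rw [cylChart_eq]; simp

variable [IsManifold (𝓡 n) ∞ Y]

theorem contMDiffAt_cylChart_symm (θ₀ : Y) {z : ℝ × EuclideanSpace ℝ (Fin n)}
    (hz : z.2 ∈ (extChartAt (𝓡 n) θ₀).target) :
    ContMDiffAt 𝓘(ℝ, ℝ × EuclideanSpace ℝ (Fin n)) (cylModel n) ∞ (cylChart (n := n) θ₀).symm z := by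
  refine (contMDiffOn_extChartAt_symm (I := cylModel n) ((0 : ℝ), θ₀)).contMDiffAt ?_
  exact (isOpen_extChartAt_target (I := cylModel n) ((0 : ℝ), θ₀)).mem_nhds
    ((mem_cylChart_target θ₀ z).2 hz)

/-- The coordinate vector field of the chart `cylChart θ₀` in the direction `w`. -/
def coordField (θ₀ : Y) (w : ℝ × EuclideanSpace ℝ (Fin n)) : VField (cylModel n) (ℝ × Y) :=
  fun p => mfderiv 𝓘(ℝ, ℝ × EuclideanSpace ℝ (Fin n)) (cylModel n) (cylChart (n := n) θ₀).symm
    (cylChart (n := n) θ₀ p) w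

theorem tangentBundle_mk_congr {p q : ℝ × Y} (h : p = q) (v : ℝ × EuclideanSpace ℝ (Fin n)) :
    (⟨p, v⟩ : TangentBundle (cylModel n) (ℝ × Y)) = ⟨q, v⟩ := by
  subst h; rfl

/-- The field is the image of a constant section under the tangent map of the inverse chart. -/
theorem contMDiffOn_coordField (θ₀ : Y) (w : ℝ × EuclideanSpace ℝ (Fin n)) :
    ContMDiffOn (cylModel n) (cylModel n).tangent ∞
      (fun p => (⟨p, coordField θ₀ w p⟩ : TangentBundle (cylModel n) (ℝ × Y)))
      (cylChart (n := n) θ₀).source := by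
  set e := cylChart (n := n) θ₀
  have hopen : IsOpen e.target := isOpen_extChartAt_target (I := cylModel n) ((0 : ℝ), θ₀)
  have h1 : ContMDiffOn 𝓘(ℝ, ℝ × EuclideanSpace ℝ (Fin n)).tangent (cylModel n).tangent ∞
      (tangentMapWithin 𝓘(ℝ, ℝ × EuclideanSpace ℝ (Fin n)) (cylModel n) e.symm e.target)
      (Bundle.TotalSpace.proj ⁻¹' e.target) := by
    have : IsManifold (cylModel n) 1 (ℝ × Y) := IsManifold.of_le (n := ∞) ENat.LEInfty.out
    exact (contMDiffOn_extChartAt_symm (n := ∞) (I := cylModel n) ((0 : ℝ), θ₀)).contMDiffOn_tangentMapWithin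
      (m := ∞) (by simp) hopen.uniqueMDiffOn
  have h2 : ContMDiffOn (cylModel n) 𝓘(ℝ, ℝ × EuclideanSpace ℝ (Fin n)).tangent ∞
      (fun p => (⟨e p, w⟩ : TangentBundle 𝓘(ℝ, ℝ × EuclideanSpace ℝ (Fin n))
        (ℝ × EuclideanSpace ℝ (Fin n)))) e.source := by
    have h3 : ContMDiff 𝓘(ℝ, ℝ × EuclideanSpace ℝ (Fin n))
        𝓘(ℝ, ℝ × EuclideanSpace ℝ (Fin n)).tangent ∞
        (fun z => (⟨z, w⟩ : TangentBundle 𝓘(ℝ, ℝ × EuclideanSpace ℝ (Fin n))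
          (ℝ × EuclideanSpace ℝ (Fin n)))) := fun z =>
      contMDiffWithinAt_vectorSpace_iff_contDiffWithinAt.2 contDiffWithinAt_const
    exact h3.comp_contMDiffOn (contMDiffOn_extChartAt (I := cylModel n) (x := ((0 : ℝ), θ₀))|>.mono
      (by rw [extChartAt_source]))
  refine (h1.comp h2 fun p hp => e.map_source hp).congr fun p hp => ?_
  have h4 : e.symm (e p) = p := e.left_inv hp
  simp only [Function.comp, tangentMapWithin, coordField]
  rw [mfderivWithin_of_isOpen hopen (e.map_source hp)]
  exact tangentBundle_mk_congr h4.symm _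

/-- The weight which turns the coordinate fields into b-vector fields. -/
def frameWeight (n : ℕ) (a : CylIndex n) (s : ℝ) : ℝ := Sum.elim (fun _ => s) (fun _ => 1) a

theorem contDiff_frameWeight (a : CylIndex n) : ContDiff ℝ ∞ (frameWeight n a) := by
  rcases a with a | a
  · exact contDiff_id
  · exact contDiff_const

/-- A frame of b-vector fields `ρ∂_ρ, ∂_{θ_i}`, in the chart at `θ₀`, cut off by `χ`. -/
def collarField (χ : Y → ℝ) (θ₀ : Y) (a : CylIndex n) : VField (cylModel n) (ℝ × Y) :=
  fun p => (χ p.2 * frameWeight n a p.1) • coordField θ₀ (cylBasis n a) p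

/-- The cutoff is supported inside the chart, so extension by zero gives globally smooth fields.
This is needed because b-vector fields must be smooth on the whole cylinder. -/
theorem contMDiff_collarField {χ : Y → ℝ} {θ₀ : Y} (hχ : ContMDiff (𝓡 n) 𝓘(ℝ, ℝ) ∞ χ)
    (hsupp : tsupport χ ⊆ (extChartAt (𝓡 n) θ₀).source) (a : CylIndex n) :
    ContMDiff (cylModel n) (cylModel n).tangent ∞
      (fun p => (⟨p, collarField χ θ₀ a p⟩ : TangentBundle (cylModel n) (ℝ × Y))) := by
  have h1 : ContMDiff (cylModel n) 𝓘(ℝ, ℝ) ∞ fun p : ℝ × Y => χ p.2 * frameWeight n a p.1 :=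
    (hχ.comp contMDiff_snd).mul ((contDiff_frameWeight a).contMDiff.comp contMDiff_fst)
  refine ContMDiffOn.smul_section_of_tsupport (ψ := fun p : ℝ × Y => χ p.2 * frameWeight n a p.1)
    (u := (cylChart (n := n) θ₀).source)
    h1.contMDiffOn (isOpen_extChartAt_source _) ?_ (contMDiffOn_coordField θ₀ (cylBasis n a))
  intro p hp
  rw [mem_cylChart_source]
  refine hsupp ?_
  have h2 : tsupport (fun p : ℝ × Y => χ p.2 * frameWeight n a p.1) ⊆ Prod.snd ⁻¹' tsupport χ := by
    refine closure_minimal (fun q hq => subset_closure ?_)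
      ((isClosed_tsupport χ).preimage continuous_snd)
    exact left_ne_zero_of_mul hq
  exact h2 hp

/-- The function `ρ⁻¹ V_a ρ`. -/
def frameBeta (χ : Y → ℝ) (a : CylIndex n) (p : ℝ × Y) : ℝ :=
  Sum.elim (fun _ => χ p.2) (fun _ => 0) a

theorem contMDiff_frameBeta {χ : Y → ℝ} (hχ : ContMDiff (𝓡 n) 𝓘(ℝ, ℝ) ∞ χ) (a : CylIndex n) :
    ContMDiff (cylModel n) 𝓘(ℝ, ℝ) ∞ (frameBeta χ a) := by
  rcases a with a | a
  · exact hχ.comp contMDiff_snd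
  · exact contMDiff_const

theorem mfderiv_fst_coordField {θ₀ : Y} {p : ℝ × Y} (hp : p.2 ∈ (extChartAt (𝓡 n) θ₀).source)
    (w : ℝ × EuclideanSpace ℝ (Fin n)) :
    (mfderiv (cylModel n) 𝓘(ℝ, ℝ) (Prod.fst : ℝ × Y → ℝ) p (coordField θ₀ w p) : ℝ) = w.1 := by
  set e := cylChart (n := n) θ₀
  have hps : p ∈ e.source := (mem_cylChart_source θ₀ p).2 hp
  have h1 : MDifferentiableAt 𝓘(ℝ, ℝ × EuclideanSpace ℝ (Fin n)) (cylModel n) e.symm (e p) :=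
    (contMDiffAt_cylChart_symm θ₀ ((mem_cylChart_target θ₀ _).1 (e.map_source hps))).mdifferentiableAt
      (by simp)
  have h2 : MDifferentiableAt (cylModel n) 𝓘(ℝ, ℝ) (Prod.fst : ℝ × Y → ℝ) (e.symm (e p)) :=
    (contMDiff_fst (n := 1)).mdifferentiableAt one_ne_zero
  have h3 := mfderiv_comp (e p) h2 h1
  have h4 : (Prod.fst : ℝ × Y → ℝ) ∘ e.symm = (Prod.fst : ℝ × EuclideanSpace ℝ (Fin n) → ℝ) := by
    funext z
    exact congrArg Prod.fst (cylChart_symm_apply θ₀ z)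
  rw [h4, mfderiv_eq_fderiv, fderiv_fst] at h3
  have h5 := congrArg (fun f : (ℝ × EuclideanSpace ℝ (Fin n)) →L[ℝ] ℝ => f w) h3
  refine Eq.trans ?_ h5.symm
  have h6 : e.symm (e p) = p := e.left_inv hps
  change _ = (mfderiv (cylModel n) 𝓘(ℝ, ℝ) (Prod.fst : ℝ × Y → ℝ) (e.symm (e p)) :
    (ℝ × EuclideanSpace ℝ (Fin n)) →L[ℝ] ℝ) (coordField θ₀ w p)
  rw [h6]

/-- This gives both tangency to the boundary and the relation Vρ = ρβ required by the congruence
calculus. Outside the chart both sides vanish with χ. -/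
theorem vfDeriv_fst_collarField {χ : Y → ℝ} {θ₀ : Y}
    (hsupp : tsupport χ ⊆ (extChartAt (𝓡 n) θ₀).source) (a : CylIndex n) (p : ℝ × Y) :
    vfDeriv (cylModel n) (collarField χ θ₀ a) Prod.fst p = p.1 * frameBeta χ a p := by
  unfold vfDeriv collarField
  by_cases hp : p.2 ∈ (extChartAt (𝓡 n) θ₀).source
  · have h := mfderiv_fst_coordField hp (cylBasis n a)
    rw [map_smul]
    refine (congrArg (fun x : ℝ => (χ p.2 * frameWeight n a p.1) * x) h).trans ?_
    rcases a with a | a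
    · simp [frameWeight, frameBeta, mul_comm]
    · simp [frameBeta]
  · have h0 : χ p.2 = 0 := image_eq_zero_of_notMem_tsupport fun h => hp (hsupp h)
    rw [h0, zero_mul, zero_smul, map_zero]
    refine Eq.trans (b := (0 : ℝ)) rfl ?_
    rcases a with a | a
    · simp [frameBeta, h0]
    · simp [frameBeta]

end CollarFrame

/-! ### Locality and naturality under diffeomorphisms -/

section Congruence

open Filter Topology

theorem flatLaplacian_congr {E : Type*} [NormedAddCommGroup E] [NormedSpace ℝ E]
    {ι : Type*} [Fintype ι] [DecidableEq ι] (b : ι → E) {G G' : E → Matrix ι ι ℝ} {u u' : E → ℝ}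
    {y : E} (hG : G =ᶠ[𝓝 y] G') (hu : u =ᶠ[𝓝 y] u') :
    flatLaplacian b G u y = flatLaplacian b G' u' y := by
  unfold flatLaplacian
  rw [hG.self_of_nhds]
  refine congrArg (fun x => -((Real.sqrt (G' y).det)⁻¹ * x)) (Finset.sum_congr rfl fun i _ => ?_)
  refine congrArg (fun φ : E →L[ℝ] ℝ => φ (b i)) (Filter.EventuallyEq.fderiv_eq ?_)
  filter_upwards [hG, hu.eventually_nhds] with z h1 h2
  refine Finset.sum_congr rfl fun j _ => ?_
  rw [h1, Filter.EventuallyEq.fderiv_eq (show u =ᶠ[𝓝 z] u' from h2)]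

variable {E : Type*} [NormedAddCommGroup E] [NormedSpace ℝ E]
  {H : Type*} [TopologicalSpace H] {I : ModelWithCorners ℝ E H}
  {M : Type*} [TopologicalSpace M] [ChartedSpace H M]
  {E' : Type*} [NormedAddCommGroup E'] [NormedSpace ℝ E']
  {H' : Type*} [TopologicalSpace H'] {I' : ModelWithCorners ℝ E' H'}
  {M' : Type*} [TopologicalSpace M'] [ChartedSpace H' M']
  {E₂ : Type*} [NormedAddCommGroup E₂] [NormedSpace ℝ E₂]
  {ι₂ : Type*} [Fintype ι₂] [DecidableEq ι₂]

theorem ContMDiffAt.eventually_one [IsManifold I ∞ M] [IsManifold I' ∞ M'] {f : M → M'} {x : M}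
    (hf : ContMDiffAt I I' ∞ f x) : ∀ᶠ z in 𝓝 x, ContMDiffAt I I' 1 f z := by
  have hone : (1 : WithTop ℕ∞) ≤ ∞ := ENat.LEInfty.out
  have : IsManifold I 1 M := IsManifold.of_le hone
  have : IsManifold I' 1 M' := IsManifold.of_le hone
  exact (contMDiffAt_iff_contMDiffAt_nhds (by simp)).1 (hf.of_le hone)

/-- Naturality of the Laplace--Beltrami operator under local diffeomorphisms. -/
theorem laplaceBeltrami_pullback [FiniteDimensional ℝ E] [IsManifold I ∞ M]
    [FiniteDimensional ℝ E'] [IsManifold I' ∞ M']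
    (b₂ : Module.Basis ι₂ ℝ E₂) {g : BilinField I' M'} {u : M' → ℝ} {f : M → M'} {f' : M' → M} {p : M}
    (hp : I.IsInteriorPoint p) (hfp : I'.IsInteriorPoint (f p))
    (hf : ContMDiffAt I I' ∞ f p) (hf' : ContMDiffAt I' I ∞ f' (f p))
    (hf'f : ∀ᶠ x in 𝓝 p, f' (f x) = x) (hff' : ∀ᶠ x in 𝓝 (f p), f (f' x) = x)
    {τ : M → E₂} {Φ : E₂ → M}
    (hτ : ContMDiffAt I 𝓘(ℝ, E₂) ∞ τ p) (hΦ : ContMDiffAt 𝓘(ℝ, E₂) I ∞ Φ (τ p))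
    (hΦτ : ∀ᶠ x in 𝓝 p, Φ (τ x) = x) (hτΦ : ∀ᶠ z in 𝓝 (τ p), τ (Φ z) = z)
    (hgs : ∀ᶠ x in 𝓝 (f p), ∀ v w : TangentSpace I' x, g x v w = g x w v)
    (hgp : ∀ᶠ x in 𝓝 (f p), ∀ v : TangentSpace I' x, v ≠ 0 → 0 < g x v v)
    (hg : ∀ i j, DifferentiableAt ℝ (fun z => pullbackForm 𝓘(ℝ, E₂) I Φ (pullbackForm I I' f g) z
      (b₂ i : E₂) (b₂ j : E₂)) (τ p))
    (hu : ContDiffAt ℝ 2 (fun z => u (f (Φ z))) (τ p)) :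
    laplaceBeltrami I' g u (f p) = laplaceBeltrami I (pullbackForm I I' f g) (u ∘ f) p := by
  have hΦp : Φ (τ p) = p := hΦτ.self_of_nhds
  have hf'p : f' (f p) = p := hf'f.self_of_nhds
  have hΦt : Tendsto Φ (𝓝 (τ p)) (𝓝 p) := by
    have := hΦ.continuousAt.tendsto; rwa [hΦp] at this
  have hf't : Tendsto f' (𝓝 (f p)) (𝓝 p) := by
    have := hf'.continuousAt.tendsto; rwa [hf'p] at this
  have hft : Tendsto f (𝓝 p) (𝓝 (f p)) := hf.continuousAt.tendsto
  -- Functoriality of the pullback, from the chain rule; it identifies the Gram matrices of the two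
  -- sides.
  have hcomp : ∀ᶠ z in 𝓝 (τ p), ∀ w w' : E₂,
      (pullbackForm 𝓘(ℝ, E₂) I' (f ∘ Φ) g z : E₂ →L[ℝ] E₂ →L[ℝ] ℝ) w w' =
      (pullbackForm 𝓘(ℝ, E₂) I Φ (pullbackForm I I' f g) z : E₂ →L[ℝ] E₂ →L[ℝ] ℝ) w w' := by
    filter_upwards [hΦ.eventually_one, hΦt.eventually hf.eventually_one] with z h1 h2 w w'
    have h3 := mfderiv_comp z (h2.mdifferentiableAt one_ne_zero) (h1.mdifferentiableAt one_ne_zero)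
    have h4 : ∀ x : E₂, (mfderiv 𝓘(ℝ, E₂) I' (f ∘ Φ) z x : E') =
        mfderiv I I' f (Φ z) (mfderiv 𝓘(ℝ, E₂) I Φ z x) := fun x => by rw [h3]; rfl
    change (g (f (Φ z)) : E' →L[ℝ] E' →L[ℝ] ℝ) (mfderiv 𝓘(ℝ, E₂) I' (f ∘ Φ) z w : E')
      (mfderiv 𝓘(ℝ, E₂) I' (f ∘ Φ) z w' : E') = _
    rw [h4, h4]
    rfl
  have h1 : laplaceBeltrami I (pullbackForm I I' f g) (u ∘ f) p =
      flatLaplacian b₂ (fun z => gramMatrix b₂ (pullbackForm 𝓘(ℝ, E₂) I Φ (pullbackForm I I' f g) z))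
        (fun z => (u ∘ f) (Φ z)) (τ p) := by
    refine laplaceBeltrami_eq_flatLaplacian b₂ hp hτ hΦ hΦτ hτΦ ?_ ?_ hg hu
    · filter_upwards [hft.eventually hgs] with x hx v w
      exact hx _ _
    · filter_upwards [hft.eventually hgp, hf.eventually_one, hft.eventually hf'.eventually_one,
        hf'f.eventually_nhds] with x h1 h2 h3 h4 v hv
      refine h1 _ fun h0 => hv ?_
      have := mfderiv_comp_leftInverse (h2.mdifferentiableAt one_ne_zero)
        (h3.mdifferentiableAt one_ne_zero) h4 v
      refine this.symm.trans ?_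
      refine (congrArg (fun x' => (mfderiv I' I f' (f x) x' : E)) h0).trans ?_
      exact map_zero (mfderiv I' I f' (f x))
  have hτ' : τ (f' (f p)) = τ p := congrArg τ hf'p
  -- On the target the transported coordinates τ ∘ f′ are used, so that both sides are the same
  -- expression at the same point of E₂.
  have h2 := laplaceBeltrami_eq_flatLaplacian (g := g) (u := u) b₂ hfp (τ := τ ∘ f') (Φ := f ∘ Φ)
    (ContMDiffAt.comp (f p) (by rw [hf'p]; exact hτ) hf')
    (by
      simp only [Function.comp, hτ']
      exact ContMDiffAt.comp (τ p) (by rw [hΦp]; exact hf) hΦ)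
    (by
      filter_upwards [hf't.eventually hΦτ, hff'] with x h3 h4
      simp only [Function.comp, h3, h4])
    (by
      simp only [Function.comp, hτ']
      filter_upwards [hΦt.eventually hf'f, hτΦ] with z h3 h4
      rw [h3, h4])
    hgs hgp
    (fun i j => by
      simp only [Function.comp_apply, hτ']
      exact (hg i j).congr_of_eventuallyEq (hcomp.mono fun z hz => hz _ _))
    (by simp only [Function.comp_apply, hτ']; exact hu)
  rw [h1, h2]
  simp only [Function.comp_apply, hτ']
  refine flatLaplacian_congr _ ?_ EventuallyEq.rfl
  filter_upwards [hcomp] with z hz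
  ext i j
  exact hz _ _

end Congruence

/-! ### Coordinates on the cylinder with a changed radial variable -/

section CylParam

open Filter Topology

variable {n : ℕ} {Y : Type*} [TopologicalSpace Y] [ChartedSpace (EuclideanSpace ℝ (Fin n)) Y]
  [IsManifold (𝓡 n) ∞ Y]

/-- The parametrization of `ℝ × Y` by `γ` in the first variable and by the chart at `θ₀` in the
second one. -/
def cylParam (γ : ℝ → ℝ) (θ₀ : Y) (z : ℝ × EuclideanSpace ℝ (Fin n)) : ℝ × Y :=
  (cylChart (n := n) θ₀).symm (γ z.1, z.2)

/-- The inverse of a parametrization of `ℝ × Y`. -/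
def cylCoord (δ : ℝ → ℝ) (θ₀ : Y) (p : ℝ × Y) : ℝ × EuclideanSpace ℝ (Fin n) :=
  (δ p.1, extChartAt (𝓡 n) θ₀ p.2)

theorem cylParam_apply (γ : ℝ → ℝ) (θ₀ : Y) (z : ℝ × EuclideanSpace ℝ (Fin n)) :
    cylParam γ θ₀ z = (γ z.1, (extChartAt (𝓡 n) θ₀).symm z.2) :=
  cylChart_symm_apply θ₀ _

theorem contDiffAt_prodMap_fst {γ : ℝ → ℝ} {z : ℝ × EuclideanSpace ℝ (Fin n)}
    (hγ : ContDiffAt ℝ ∞ γ z.1) :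
    ContDiffAt ℝ ∞ (fun z : ℝ × EuclideanSpace ℝ (Fin n) => (γ z.1, z.2)) z :=
  (hγ.comp z contDiffAt_fst).prodMk contDiffAt_snd

theorem contMDiffAt_cylParam {γ : ℝ → ℝ} {θ₀ : Y} {z : ℝ × EuclideanSpace ℝ (Fin n)}
    (hγ : ContDiffAt ℝ ∞ γ z.1) (hz : z.2 ∈ (extChartAt (𝓡 n) θ₀).target) :
    ContMDiffAt 𝓘(ℝ, ℝ × EuclideanSpace ℝ (Fin n)) (cylModel n) ∞ (cylParam γ θ₀) z :=
  ContMDiffAt.comp z (contMDiffAt_cylChart_symm θ₀ hz) (contDiffAt_prodMap_fst hγ).contMDiffAt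

theorem mfderiv_cylParam {γ : ℝ → ℝ} {θ₀ : Y} {z : ℝ × EuclideanSpace ℝ (Fin n)}
    (hγ : ContDiffAt ℝ ∞ γ z.1) (hz : z.2 ∈ (extChartAt (𝓡 n) θ₀).target)
    (w : ℝ × EuclideanSpace ℝ (Fin n)) :
    (mfderiv 𝓘(ℝ, ℝ × EuclideanSpace ℝ (Fin n)) (cylModel n) (cylParam γ θ₀) z w :
      ℝ × EuclideanSpace ℝ (Fin n)) =
      coordField θ₀ (deriv γ z.1 * w.1, w.2) (cylParam γ θ₀ z) := by
  set κ : ℝ × EuclideanSpace ℝ (Fin n) → ℝ × EuclideanSpace ℝ (Fin n) :=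
    fun z => (γ z.1, z.2) with hκ
  have hγd : DifferentiableAt ℝ γ z.1 := hγ.differentiableAt (by simp)
  have h1 : HasFDerivAt κ
      ((deriv γ z.1 • ContinuousLinearMap.fst ℝ ℝ (EuclideanSpace ℝ (Fin n))).prod
        (ContinuousLinearMap.snd ℝ ℝ (EuclideanSpace ℝ (Fin n)))) z :=
    (hγd.hasDerivAt.comp_hasFDerivAt z hasFDerivAt_fst).prodMk hasFDerivAt_snd
  have h2 : MDifferentiableAt 𝓘(ℝ, ℝ × EuclideanSpace ℝ (Fin n)) (cylModel n)
      (cylChart (n := n) θ₀).symm (κ z) :=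
    (contMDiffAt_cylChart_symm θ₀ (z := κ z) hz).mdifferentiableAt (by simp)
  have h3 := mfderiv_comp z h2 h1.differentiableAt.mdifferentiableAt
  have h4 : cylChart (n := n) θ₀ (cylParam γ θ₀ z) = κ z :=
    (cylChart (n := n) θ₀).right_inv ((mem_cylChart_target θ₀ _).2 hz)
  change (mfderiv 𝓘(ℝ, ℝ × EuclideanSpace ℝ (Fin n)) (cylModel n)
    ((cylChart (n := n) θ₀).symm ∘ κ) z w : ℝ × EuclideanSpace ℝ (Fin n)) = _
  rw [h3, coordField, h4, mfderiv_eq_fderiv, h1.fderiv]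
  rfl

theorem contMDiffAt_cylCoord {δ : ℝ → ℝ} {θ₀ : Y} {p : ℝ × Y}
    (hδ : ContDiffAt ℝ ∞ δ p.1) (hp : p.2 ∈ (extChartAt (𝓡 n) θ₀).source) :
    ContMDiffAt (cylModel n) 𝓘(ℝ, ℝ × EuclideanSpace ℝ (Fin n)) ∞ (cylCoord (n := n) δ θ₀) p := by
  rw [extChartAt_source] at hp
  have h1 : ContMDiffAt (cylModel n) 𝓘(ℝ, ℝ) ∞ (fun p : ℝ × Y => δ p.1) p :=
    ContMDiffAt.comp p hδ.contMDiffAt contMDiffAt_fst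
  have h2 : ContMDiffAt (cylModel n) 𝓘(ℝ, EuclideanSpace ℝ (Fin n)) ∞
      (fun p : ℝ × Y => extChartAt (𝓡 n) θ₀ p.2) p :=
    ContMDiffAt.comp p (contMDiffAt_extChartAt' hp) contMDiffAt_snd
  exact h1.prodMk_space h2

theorem cylCoord_mem_target {δ : ℝ → ℝ} {θ₀ : Y} {p : ℝ × Y}
    (hp : p.2 ∈ (extChartAt (𝓡 n) θ₀).source) :
    (cylCoord (n := n) δ θ₀ p).2 ∈ (extChartAt (𝓡 n) θ₀).target :=
  (extChartAt (𝓡 n) θ₀).map_source hp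

theorem cylParam_cylCoord {γ δ : ℝ → ℝ} {θ₀ : Y} {p : ℝ × Y}
    (hp : p.2 ∈ (extChartAt (𝓡 n) θ₀).source) (h : γ (δ p.1) = p.1) :
    cylParam γ θ₀ (cylCoord (n := n) δ θ₀ p) = p := by
  rw [cylParam_apply]
  exact Prod.ext h ((extChartAt (𝓡 n) θ₀).left_inv hp)

theorem cylCoord_cylParam {γ δ : ℝ → ℝ} {θ₀ : Y} {z : ℝ × EuclideanSpace ℝ (Fin n)}
    (hz : z.2 ∈ (extChartAt (𝓡 n) θ₀).target) (h : δ (γ z.1) = z.1) :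
    cylCoord δ θ₀ (cylParam γ θ₀ z) = z := by
  rw [cylParam_apply]
  exact Prod.ext h ((extChartAt (𝓡 n) θ₀).right_inv hz)

/-- `γ` and `δ` are mutually inverse smooth functions near `δ s` and `s`. -/
structure LocalInverse (γ δ : ℝ → ℝ) (s : ℝ) : Prop where
  left : ContDiffAt ℝ ∞ γ (δ s)
  right : ContDiffAt ℝ ∞ δ s
  left_inv : ∀ᶠ x in 𝓝 s, γ (δ x) = x
  right_inv : ∀ᶠ x in 𝓝 (δ s), δ (γ x) = x

/-- The variable t = log ρ turns ρ∂_ρ into the coordinate field ∂_t, so the b-frame commutes and the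
coordinate formula applies to it directly. -/
theorem localInverse_exp_log {s : ℝ} (hs : 0 < s) : LocalInverse Real.exp Real.log s where
  left := Real.contDiff_exp.contDiffAt
  right := Real.contDiffAt_log.2 hs.ne'
  left_inv := by
    filter_upwards [lt_mem_nhds hs] with x hx
    exact Real.exp_log hx
  right_inv := Eventually.of_forall Real.log_exp

/-- The variable r = 1/ρ is the one in which the conic and warped metrics are diagonal blocks. -/
theorem localInverse_inv {s : ℝ} (hs : 0 < s) : LocalInverse (·⁻¹) (·⁻¹) s where
  left := contDiffAt_inv ℝ (inv_pos.2 hs).ne'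
  right := contDiffAt_inv ℝ hs.ne'
  left_inv := Eventually.of_forall inv_inv
  right_inv := Eventually.of_forall inv_inv

section

variable {γ δ : ℝ → ℝ} {θ₀ : Y} {p : ℝ × Y} (hγδ : LocalInverse γ δ p.1)
  (hp : p.2 ∈ (extChartAt (𝓡 n) θ₀).source)

include hγδ hp

theorem eventually_cylParam_cylCoord : ∀ᶠ x in 𝓝 p, cylParam γ θ₀ (cylCoord (n := n) δ θ₀ x) = x := by
  have h1 : ∀ᶠ x : ℝ × Y in 𝓝 p, γ (δ x.1) = x.1 :=
    (continuous_fst.tendsto p).eventually hγδ.left_inv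
  have h2 : ∀ᶠ x : ℝ × Y in 𝓝 p, x.2 ∈ (extChartAt (𝓡 n) θ₀).source :=
    (continuous_snd.tendsto p).eventually ((isOpen_extChartAt_source θ₀).mem_nhds hp)
  filter_upwards [h1, h2] with x h3 h4
  exact cylParam_cylCoord h4 h3

theorem eventually_cylCoord_mem_target :
    ∀ᶠ z in 𝓝 (cylCoord (n := n) δ θ₀ p), z.2 ∈ (extChartAt (𝓡 n) θ₀).target :=
  (continuous_snd.tendsto _).eventually
    ((isOpen_extChartAt_target (I := 𝓡 n) θ₀).mem_nhds (cylCoord_mem_target (δ := δ) hp))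

theorem eventually_cylCoord_cylParam :
    ∀ᶠ z in 𝓝 (cylCoord (n := n) δ θ₀ p), cylCoord δ θ₀ (cylParam γ θ₀ z) = z := by
  have h0 : ∀ᶠ t in 𝓝 (cylCoord (n := n) δ θ₀ p).1, δ (γ t) = t := hγδ.right_inv
  have h1 : ∀ᶠ z in 𝓝 (cylCoord (n := n) δ θ₀ p), δ (γ z.1) = z.1 :=
    (continuous_fst.tendsto _).eventually h0
  filter_upwards [h1, eventually_cylCoord_mem_target hγδ hp] with z h3 h4
  exact cylCoord_cylParam h4 h3

theorem contMDiffAt_cylParam_cylCoord :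
    ContMDiffAt 𝓘(ℝ, ℝ × EuclideanSpace ℝ (Fin n)) (cylModel n) ∞ (cylParam γ θ₀)
      (cylCoord (n := n) δ θ₀ p) :=
  contMDiffAt_cylParam hγδ.left (cylCoord_mem_target hp)

theorem tendsto_cylParam :
    Tendsto (cylParam γ θ₀) (𝓝 (cylCoord (n := n) δ θ₀ p)) (𝓝 p) := by
  have := (contMDiffAt_cylParam_cylCoord hγδ hp).continuousAt.tendsto
  rwa [cylParam_cylCoord hp hγδ.left_inv.self_of_nhds] at this

theorem contDiffAt_comp_cylParam {v : ℝ × Y → ℝ} {k : WithTop ℕ∞} (hk : k ≤ ∞)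
    (hv : ContMDiffAt (cylModel n) 𝓘(ℝ, ℝ) k v p) :
    ContDiffAt ℝ k (fun z => v (cylParam γ θ₀ z)) (cylCoord (n := n) δ θ₀ p) := by
  rw [← contMDiffAt_iff_contDiffAt]
  refine ContMDiffAt.comp _ ?_ ((contMDiffAt_cylParam_cylCoord hγδ hp).of_le hk)
  rwa [cylParam_cylCoord hp hγδ.left_inv.self_of_nhds]

theorem laplaceBeltrami_cylParam {g : BilinField (cylModel n) (ℝ × Y)} {v : ℝ × Y → ℝ}
    (hs : ∀ᶠ x in 𝓝 p, ∀ v w : TangentSpace (cylModel n) x, g x v w = g x w v)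
    (hpos : ∀ᶠ x in 𝓝 p, ∀ v : TangentSpace (cylModel n) x, v ≠ 0 → 0 < g x v v)
    (hg : ∀ i j, DifferentiableAt ℝ
      (fun z => pullbackForm 𝓘(ℝ, ℝ × EuclideanSpace ℝ (Fin n)) (cylModel n) (cylParam γ θ₀) g z
        (cylBasis n i) (cylBasis n j)) (cylCoord (n := n) δ θ₀ p))
    (hv : ContMDiffAt (cylModel n) 𝓘(ℝ, ℝ) ∞ v p) :
    laplaceBeltrami (cylModel n) g v p =
      flatLaplacian (cylBasis n) (fun z => gramMatrix (cylBasis n)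
        (pullbackForm 𝓘(ℝ, ℝ × EuclideanSpace ℝ (Fin n)) (cylModel n) (cylParam γ θ₀) g z))
        (fun z => v (cylParam γ θ₀ z)) (cylCoord (n := n) δ θ₀ p) :=
  laplaceBeltrami_eq_flatLaplacian (cylBasis n) BoundarylessManifold.isInteriorPoint
    (contMDiffAt_cylCoord hγδ.right hp) (contMDiffAt_cylParam_cylCoord hγδ hp)
    (eventually_cylParam_cylCoord hγδ hp) (eventually_cylCoord_cylParam hγδ hp) hs hpos hg
    ((contDiffAt_comp_cylParam hγδ hp le_rfl hv).of_le ENat.LEInfty.out)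

end

end CylParam

/-! ### The Laplace–Beltrami operator in the b-frame -/

section FrameFormula

open Filter Topology

variable {n : ℕ} {Y : Type*} [TopologicalSpace Y] [ChartedSpace (EuclideanSpace ℝ (Fin n)) Y]
  [IsManifold (𝓡 n) ∞ Y]

theorem coordField_smul (θ₀ : Y) (c : ℝ) (w : ℝ × EuclideanSpace ℝ (Fin n)) (p : ℝ × Y) :
    coordField θ₀ (c • w) p = c • coordField θ₀ w p :=
  map_smul (mfderiv 𝓘(ℝ, ℝ × EuclideanSpace ℝ (Fin n)) (cylModel n) (cylChart (n := n) θ₀).symm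
    (cylChart (n := n) θ₀ p)) c w

theorem frameWeight_smul_cylBasis (a : CylIndex n) (s : ℝ) :
    frameWeight n a s • cylBasis n a = (s * (cylBasis n a).1, (cylBasis n a).2) := by
  rcases a with a | a <;> simp [frameWeight]

section

variable {χ : Y → ℝ} {θ₀ : Y} {z : ℝ × EuclideanSpace ℝ (Fin n)}
  (hz : z.2 ∈ (extChartAt (𝓡 n) θ₀).target) (hχ : χ (cylParam Real.exp θ₀ z).2 = 1)

include hz hχ

/-- Since d(eᵗ)/dt = eᵗ = ρ, the radial derivative acquires precisely the weight ρ of the frame,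
while the angular ones are unchanged. -/
theorem mfderiv_cylParam_exp (a : CylIndex n) :
    (mfderiv 𝓘(ℝ, ℝ × EuclideanSpace ℝ (Fin n)) (cylModel n) (cylParam Real.exp θ₀) z
      (cylBasis n a) : ℝ × EuclideanSpace ℝ (Fin n)) =
      collarField χ θ₀ a (cylParam Real.exp θ₀ z) := by
  rw [mfderiv_cylParam Real.contDiff_exp.contDiffAt hz, Real.deriv_exp, ← frameWeight_smul_cylBasis,
    coordField_smul, collarField, hχ, one_mul, cylParam_apply]

theorem fderiv_comp_cylParam_exp {f : ℝ × Y → ℝ}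
    (hf : MDifferentiableAt (cylModel n) 𝓘(ℝ, ℝ) f (cylParam Real.exp θ₀ z)) (a : CylIndex n) :
    fderiv ℝ (fun z => f (cylParam Real.exp θ₀ z)) z (cylBasis n a) =
      vfDeriv (cylModel n) (collarField χ θ₀ a) f (cylParam Real.exp θ₀ z) := by
  have h1 : MDifferentiableAt 𝓘(ℝ, ℝ × EuclideanSpace ℝ (Fin n)) (cylModel n)
      (cylParam Real.exp θ₀) z :=
    (contMDiffAt_cylParam Real.contDiff_exp.contDiffAt hz).mdifferentiableAt (by simp)
  have h2 := mfderiv_comp z hf h1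
  have h3 : (fderiv ℝ (fun z => f (cylParam Real.exp θ₀ z)) z) =
      (mfderiv 𝓘(ℝ, ℝ × EuclideanSpace ℝ (Fin n)) 𝓘(ℝ, ℝ) (f ∘ cylParam Real.exp θ₀) z) :=
    mfderiv_eq_fderiv.symm
  have h4 := mfderiv_cylParam_exp hz hχ a
  rw [h3, h2]
  change (mfderiv (cylModel n) 𝓘(ℝ, ℝ) f (cylParam Real.exp θ₀ z) :
    (ℝ × EuclideanSpace ℝ (Fin n)) →L[ℝ] ℝ) (mfderiv 𝓘(ℝ, ℝ × EuclideanSpace ℝ (Fin n))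
      (cylModel n) (cylParam Real.exp θ₀) z (cylBasis n a) : ℝ × EuclideanSpace ℝ (Fin n)) = _
  rw [h4]
  rfl

theorem pullbackForm_cylParam_exp (g : BilinField (cylModel n) (ℝ × Y)) (a b : CylIndex n) :
    (pullbackForm 𝓘(ℝ, ℝ × EuclideanSpace ℝ (Fin n)) (cylModel n) (cylParam Real.exp θ₀) g z
      (cylBasis n a) (cylBasis n b) : ℝ) =
      g (cylParam Real.exp θ₀ z) (collarField χ θ₀ a (cylParam Real.exp θ₀ z))
        (collarField χ θ₀ b (cylParam Real.exp θ₀ z)) := by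
  have h1 := mfderiv_cylParam_exp hz hχ a
  have h2 := mfderiv_cylParam_exp hz hχ b
  change (g (cylParam Real.exp θ₀ z) : (ℝ × EuclideanSpace ℝ (Fin n)) →L[ℝ]
    (ℝ × EuclideanSpace ℝ (Fin n)) →L[ℝ] ℝ) (mfderiv 𝓘(ℝ, ℝ × EuclideanSpace ℝ (Fin n))
      (cylModel n) (cylParam Real.exp θ₀) z (cylBasis n a) : ℝ × EuclideanSpace ℝ (Fin n))
      (mfderiv 𝓘(ℝ, ℝ × EuclideanSpace ℝ (Fin n))
      (cylModel n) (cylParam Real.exp θ₀) z (cylBasis n b) : ℝ × EuclideanSpace ℝ (Fin n)) = _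
  rw [h1, h2]

end

theorem coordField_ne_zero {θ₀ : Y} {p : ℝ × Y} (hp : p.2 ∈ (extChartAt (𝓡 n) θ₀).source)
    {w : ℝ × EuclideanSpace ℝ (Fin n)} (hw : w ≠ 0) : coordField θ₀ w p ≠ 0 := by
  intro h0
  refine hw ?_
  set e := cylChart (n := n) θ₀
  have hps : p ∈ e.source := (mem_cylChart_source θ₀ p).2 hp
  have hpt : e p ∈ e.target := e.map_source hps
  have h1 : MDifferentiableAt 𝓘(ℝ, ℝ × EuclideanSpace ℝ (Fin n)) (cylModel n) e.symm (e p) :=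
    (contMDiffAt_cylChart_symm θ₀ ((mem_cylChart_target θ₀ _).1 hpt)).mdifferentiableAt (by simp)
  have h2 : MDifferentiableAt (cylModel n) 𝓘(ℝ, ℝ × EuclideanSpace ℝ (Fin n)) e (e.symm (e p)) := by
    rw [e.left_inv hps]
    refine (contMDiffAt_extChartAt' (n := 1) ?_).mdifferentiableAt one_ne_zero
    rwa [← extChartAt_source (cylModel n)]
  have h3 : ∀ᶠ z in 𝓝 (e p), e (e.symm z) = z := by
    filter_upwards [(isOpen_extChartAt_target (I := cylModel n) ((0 : ℝ), θ₀)).mem_nhds hpt] with z hz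
    exact e.right_inv hz
  have h4 := mfderiv_comp_leftInverse h1 h2 h3 w
  refine h4.symm.trans ?_
  refine (congrArg (fun x' => (mfderiv (cylModel n) 𝓘(ℝ, ℝ × EuclideanSpace ℝ (Fin n)) e
    (e.symm (e p)) x' : ℝ × EuclideanSpace ℝ (Fin n))) h0).trans ?_
  exact map_zero (mfderiv (cylModel n) 𝓘(ℝ, ℝ × EuclideanSpace ℝ (Fin n)) e (e.symm (e p)))

/-- The Gram matrix of a metric in the rescaled frame. -/
def scGram (g : BilinField (cylModel n) (ℝ × Y)) (χ : Y → ℝ) (θ₀ : Y) (p : ℝ × Y) :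
    Matrix (CylIndex n) (CylIndex n) ℝ :=
  Matrix.of fun a b => g p (p.1 • collarField χ θ₀ a p) (p.1 • collarField χ θ₀ b p)

/-- For ρ > 0 and χ = 1 the rescaling factors are units, so this is the Gram matrix of a positive
definite form in a rescaled basis. -/
theorem scGram_det_pos {g : BilinField (cylModel n) (ℝ × Y)} {χ : Y → ℝ} {θ₀ : Y} {p : ℝ × Y}
    (hp : p.2 ∈ (extChartAt (𝓡 n) θ₀).source) (hp1 : 0 < p.1) (hχ : χ p.2 = 1)
    (hs : ∀ v w : TangentSpace (cylModel n) p, g p v w = g p w v)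
    (hpos : ∀ v : TangentSpace (cylModel n) p, v ≠ 0 → 0 < g p v v) :
    0 < (scGram g χ θ₀ p).det := by
  let L : (ℝ × EuclideanSpace ℝ (Fin n)) →L[ℝ] (ℝ × EuclideanSpace ℝ (Fin n)) :=
    mfderiv 𝓘(ℝ, ℝ × EuclideanSpace ℝ (Fin n)) (cylModel n) (cylChart (n := n) θ₀).symm
      (cylChart (n := n) θ₀ p)
  let B : (ℝ × EuclideanSpace ℝ (Fin n)) →L[ℝ] (ℝ × EuclideanSpace ℝ (Fin n)) →L[ℝ] ℝ :=
    (ContinuousLinearMap.precomp ℝ L).comp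
      ((g p : (ℝ × EuclideanSpace ℝ (Fin n)) →L[ℝ] (ℝ × EuclideanSpace ℝ (Fin n)) →L[ℝ] ℝ).comp L)
  have hc : ∀ a : CylIndex n, IsUnit (p.1 * frameWeight n a p.1) := fun a => by
    rcases a with a | a
    · simp [frameWeight, hp1.ne']
    · simp [frameWeight, hp1.ne']
  have h1 : scGram g χ θ₀ p = gramMatrix ((cylBasis n).isUnitSMul hc) B := by
    ext a b
    have h2 : ∀ a, (p.1 • collarField χ θ₀ a p : TangentSpace (cylModel n) p) =
        L ((cylBasis n).isUnitSMul hc a) := fun a => by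
      rw [Module.Basis.isUnitSMul_apply, map_smul, collarField, hχ, one_mul, smul_smul]
      rfl
    simp only [scGram, gramMatrix, Matrix.of_apply]
    rw [h2, h2]
    rfl
  rw [h1]
  refine gramMatrix_det_pos _ B (fun v w => hs _ _) fun v hv => hpos _ ?_
  exact coordField_ne_zero hp hv

/-- The Laplace--Beltrami operator in the frame `collarField χ θ₀`, where `χ = 1`. -/
theorem laplaceBeltrami_frame {g : BilinField (cylModel n) (ℝ × Y)} {χ : Y → ℝ} {θ₀ : Y}
    {N : Set Y} (hN : IsOpen N) (hNs : N ⊆ (extChartAt (𝓡 n) θ₀).source)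
    (hsmooth : ContMDiff (𝓡 n) 𝓘(ℝ, ℝ) ∞ χ)
    (hsupp : tsupport χ ⊆ (extChartAt (𝓡 n) θ₀).source)
    (hχ : ∀ θ ∈ N, χ θ = 1)
    (hs : ∀ p ∈ cylInterior Y, ∀ v w : TangentSpace (cylModel n) p, g p v w = g p w v)
    (hpos : ∀ p ∈ cylInterior Y, ∀ v : TangentSpace (cylModel n) p, v ≠ 0 → 0 < g p v v)
    {K : ℝ × Y → Matrix (CylIndex n) (CylIndex n) ℝ}
    (hK : ∀ a b, ContMDiffOn (cylModel n) 𝓘(ℝ, ℝ) ∞ (fun p => K p a b) (Ico (0 : ℝ) 1 ×ˢ N))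
    (hgK : ∀ p ∈ Ioo (0 : ℝ) 1 ×ˢ N, scGram g χ θ₀ p = K p)
    {v : ℝ × Y → ℝ} (hv : ContMDiffOn (cylModel n) 𝓘(ℝ, ℝ) ∞ v (cylInterior Y))
    {p : ℝ × Y} (hp : p ∈ Ioo (0 : ℝ) 1 ×ˢ N) :
    laplaceBeltrami (cylModel n) g v p =
      -(p.1 ^ 2 * (∑ a, ∑ b, (K p)⁻¹ a b *
          vfDeriv (cylModel n) (collarField χ θ₀ a) (vfDeriv (cylModel n) (collarField χ θ₀ b) v) p +
        ∑ b, frameCoeff (cylModel n) (Ico (0 : ℝ) 1 ×ˢ N) (collarField χ θ₀) (frameBeta χ) K b p *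
          vfDeriv (cylModel n) (collarField χ θ₀ b) v p)) := by
  have hUopen : IsOpen (Ioo (0 : ℝ) 1 ×ˢ N) := isOpen_Ioo.prod hN
  have hUsub : Ioo (0 : ℝ) 1 ×ˢ N ⊆ cylInterior Y := prod_mono le_rfl (subset_univ _)
  have hUS : Ioo (0 : ℝ) 1 ×ˢ N ⊆ Ico (0 : ℝ) 1 ×ˢ N := prod_mono Ioo_subset_Ico_self le_rfl
  have hcyl : IsOpen (cylInterior Y) := isOpen_Ioo.prod isOpen_univ
  have hUnhds : ∀ q ∈ Ioo (0 : ℝ) 1 ×ˢ N, Ico (0 : ℝ) 1 ×ˢ N ∈ 𝓝 q := fun q hq =>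
    mem_of_superset (hUopen.mem_nhds hq) hUS
  have hps : p.2 ∈ (extChartAt (𝓡 n) θ₀).source := hNs hp.2
  -- Coordinates with ρ = eᵗ are chosen, in which the frame consists of coordinate fields.
  have hγ : LocalInverse Real.exp Real.log p.1 := localInverse_exp_log hp.1.1
  set Φ : ℝ × EuclideanSpace ℝ (Fin n) → ℝ × Y := cylParam Real.exp θ₀ with hΦ
  set z₀ := cylCoord (n := n) Real.log θ₀ p with hz₀
  have hΦz₀ : Φ z₀ = p := cylParam_cylCoord hps hγ.left_inv.self_of_nhds
  have hev : ∀ᶠ z in 𝓝 z₀, z.2 ∈ (extChartAt (𝓡 n) θ₀).target ∧ Φ z ∈ Ioo (0 : ℝ) 1 ×ˢ N :=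
    (eventually_cylCoord_mem_target hγ hps).and
      ((tendsto_cylParam hγ hps).eventually (hUopen.mem_nhds hp))
  have hχΦ : ∀ z, Φ z ∈ Ioo (0 : ℝ) 1 ×ˢ N → χ (Φ z).2 = 1 := fun z hz => hχ _ hz.2
  have hV : ∀ a, ContMDiff (cylModel n) (cylModel n).tangent ∞
      (fun p => (⟨p, collarField χ θ₀ a p⟩ : TangentBundle (cylModel n) (ℝ × Y))) :=
    contMDiff_collarField hsmooth hsupp
  have hVv : ∀ b, ContMDiffOn (cylModel n) 𝓘(ℝ, ℝ) ∞
      (vfDeriv (cylModel n) (collarField χ θ₀ b) v) (cylInterior Y) := fun b =>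
    (contMDiffOn_vfDerivWithin hcyl.uniqueMDiffOn (hV b).contMDiffOn hv).congr fun q hq =>
      (vfDerivWithin_of_mem_nhds (hcyl.mem_nhds hq)).symm
  have hmd : ∀ {f : ℝ × Y → ℝ} {S : Set (ℝ × Y)} {q : ℝ × Y},
      ContMDiffOn (cylModel n) 𝓘(ℝ, ℝ) ∞ f S → S ∈ 𝓝 q →
      MDifferentiableAt (cylModel n) 𝓘(ℝ, ℝ) f q := fun hf hq =>
    (hf.contMDiffAt hq).mdifferentiableAt (by simp)
  have hdet : ∀ q ∈ Ioo (0 : ℝ) 1 ×ˢ N, 0 < (K q).det := fun q hq => by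
    rw [← hgK q hq]
    exact scGram_det_pos (hNs hq.2) hq.1.1 (hχ _ hq.2) (hs q (hUsub hq)) (hpos q (hUsub hq))
  -- K is computed with an additional factor ρ in each argument, hence the metric is ρ⁻²K in these
  -- coordinates.
  have hgram : ∀ᶠ z in 𝓝 z₀, gramMatrix (cylBasis n)
      (pullbackForm 𝓘(ℝ, ℝ × EuclideanSpace ℝ (Fin n)) (cylModel n) Φ g z) =
      (Real.exp z.1 ^ 2)⁻¹ • K (Φ z) := by
    filter_upwards [hev] with z hz
    ext a b
    have h1 := pullbackForm_cylParam_exp hz.1 (hχΦ z hz.2) g a b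
    refine h1.trans ?_
    have h2 : (Φ z).1 = Real.exp z.1 := by rw [hΦ, cylParam_apply]
    rw [Matrix.smul_apply, ← hgK _ hz.2, ← h2]
    simp only [scGram, Matrix.of_apply, map_smul, _root_.smul_apply, smul_eq_mul]
    have h3 : (Φ z).1 ≠ 0 := hz.2.1.1.ne'
    field_simp
    rfl
  have hKΦ : ∀ a b, DifferentiableAt ℝ (fun z => K (Φ z) a b) z₀ := fun a b =>
    (contDiffAt_comp_cylParam hγ hps le_rfl ((hK a b).contMDiffAt (hUnhds p hp))).differentiableAt
      (by simp)
  have hexp : DifferentiableAt ℝ (fun z : ℝ × EuclideanSpace ℝ (Fin n) => Real.exp z.1) z₀ :=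
    differentiableAt_fst.exp
  have hvp : ContMDiffAt (cylModel n) 𝓘(ℝ, ℝ) ∞ v p := hv.contMDiffAt (hcyl.mem_nhds (hUsub hp))
  -- Smoothness of K⁻¹ and det K is read off from the congruence calculus applied to K and itself,
  -- with j = 0.
  have hKinv : ∀ a b, ContMDiffOn (cylModel n) 𝓘(ℝ, ℝ) ∞ (fun p => (K p)⁻¹ a b)
      (Ioo (0 : ℝ) 1 ×ˢ N) := fun a b =>
    (CongrMod.matrix_inv (ρ := Prod.fst) (j := 0) (fun a b => CongrMod.refl ((hK a b).mono hUS))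
      (fun q hq => (hdet q hq).ne') (fun q hq => (hdet q hq).ne') a b).left
  have hKdet : ContMDiffOn (cylModel n) 𝓘(ℝ, ℝ) ∞ (fun p => (K p).det) (Ioo (0 : ℝ) 1 ×ˢ N) :=
    (CongrMod.det (ρ := Prod.fst) (j := 0) (fun a b => CongrMod.refl ((hK a b).mono hUS))).left
  rw [laplaceBeltrami_cylParam hγ hps (by
      filter_upwards [hcyl.mem_nhds (hUsub hp)] with q hq using hs q hq) (by
      filter_upwards [hcyl.mem_nhds (hUsub hp)] with q hq using hpos q hq) (fun a b => by
      refine DifferentiableAt.congr_of_eventuallyEq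
        (f := fun z => (Real.exp z.1 ^ 2)⁻¹ * K (Φ z) a b) ?_ ?_
      · exact ((hexp.pow 2).inv (pow_ne_zero 2 (Real.exp_pos _).ne')).mul (hKΦ a b)
      · filter_upwards [hgram] with z hz
        exact congrFun (congrFun hz a) b) hvp,
    flatLaplacian_conformal (cylBasis n) hgram hKΦ (by rw [hΦz₀]; exact hdet p hp) hexp
      (Real.exp_pos _) ((contDiffAt_comp_cylParam hγ hps le_rfl hvp).of_le ENat.LEInfty.out)]
  have hz₀t := hev.self_of_nhds
  have hD : ∀ {f : ℝ × Y → ℝ}, MDifferentiableAt (cylModel n) 𝓘(ℝ, ℝ) f p → ∀ a,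
      fderiv ℝ (fun z => f (Φ z)) z₀ (cylBasis n a) =
        vfDeriv (cylModel n) (collarField χ θ₀ a) f p := fun {f} hf a => by
    have := fderiv_comp_cylParam_exp hz₀t.1 (hχΦ _ hz₀t.2) (f := f) (by
      rw [← hΦ, hΦz₀]; exact hf) a
    rw [← hΦ, hΦz₀] at this
    exact this
  have hexp0 : Real.exp z₀.1 = p.1 := Real.exp_log hp.1.1
  have hD2 : ∀ a b, fderiv ℝ (fun z => fderiv ℝ (fun z => v (Φ z)) z (cylBasis n b)) z₀
      (cylBasis n a) = vfDeriv (cylModel n) (collarField χ θ₀ a)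
        (vfDeriv (cylModel n) (collarField χ θ₀ b) v) p := fun a b => by
    rw [← hD (hmd (hVv b) (hcyl.mem_nhds (hUsub hp)))]
    refine congrArg (fun φ : (ℝ × EuclideanSpace ℝ (Fin n)) →L[ℝ] ℝ => φ (cylBasis n a))
      (Filter.EventuallyEq.fderiv_eq ?_)
    filter_upwards [hev] with z hz
    exact fderiv_comp_cylParam_exp hz.1 (hχΦ z hz.2) (hmd hv (hcyl.mem_nhds (hUsub hz.2))) b
  have hfst : ∀ a, fderiv ℝ (fun z : ℝ × EuclideanSpace ℝ (Fin n) => Real.exp z.1) z₀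
      (cylBasis n a) = p.1 * frameBeta χ a p := fun a => by
    rw [← vfDeriv_fst_collarField hsupp, ← hD (contMDiff_fst (n := 1)|>.mdifferentiableAt one_ne_zero)]
    congr 2
  have hU := hUopen.mem_nhds hp
  have hcoef : ∀ b, firstOrderCoeff (fun i j => (K (Φ z₀))⁻¹ i j) (K (Φ z₀)).det (Real.exp z₀.1)
      (fun k i j => fderiv ℝ (fun z => (K (Φ z))⁻¹ i j) z₀ (cylBasis n k))
      (fun k => fderiv ℝ (fun z => (K (Φ z)).det) z₀ (cylBasis n k))
      (fun k => fderiv ℝ (fun z : ℝ × EuclideanSpace ℝ (Fin n) => Real.exp z.1) z₀ (cylBasis n k)) b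
      = frameCoeff (cylModel n) (Ico (0 : ℝ) 1 ×ˢ N) (collarField χ θ₀) (frameBeta χ) K b p :=
    fun b => by
    unfold firstOrderCoeff frameCoeff
    refine Finset.sum_congr rfl fun a _ => ?_
    have h1 : fderiv ℝ (fun z => (K (Φ z))⁻¹ a b) z₀ (cylBasis n a) = _ :=
      hD (hmd (hKinv a b) hU) a
    have h2 : fderiv ℝ (fun z => (K (Φ z)).det) z₀ (cylBasis n a) = _ := hD (hmd hKdet hU) a
    have hp1 : p.1 ≠ 0 := hp.1.1.ne'
    simp only [h1, h2, hfst, hexp0, hΦz₀, vfDerivWithin_of_mem_nhds (hUnhds p hp)]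
    field_simp
  rw [hexp0]
  refine congrArg (fun x => -(p.1 ^ 2 * x)) (congrArg₂ (· + ·) (Finset.sum_congr rfl fun a _ =>
    Finset.sum_congr rfl fun b _ => congrArg₂ (· * ·) (by rw [hΦz₀]) (hD2 a b))
    (Finset.sum_congr rfl fun b _ => congrArg₂ (· * ·) ?_
      (hD (hmd hv (hcyl.mem_nhds (hUsub hp))) b)))
  rw [← hcoef, hexp0]

end FrameFormula

/-! ### The intermediate metrics f(ρ)dr² + r²h -/

section WarpedMetric

open Filter Topology

variable {n : ℕ} {Y : Type*} [TopologicalSpace Y] [ChartedSpace (EuclideanSpace ℝ (Fin n)) Y]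

/-- The metric `f(ρ) dr² + r² h` on `(0,1) × Y`, where `r = ρ^{-1}`. -/
def warpedMetric (f : ℝ → ℝ) (h : BilinField (𝓡 n) Y) : BilinField (cylModel n) (ℝ × Y) :=
  fun p => f p.1 • drSq n Y p + (p.1 ^ 2)⁻¹ • pullbackForm (cylModel n) (𝓡 n) (Prod.snd : ℝ × Y → Y) h p

theorem conicMetric_eq_warpedMetric (h : BilinField (𝓡 n) Y) :
    conicMetric h = warpedMetric (fun _ => 1) h := by
  funext p
  rw [conicMetric, warpedMetric, one_smul]

theorem drSq_apply (p : ℝ × Y) (v w : ℝ × EuclideanSpace ℝ (Fin n)) :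
    drSq n Y p v w = (p.1 ^ 4)⁻¹ * (v.1 * w.1) := by
  have h1 : mfderiv (cylModel n) 𝓘(ℝ, ℝ) (Prod.fst : ℝ × Y → ℝ) p =
      ContinuousLinearMap.fst ℝ ℝ (EuclideanSpace ℝ (Fin n)) := mfderiv_fst
  have h2 : drSq n Y p v w = (p.1 ^ 4)⁻¹ * ContinuousLinearMap.mul ℝ ℝ
    (mfderiv (cylModel n) 𝓘(ℝ, ℝ) (Prod.fst : ℝ × Y → ℝ) p v)
    (mfderiv (cylModel n) 𝓘(ℝ, ℝ) (Prod.fst : ℝ × Y → ℝ) p w) := rfl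
  rw [h2, h1]
  rfl

theorem warpedMetric_apply (f : ℝ → ℝ) (h : BilinField (𝓡 n) Y) (p : ℝ × Y)
    (v w : TangentSpace (cylModel n) p) :
    warpedMetric f h p v w = f p.1 * drSq n Y p v w + (p.1 ^ 2)⁻¹ *
      h p.2 (mfderiv (cylModel n) (𝓡 n) (Prod.snd : ℝ × Y → Y) p v)
        (mfderiv (cylModel n) (𝓡 n) (Prod.snd : ℝ × Y → Y) p w) := rfl

theorem mfderiv_fst_apply (p : ℝ × Y) (v : ℝ × EuclideanSpace ℝ (Fin n)) :
    (mfderiv (cylModel n) 𝓘(ℝ, ℝ) (Prod.fst : ℝ × Y → ℝ) p v : ℝ) = v.1 := by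
  rw [mfderiv_fst]; rfl

theorem mfderiv_snd_apply (p : ℝ × Y) (v : ℝ × EuclideanSpace ℝ (Fin n)) :
    (mfderiv (cylModel n) (𝓡 n) (Prod.snd : ℝ × Y → Y) p v : EuclideanSpace ℝ (Fin n)) = v.2 := by
  rw [mfderiv_snd]; rfl

theorem warpedMetric_symm (f : ℝ → ℝ) {h : BilinField (𝓡 n) Y}
    (hs : ∀ θ, ∀ v w : TangentSpace (𝓡 n) θ, h θ v w = h θ w v) (p : ℝ × Y)
    (v w : TangentSpace (cylModel n) p) : warpedMetric f h p v w = warpedMetric f h p w v := by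
  have h1 : drSq n Y p v w = drSq n Y p w v :=
    (drSq_apply p v w).trans ((congrArg (fun x => (p.1 ^ 4)⁻¹ * x) (mul_comm _ _)).trans
      (drSq_apply p w v).symm)
  rw [warpedMetric_apply, warpedMetric_apply, hs, h1]

theorem warpedMetric_pos {f : ℝ → ℝ} {h : BilinField (𝓡 n) Y}
    (hpos : ∀ θ, ∀ v : TangentSpace (𝓡 n) θ, v ≠ 0 → 0 < h θ v v) {p : ℝ × Y} (hp : 0 < p.1)
    (hf : 0 < f p.1) (v : TangentSpace (cylModel n) p) (hv : v ≠ 0) :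
    0 < warpedMetric f h p v v := by
  have h2 := mfderiv_snd_apply p v
  have h1 : drSq n Y p v v = (p.1 ^ 4)⁻¹ * ((v : ℝ × EuclideanSpace ℝ (Fin n)).1 *
    (v : ℝ × EuclideanSpace ℝ (Fin n)).1) := drSq_apply p v v
  rw [warpedMetric_apply, h1]
  by_cases h0 : (v : ℝ × EuclideanSpace ℝ (Fin n)).2 = 0
  · have h3 : (v : ℝ × EuclideanSpace ℝ (Fin n)).1 ≠ 0 := fun h => hv (Prod.ext h h0)
    have h4 : mfderiv (cylModel n) (𝓡 n) (Prod.snd : ℝ × Y → Y) p v = 0 := h2.trans h0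
    rw [h4, map_zero, mul_zero, add_zero]
    have := mul_self_pos.2 h3
    positivity
  · have h4 : mfderiv (cylModel n) (𝓡 n) (Prod.snd : ℝ × Y → Y) p v ≠ 0 := fun h => h0 (h2.symm.trans h)
    have h5 := hpos p.2 _ h4
    have := mul_self_nonneg (v : ℝ × EuclideanSpace ℝ (Fin n)).1
    positivity

variable [IsManifold (𝓡 n) ∞ Y]

/-- The coordinate vector fields of the chart at `θ₀` of `Y`. -/
def chartField (θ₀ : Y) (w : EuclideanSpace ℝ (Fin n)) : VField (𝓡 n) Y :=
  fun θ => mfderiv 𝓘(ℝ, EuclideanSpace ℝ (Fin n)) (𝓡 n) (extChartAt (𝓡 n) θ₀).symm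
    (extChartAt (𝓡 n) θ₀ θ) w

theorem mfderiv_snd_coordField {θ₀ : Y} {p : ℝ × Y} (hp : p.2 ∈ (extChartAt (𝓡 n) θ₀).source)
    (w : ℝ × EuclideanSpace ℝ (Fin n)) :
    (mfderiv (cylModel n) (𝓡 n) (Prod.snd : ℝ × Y → Y) p (coordField θ₀ w p) :
      EuclideanSpace ℝ (Fin n)) = chartField θ₀ w.2 p.2 := by
  set e := cylChart (n := n) θ₀
  have hps : p ∈ e.source := (mem_cylChart_source θ₀ p).2 hp
  have h1 : MDifferentiableAt 𝓘(ℝ, ℝ × EuclideanSpace ℝ (Fin n)) (cylModel n) e.symm (e p) :=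
    (contMDiffAt_cylChart_symm θ₀ ((mem_cylChart_target θ₀ _).1 (e.map_source hps))).mdifferentiableAt
      (by simp)
  have h2 : MDifferentiableAt (cylModel n) (𝓡 n) (Prod.snd : ℝ × Y → Y) (e.symm (e p)) :=
    (contMDiff_snd (n := 1)).mdifferentiableAt one_ne_zero
  have h3 := mfderiv_comp (e p) h2 h1
  have h4 : (Prod.snd : ℝ × Y → Y) ∘ e.symm = (extChartAt (𝓡 n) θ₀).symm ∘
      (Prod.snd : ℝ × EuclideanSpace ℝ (Fin n) → EuclideanSpace ℝ (Fin n)) := by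
    funext z
    exact congrArg Prod.snd (cylChart_symm_apply θ₀ z)
  have h7 : (e p).2 = extChartAt (𝓡 n) θ₀ p.2 := by rw [cylChart_apply]
  have h8 : MDifferentiableAt 𝓘(ℝ, EuclideanSpace ℝ (Fin n)) (𝓡 n) (extChartAt (𝓡 n) θ₀).symm
      ((Prod.snd : ℝ × EuclideanSpace ℝ (Fin n) → EuclideanSpace ℝ (Fin n)) (e p)) := by
    rw [h7]
    exact ((contMDiffOn_extChartAt_symm (n := 1) θ₀).contMDiffAt
      ((isOpen_extChartAt_target θ₀).mem_nhds ((extChartAt (𝓡 n) θ₀).map_source hp))).mdifferentiableAt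
      one_ne_zero
  have h9 := mfderiv_comp (e p) h8 (differentiableAt_snd.mdifferentiableAt)
  rw [h4, h9, mfderiv_eq_fderiv, fderiv_snd] at h3
  have h5 := congrArg (fun f : (ℝ × EuclideanSpace ℝ (Fin n)) →L[ℝ] EuclideanSpace ℝ (Fin n) => f w) h3
  have h6 : e.symm (e p) = p := e.left_inv hps
  have h10 : (mfderiv (cylModel n) (𝓡 n) (Prod.snd : ℝ × Y → Y) p (coordField θ₀ w p) :
      EuclideanSpace ℝ (Fin n)) = (mfderiv (cylModel n) (𝓡 n) (Prod.snd : ℝ × Y → Y) (e.symm (e p)) :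
      (ℝ × EuclideanSpace ℝ (Fin n)) →L[ℝ] EuclideanSpace ℝ (Fin n)) (coordField θ₀ w p) := by rw [h6]
  refine h10.trans (h5.symm.trans ?_)
  unfold chartField
  rw [← h7]
  rfl

variable (h : Bundle.ContMDiffRiemannianMetric (𝓡 n) ∞ (EuclideanSpace ℝ (Fin n))
      (fun θ : Y => TangentSpace (𝓡 n) θ))

/-- The components of the metric `h` in the frame `collarField χ θ₀`. -/
def sliceGram (χ : Y → ℝ) (θ₀ : Y) (p : ℝ × Y) (a b : CylIndex n) : ℝ :=
  h.inner p.2 (mfderiv (cylModel n) (𝓡 n) (Prod.snd : ℝ × Y → Y) p (collarField χ θ₀ a p))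
    (mfderiv (cylModel n) (𝓡 n) (Prod.snd : ℝ × Y → Y) p (collarField χ θ₀ b p))

theorem contMDiff_sliceGram {χ : Y → ℝ} {θ₀ : Y} (hχ : ContMDiff (𝓡 n) 𝓘(ℝ, ℝ) ∞ χ)
    (hsupp : tsupport χ ⊆ (extChartAt (𝓡 n) θ₀).source) (a b : CylIndex n) :
    ContMDiff (cylModel n) 𝓘(ℝ, ℝ) ∞ (fun p => sliceGram h χ θ₀ p a b) := by
  have : IsManifold (cylModel n) 1 (ℝ × Y) := IsManifold.of_le (n := ∞) ENat.LEInfty.out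
  have : IsManifold (𝓡 n) 1 Y := IsManifold.of_le (n := ∞) ENat.LEInfty.out
  have hT : ContMDiff (cylModel n).tangent (𝓡 n).tangent ∞
      (tangentMap (cylModel n) (𝓡 n) (Prod.snd : ℝ × Y → Y)) :=
    (contMDiff_snd (n := ∞)).contMDiff_tangentMap (m := ∞) (by simp)
  have hU : ∀ a, ContMDiff (cylModel n) (𝓡 n).tangent ∞ (fun p : ℝ × Y =>
      (Bundle.TotalSpace.mk' (EuclideanSpace ℝ (Fin n)) (E := fun θ : Y => TangentSpace (𝓡 n) θ) p.2
        (mfderiv (cylModel n) (𝓡 n) (Prod.snd : ℝ × Y → Y) p (collarField χ θ₀ a p)))) := fun a =>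
    hT.comp (contMDiff_collarField hχ hsupp a)
  have hh := h.contMDiff.comp (contMDiff_snd (I := 𝓘(ℝ, ℝ)) (J := 𝓡 n) (M := ℝ) (N := Y))
  have h1 := ContMDiff.clm_bundle_apply₂ (F₁ := EuclideanSpace ℝ (Fin n))
    (F₂ := EuclideanSpace ℝ (Fin n)) (F₃ := ℝ) (E₃ := Bundle.Trivial Y ℝ) hh (hU a) (hU b)
  intro p
  exact (Bundle.contMDiffAt_totalSpace.1 (h1 p)).2

/-- The projection to Y annihilates the radial field, and the angular fields carry weight 1, so ρ
does not enter. -/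
theorem sliceGram_eq {χ : Y → ℝ} {θ₀ : Y} (hsupp : tsupport χ ⊆ (extChartAt (𝓡 n) θ₀).source)
    (s s' : ℝ) (θ : Y) (a b : CylIndex n) :
    sliceGram h χ θ₀ (s, θ) a b = sliceGram h χ θ₀ (s', θ) a b := by
  have h1 : ∀ (s : ℝ) (a : CylIndex n), (mfderiv (cylModel n) (𝓡 n) (Prod.snd : ℝ × Y → Y) (s, θ)
      (collarField χ θ₀ a (s, θ)) : EuclideanSpace ℝ (Fin n)) =
      χ θ • Sum.elim (fun _ => 0) (fun i => chartField θ₀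
        (Module.finBasis ℝ (EuclideanSpace ℝ (Fin n)) i) θ) a := by
    intro s a
    by_cases hθ : θ ∈ (extChartAt (𝓡 n) θ₀).source
    · have h2 := mfderiv_snd_coordField (p := (s, θ)) hθ (cylBasis n a)
      rw [collarField, map_smul]
      refine (congrArg (fun x : EuclideanSpace ℝ (Fin n) => (χ θ * frameWeight n a s) • x) h2).trans ?_
      rcases a with a | a
      · have h3 : chartField θ₀ (cylBasis n (Sum.inl a)).2 θ = 0 := by
          rw [cylBasis_inl]
          exact map_zero (mfderiv 𝓘(ℝ, EuclideanSpace ℝ (Fin n)) (𝓡 n) (extChartAt (𝓡 n) θ₀).symm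
            (extChartAt (𝓡 n) θ₀ θ))
        refine (congrArg (fun x : EuclideanSpace ℝ (Fin n) => _ • x) h3).trans ?_
        exact Eq.trans (smul_zero (A := EuclideanSpace ℝ (Fin n)) _)
          (smul_zero (A := EuclideanSpace ℝ (Fin n)) _).symm
      · simp [frameWeight]
        rfl
    · have h0 : χ θ = 0 := image_eq_zero_of_notMem_tsupport fun h => hθ (hsupp h)
      rw [h0, zero_smul, collarField]
      simp only [h0, zero_mul, zero_smul]
      exact map_zero (mfderiv (cylModel n) (𝓡 n) (Prod.snd : ℝ × Y → Y) (s, θ))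
  change (h.inner θ : EuclideanSpace ℝ (Fin n) →L[ℝ] EuclideanSpace ℝ (Fin n) →L[ℝ] ℝ)
    (mfderiv (cylModel n) (𝓡 n) (Prod.snd : ℝ × Y → Y) (s, θ)
      (collarField χ θ₀ a (s, θ)) : EuclideanSpace ℝ (Fin n))
    (mfderiv (cylModel n) (𝓡 n) (Prod.snd : ℝ × Y → Y) (s, θ)
      (collarField χ θ₀ b (s, θ)) : EuclideanSpace ℝ (Fin n)) =
    (h.inner θ : EuclideanSpace ℝ (Fin n) →L[ℝ] EuclideanSpace ℝ (Fin n) →L[ℝ] ℝ)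
    (mfderiv (cylModel n) (𝓡 n) (Prod.snd : ℝ × Y → Y) (s', θ)
      (collarField χ θ₀ a (s', θ)) : EuclideanSpace ℝ (Fin n))
    (mfderiv (cylModel n) (𝓡 n) (Prod.snd : ℝ × Y → Y) (s', θ)
      (collarField χ θ₀ b (s', θ)) : EuclideanSpace ℝ (Fin n))
  rw [h1, h1, h1, h1]

/-- Because dr = -ρ⁻²dρ and dρ(V_a) = ρβ_a, the rescaled field satisfies dr(ρV_a) = -β_a; the signs
cancel in the product. -/
theorem drSq_collarField {χ : Y → ℝ} {θ₀ : Y} (hsupp : tsupport χ ⊆ (extChartAt (𝓡 n) θ₀).source)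
    {p : ℝ × Y} (hp : p.1 ≠ 0) (a b : CylIndex n) :
    drSq n Y p (p.1 • collarField χ θ₀ a p) (p.1 • collarField χ θ₀ b p) =
      frameBeta χ a p * frameBeta χ b p := by
  have h1 : ∀ a, (collarField χ θ₀ a p : ℝ × EuclideanSpace ℝ (Fin n)).1 =
      p.1 * frameBeta χ a p := fun a => by
    rw [← vfDeriv_fst_collarField hsupp]; exact (mfderiv_fst_apply p _).symm
  refine (drSq_apply p (p.1 • collarField χ θ₀ a p) (p.1 • collarField χ θ₀ b p)).trans ?_
  have h2 : ∀ a, (p.1 • collarField χ θ₀ a p : ℝ × EuclideanSpace ℝ (Fin n)).1 =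
      p.1 * (p.1 * frameBeta χ a p) := fun a => congrArg (fun x => p.1 * x) (h1 a)
  rw [h2, h2]
  field_simp

/-- The components of `f(ρ) dr² + r² h` in the rescaled frame. -/
def warpedGram (f : ℝ → ℝ) (χ : Y → ℝ) (θ₀ : Y) (p : ℝ × Y) : Matrix (CylIndex n) (CylIndex n) ℝ :=
  Matrix.of fun a b => f p.1 * (frameBeta χ a p * frameBeta χ b p) + sliceGram h χ θ₀ p a b

/-- The factor ρ in each argument compensates r² = ρ⁻², leaving an expression that is smooth up to ρ
= 0. -/
theorem scGram_warpedMetric (f : ℝ → ℝ) {χ : Y → ℝ} {θ₀ : Y}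
    (hsupp : tsupport χ ⊆ (extChartAt (𝓡 n) θ₀).source) {p : ℝ × Y} (hp : p.1 ≠ 0) :
    scGram (warpedMetric f h.inner) χ θ₀ p = warpedGram h f χ θ₀ p := by
  ext a b
  simp only [scGram, warpedGram, Matrix.of_apply]
  rw [warpedMetric_apply, drSq_collarField hsupp hp]
  simp only [map_smul, _root_.smul_apply, smul_eq_mul, sliceGram]
  field_simp

theorem contMDiffOn_warpedGram {f : ℝ → ℝ} (hf : ContDiffOn ℝ ∞ f (Ico (0 : ℝ) 1)) {χ : Y → ℝ} {θ₀ : Y}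
    (hχ : ContMDiff (𝓡 n) 𝓘(ℝ, ℝ) ∞ χ)
    (hsupp : tsupport χ ⊆ (extChartAt (𝓡 n) θ₀).source) (N : Set Y) (a b : CylIndex n) :
    ContMDiffOn (cylModel n) 𝓘(ℝ, ℝ) ∞ (fun p => warpedGram h f χ θ₀ p a b) (Ico (0 : ℝ) 1 ×ˢ N) := by
  have h1 : ContMDiffOn (cylModel n) 𝓘(ℝ, ℝ) ∞ (fun p : ℝ × Y => f p.1) (Ico (0 : ℝ) 1 ×ˢ N) :=
    hf.contMDiffOn.comp contMDiffOn_fst fun p hp => hp.1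
  exact (h1.mul ((contMDiff_frameBeta hχ a).mul (contMDiff_frameBeta hχ b)).contMDiffOn).add
    (contMDiff_sliceGram h hχ hsupp a b).contMDiffOn

/-- The point of this bound is that it holds at ρ = 0, where there is no metric. The matrix depends
on ρ only through the value f(ρ), so it equals the Gram matrix at (1, θ) of the warped metric with
that constant factor, which is positive definite. -/
theorem warpedGram_det_pos {f : ℝ → ℝ} {χ : Y → ℝ} {θ₀ : Y}
    (hsupp : tsupport χ ⊆ (extChartAt (𝓡 n) θ₀).source) {p : ℝ × Y}
    (hp : p.2 ∈ (extChartAt (𝓡 n) θ₀).source) (hχ : χ p.2 = 1) (hf : 0 < f p.1) :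
    0 < (warpedGram h f χ θ₀ p).det := by
  have h1 : warpedGram h f χ θ₀ p = warpedGram h (fun _ => f p.1) χ θ₀ ((1 : ℝ), p.2) := by
    ext a b
    simp only [warpedGram, Matrix.of_apply]
    rw [show p = (p.1, p.2) from rfl, sliceGram_eq h hsupp p.1 1]
    rcases a with a | a <;> rcases b with b | b <;> rfl
  rw [h1, ← scGram_warpedMetric h _ hsupp (p := ((1 : ℝ), p.2)) one_ne_zero]
  exact scGram_det_pos (p := ((1 : ℝ), p.2)) hp one_pos hχ (warpedMetric_symm _ h.symm _)
    (warpedMetric_pos h.pos (p := ((1 : ℝ), p.2)) one_pos hf)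

end WarpedMetric

/-! ### Local membership in Diff_b and comparison of metrics -/

section LocalOperators

open Filter Topology

variable {n : ℕ} {Y : Type*} [TopologicalSpace Y] [ChartedSpace (EuclideanSpace ℝ (Fin n)) Y]

theorem uniqueMDiffOn_Ico_prod {N : Set Y} (hN : IsOpen N) :
    UniqueMDiffOn (cylModel n) (Ico (0 : ℝ) 1 ×ˢ N) :=
  (uniqueMDiffOn_iff_uniqueDiffOn.2 (uniqueDiffOn_Ico 0 1)).prod hN.uniqueMDiffOn

theorem mfderivWithin_fst_Ico_prod {N : Set Y} (hN : IsOpen N) {p : ℝ × Y}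
    (hp : p ∈ Ico (0 : ℝ) 1 ×ˢ N) :
    mfderivWithin (cylModel n) 𝓘(ℝ, ℝ) (Prod.fst : ℝ × Y → ℝ) (Ico (0 : ℝ) 1 ×ˢ N) p =
      mfderiv (cylModel n) 𝓘(ℝ, ℝ) (Prod.fst : ℝ × Y → ℝ) p :=
  mfderivWithin_eq_mfderiv (uniqueMDiffOn_Ico_prod hN p hp)
    ((contMDiff_fst (n := 1)).mdifferentiableAt one_ne_zero)

variable [IsManifold (𝓡 n) ∞ Y]

theorem isBField_collarField {χ : Y → ℝ} {θ₀ : Y} (hχ : ContMDiff (𝓡 n) 𝓘(ℝ, ℝ) ∞ χ)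
    (hsupp : tsupport χ ⊆ (extChartAt (𝓡 n) θ₀).source) (a : CylIndex n) :
    IsBField (cylModel n) (cyl Y) Prod.fst (collarField χ θ₀ a) where
  contMDiffOn := (contMDiff_collarField hχ hsupp a).contMDiffOn
  tangent p hp h0 := by
    have h1 := vfDeriv_fst_collarField hsupp a p
    rw [h0, zero_mul] at h1
    rw [mfderivWithin_fst_Ico_prod isOpen_univ hp]
    exact h1

theorem exists_bump [T2Space Y] (θ₀ : Y) : ∃ (χ : Y → ℝ) (N : Set Y), IsOpen N ∧ θ₀ ∈ N ∧
    N ⊆ (extChartAt (𝓡 n) θ₀).source ∧ ContMDiff (𝓡 n) 𝓘(ℝ, ℝ) ∞ χ ∧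
    tsupport χ ⊆ (extChartAt (𝓡 n) θ₀).source ∧ ∀ θ ∈ N, χ θ = 1 := by
  have f : SmoothBumpFunction (𝓡 n) θ₀ := Classical.arbitrary _
  obtain ⟨N, hN1, hN, hN0⟩ := eventually_nhds_iff.1 (f.eventuallyEq_one.and
    (extChartAt_source_mem_nhds (I := 𝓡 n) θ₀))
  exact ⟨f, N, hN, hN0, fun θ hθ => (hN1 θ hθ).2, f.contMDiff, f.tsupport_subset_extChartAt_source,
    fun θ hθ => (hN1 θ hθ).1⟩

/-- Over `(0,1) × N`, the operator `P` is a b-differential operator of order `m`. -/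
def IsDiffBNear (n : ℕ) {Y : Type*} [TopologicalSpace Y] [ChartedSpace (EuclideanSpace ℝ (Fin n)) Y]
    [IsManifold (𝓡 n) ∞ Y] (N : Set Y) (m : ℕ) (P : (ℝ × Y → ℝ) → ℝ × Y → ℝ) : Prop :=
  ∃ (ι : Type) (_ : Fintype ι) (a : ι → ℝ × Y → ℝ) (L : ι → List (VField (cylModel n) (ℝ × Y))),
    (∀ i, ContMDiffOn (cylModel n) 𝓘(ℝ, ℝ) ∞ (a i) (Ico (0 : ℝ) 1 ×ˢ N)) ∧
    (∀ i, (L i).length ≤ m ∧ ∀ V ∈ L i, IsBField (cylModel n) (cyl Y) Prod.fst V) ∧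
    ∀ u : ℝ × Y → ℝ, IsSmoothInterior (cylModel n) (cyl Y) Prod.fst u → ∀ p ∈ Ioo (0 : ℝ) 1 ×ˢ N,
      P u p = ∑ i, a i p * (L i).foldr (fun V w => vfDeriv (cylModel n) V w) u p

theorem isDiffBNear_of_frame {χ : Y → ℝ} {θ₀ : Y} (hχ : ContMDiff (𝓡 n) 𝓘(ℝ, ℝ) ∞ χ)
    (hsupp : tsupport χ ⊆ (extChartAt (𝓡 n) θ₀).source) {N : Set Y}
    {C : CylIndex n → CylIndex n → ℝ × Y → ℝ} {c : CylIndex n → ℝ × Y → ℝ}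
    (hC : ∀ a b, ContMDiffOn (cylModel n) 𝓘(ℝ, ℝ) ∞ (C a b) (Ico (0 : ℝ) 1 ×ˢ N))
    (hc : ∀ a, ContMDiffOn (cylModel n) 𝓘(ℝ, ℝ) ∞ (c a) (Ico (0 : ℝ) 1 ×ˢ N))
    {P : (ℝ × Y → ℝ) → ℝ × Y → ℝ}
    (hP : ∀ u : ℝ × Y → ℝ, IsSmoothInterior (cylModel n) (cyl Y) Prod.fst u →
      ∀ p ∈ Ioo (0 : ℝ) 1 ×ˢ N, P u p = ∑ a, ∑ b, C a b p *
          vfDeriv (cylModel n) (collarField χ θ₀ a) (vfDeriv (cylModel n) (collarField χ θ₀ b) u) p +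
        ∑ b, c b p * vfDeriv (cylModel n) (collarField χ θ₀ b) u p) :
    IsDiffBNear n N 2 P := by
  refine ⟨(CylIndex n × CylIndex n) ⊕ CylIndex n, inferInstance,
    Sum.elim (fun i => C i.1 i.2) c,
    Sum.elim (fun i => [collarField χ θ₀ i.1, collarField χ θ₀ i.2]) (fun b => [collarField χ θ₀ b]),
    ?_, ?_, fun u hu p hp => ?_⟩
  · rintro (i | i)
    · exact hC _ _
    · exact hc _
  · rintro (i | i)
    · refine ⟨le_rfl, fun V hV => ?_⟩
      simp only [Sum.elim_inl, List.mem_cons, List.not_mem_nil, or_false] at hV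
      rcases hV with rfl | rfl <;> exact isBField_collarField hχ hsupp _
    · refine ⟨one_le_two, fun V hV => ?_⟩
      simp only [Sum.elim_inr, List.mem_cons, List.not_mem_nil, or_false] at hV
      rcases hV with rfl; exact isBField_collarField hχ hsupp _
  · refine (hP u hu p hp).trans ((Fintype.sum_sum_type _).trans ?_).symm
    simp only [Sum.elim_inl, Sum.elim_inr, Fintype.sum_prod_type]
    rfl

theorem IsSmoothInterior.cyl {u : ℝ × Y → ℝ} (hu : IsSmoothInterior (cylModel n) (cyl Y) Prod.fst u) :
    ContMDiffOn (cylModel n) 𝓘(ℝ, ℝ) ∞ u (cylInterior Y) :=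
  hu.mono fun _ hp => ⟨⟨⟨hp.1.1.le, hp.1.2⟩, hp.2⟩, hp.1.1⟩

section

variable (h : Bundle.ContMDiffRiemannianMetric (𝓡 n) ∞ (EuclideanSpace ℝ (Fin n))
      (fun θ : Y => TangentSpace (𝓡 n) θ))
  {f : ℝ → ℝ} (hf : ContDiffOn ℝ ∞ f (Ico (0 : ℝ) 1)) (hf0 : ∀ s ∈ Ico (0 : ℝ) 1, 0 < f s)
  {χ : Y → ℝ} {θ₀ : Y} {N : Set Y} (hN : IsOpen N) (hNs : N ⊆ (extChartAt (𝓡 n) θ₀).source)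
  (hsmooth : ContMDiff (𝓡 n) 𝓘(ℝ, ℝ) ∞ χ) (hsupp : tsupport χ ⊆ (extChartAt (𝓡 n) θ₀).source)
  (hχ : ∀ θ ∈ N, χ θ = 1)

include hf hf0 hN hNs hsmooth hsupp hχ

theorem laplaceBeltrami_warpedMetric_frame {v : ℝ × Y → ℝ}
    (hv : IsSmoothInterior (cylModel n) (cyl Y) Prod.fst v) {p : ℝ × Y} (hp : p ∈ Ioo (0 : ℝ) 1 ×ˢ N) :
    laplaceBeltrami (cylModel n) (warpedMetric f h.inner) v p =
      -(p.1 ^ 2 * (∑ a, ∑ b, (warpedGram h f χ θ₀ p)⁻¹ a b *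
          vfDeriv (cylModel n) (collarField χ θ₀ a) (vfDeriv (cylModel n) (collarField χ θ₀ b) v) p +
        ∑ b, frameCoeff (cylModel n) (Ico (0 : ℝ) 1 ×ˢ N) (collarField χ θ₀) (frameBeta χ)
          (warpedGram h f χ θ₀) b p * vfDeriv (cylModel n) (collarField χ θ₀ b) v p)) :=
  laplaceBeltrami_frame hN hNs hsmooth hsupp hχ (fun _ _ => warpedMetric_symm f h.symm _)
    (fun _ hp => warpedMetric_pos h.pos hp.1.1 (hf0 _ ⟨hp.1.1.le, hp.1.2⟩))
    (contMDiffOn_warpedGram h hf hsmooth hsupp N)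
    (fun _ hp => scGram_warpedMetric h f hsupp hp.1.1.ne') hv.cyl hp

theorem congrMod_frame {K K' : ℝ × Y → Matrix (CylIndex n) (CylIndex n) ℝ} {j : ℕ}
    (hKK : ∀ a b, CongrMod (cylModel n) (Ico (0 : ℝ) 1 ×ˢ N) Prod.fst j (fun p => K p a b)
      (fun p => K' p a b))
    (hK : ∀ p ∈ Ico (0 : ℝ) 1 ×ˢ N, (K p).det ≠ 0) (hK' : ∀ p ∈ Ico (0 : ℝ) 1 ×ˢ N, (K' p).det ≠ 0)
    (b : CylIndex n) :
    CongrMod (cylModel n) (Ico (0 : ℝ) 1 ×ˢ N) Prod.fst j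
      (frameCoeff (cylModel n) (Ico (0 : ℝ) 1 ×ˢ N) (collarField χ θ₀) (frameBeta χ) K b)
      (frameCoeff (cylModel n) (Ico (0 : ℝ) 1 ×ˢ N) (collarField χ θ₀) (frameBeta χ) K' b) := by
  refine CongrMod.frameCoeff (uniqueMDiffOn_Ico_prod hN)
    (fun a => (contMDiff_collarField hsmooth hsupp a).contMDiffOn) contMDiffOn_fst
    (fun a => (contMDiff_frameBeta hsmooth a).contMDiffOn) (fun a p hp => ?_) hKK hK hK' b
  rw [← vfDeriv_fst_collarField hsupp, vfDerivWithin, vfDeriv, mfderivWithin_fst_Ico_prod hN hp]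

theorem warpedGram_det_ne_zero : ∀ p ∈ Ico (0 : ℝ) 1 ×ˢ N, (warpedGram h f χ θ₀ p).det ≠ 0 :=
  fun p hp => (warpedGram_det_pos h hsupp (hNs hp.2) (hχ _ hp.2) (hf0 _ hp.1)).ne'

/-- In the frame formula all coefficients are smooth up to the boundary, since the Gram matrix is
smooth and invertible there. The congruence of this matrix with itself serves only to record
smoothness. -/
theorem isDiffBNear_laplaceBeltrami_warpedMetric :
    IsDiffBNear n N 2 (fun v p => (p.1 ^ 2)⁻¹ *
      laplaceBeltrami (cylModel n) (warpedMetric f h.inner) v p) := by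
  have h1 : ∀ a b, CongrMod (cylModel n) (Ico (0 : ℝ) 1 ×ˢ N) Prod.fst 0
      (fun p => warpedGram h f χ θ₀ p a b) (fun p => warpedGram h f χ θ₀ p a b) := fun a b =>
    CongrMod.refl (contMDiffOn_warpedGram h hf hsmooth hsupp N a b)
  have h2 := warpedGram_det_ne_zero h hf hf0 hN hNs hsmooth hsupp hχ
  refine isDiffBNear_of_frame hsmooth hsupp
    (C := fun a b p => -(warpedGram h f χ θ₀ p)⁻¹ a b)
    (c := fun b p => -frameCoeff (cylModel n) (Ico (0 : ℝ) 1 ×ˢ N) (collarField χ θ₀) (frameBeta χ)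
          (warpedGram h f χ θ₀) b p)
    (fun a b => (CongrMod.matrix_inv h1 h2 h2 a b).left.neg)
    (fun b => (congrMod_frame hf hf0 hN hNs hsmooth hsupp hχ h1 h2 h2 b).left.neg)
    fun u hu p hp => ?_
  have h3 : p.1 ≠ 0 := hp.1.1.ne'
  have h4 := laplaceBeltrami_warpedMetric_frame h hf hf0 hN hNs hsmooth hsupp hχ hu hp
  simp only [neg_mul, Finset.sum_neg_distrib]
  refine (congrArg (fun x => (p.1 ^ 2)⁻¹ * x) h4).trans ?_
  field_simp
  ring

/-- The two rescaled Gram matrices differ by ρ^j C^∞, hence so do all coefficients in the frame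
formula; the common prefactor ρ² supplies the remaining weight. -/
theorem isDiffBNear_laplaceBeltrami_sub {g κ : BilinField (cylModel n) (ℝ × Y)}
    (hs : ∀ p ∈ cylInterior Y, ∀ v w : TangentSpace (cylModel n) p, g p v w = g p w v)
    (hpos : ∀ p ∈ cylInterior Y, ∀ v : TangentSpace (cylModel n) p, v ≠ 0 → 0 < g p v v)
    {c : ℝ → ℝ} {l : ℕ∞} (hc : MemRhoSmooth 𝓘(ℝ, ℝ) (Ico (0 : ℝ) 1) id l c)
    (hκ : MemScSymTwo (cylModel n) (cyl Y) Prod.fst l κ)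
    (hg : ∀ p ∈ cylInterior Y, g p = warpedMetric f h.inner p + c p.1 • drSq n Y p + κ p)
    {j : ℕ} (hj : 1 ≤ j) (hjl : (j : ℕ∞) ≤ l) :
    IsDiffBNear n N 2 (fun v p => (p.1 ^ (2 + j))⁻¹ *
      (laplaceBeltrami (cylModel n) g v p -
        laplaceBeltrami (cylModel n) (warpedMetric f h.inner) v p)) := by
  obtain ⟨ca, hca, hc⟩ := hc j hjl
  choose κa hκa hκ using fun a b => hκ.smooth _ _ (isBField_collarField hsmooth hsupp a)
    (isBField_collarField hsmooth hsupp b) j hjl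
  have hS : Ico (0 : ℝ) 1 ×ˢ N ⊆ cyl Y := prod_mono le_rfl (subset_univ _)
  -- This is ρ^{-j} times the error c dr² + κ evaluated on the sc-frame, extended smoothly to ρ = 0.
  set m : CylIndex n → CylIndex n → ℝ × Y → ℝ := fun a b p =>
    ca p.1 * (frameBeta χ a p * frameBeta χ b p) + κa a b p with hm_def
  have hm : ∀ a b, ContMDiffOn (cylModel n) 𝓘(ℝ, ℝ) ∞ (m a b) (Ico (0 : ℝ) 1 ×ˢ N) := fun a b =>
    (((hca.comp contMDiffOn_fst fun p hp => hp.1).mul ((contMDiff_frameBeta hsmooth a).mul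
      (contMDiff_frameBeta hsmooth b)).contMDiffOn).add ((hκa a b).mono hS))
  set K : ℝ × Y → Matrix (CylIndex n) (CylIndex n) ℝ := fun p =>
    Matrix.of fun a b => warpedGram h f χ θ₀ p a b + p.1 ^ j * m a b p with hK_def
  have hw := contMDiffOn_warpedGram h hf hsmooth hsupp N
  have hfst : ContMDiffOn (cylModel n) 𝓘(ℝ, ℝ) ∞ (Prod.fst : ℝ × Y → ℝ) (Ico (0 : ℝ) 1 ×ˢ N) :=
    contMDiffOn_fst
  have hKs : ∀ a b, ContMDiffOn (cylModel n) 𝓘(ℝ, ℝ) ∞ (fun p => K p a b) (Ico (0 : ℝ) 1 ×ˢ N) :=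
    fun a b => (hw a b).add ((hfst.pow j).mul (hm a b))
  have h1 : ∀ a b, CongrMod (cylModel n) (Ico (0 : ℝ) 1 ×ˢ N) Prod.fst j
      (fun p => K p a b) (fun p => warpedGram h f χ θ₀ p a b) := fun a b =>
    ⟨hKs a b, hw a b, m a b, hm a b, fun p _ => rfl⟩
  have hgK : ∀ p ∈ Ioo (0 : ℝ) 1 ×ˢ N, scGram g χ θ₀ p = K p := by
    intro p hp
    have hp0 : 0 < p.1 := hp.1.1
    have hpc : p ∈ cylInterior Y := ⟨hp.1, mem_univ _⟩
    have hpc' : p ∈ cyl Y := ⟨Ioo_subset_Ico_self hp.1, mem_univ _⟩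
    ext a b
    have e1 : warpedMetric f h.inner p (p.1 • collarField χ θ₀ a p) (p.1 • collarField χ θ₀ b p) =
      warpedGram h f χ θ₀ p a b := by rw [← scGram_warpedMetric h f hsupp hp0.ne']; rfl
    have e2 := drSq_collarField hsupp hp0.ne' a b
    have e3 := hκ a b p hpc' hp0
    have e4 := hc p.1 (Ioo_subset_Ico_self hp.1) hp0
    have e5 : scGram g χ θ₀ p a b =
        warpedMetric f h.inner p (p.1 • collarField χ θ₀ a p) (p.1 • collarField χ θ₀ b p) +
        c p.1 * drSq n Y p (p.1 • collarField χ θ₀ a p) (p.1 • collarField χ θ₀ b p) +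
        κ p (p.1 • collarField χ θ₀ a p) (p.1 • collarField χ θ₀ b p) := by
      simp only [scGram, Matrix.of_apply]
      rw [hg p hpc]
      rfl
    rw [e5, e1, e2]
    refine (congrArg₂ (fun x y => warpedGram h f χ θ₀ p a b +
      x * (frameBeta χ a p * frameBeta χ b p) + y) e4 e3).trans ?_
    simp only [hK_def, hm_def, Matrix.of_apply, id]
    ring
  have hdet' := warpedGram_det_ne_zero h hf hf0 hN hNs hsmooth hsupp hχ
  -- At the boundary the perturbation vanishes because j ≥ 1, which leaves the warped matrix. In the
  -- interior K is the Gram matrix of g, which is positive definite.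
  have hdet : ∀ p ∈ Ico (0 : ℝ) 1 ×ˢ N, (K p).det ≠ 0 := by
    intro p hp
    rcases hp.1.1.eq_or_lt with h0 | h0
    · have : K p = warpedGram h f χ θ₀ p := by
        ext a b
        simp only [hK_def, Matrix.of_apply, ← h0, zero_pow (Nat.one_le_iff_ne_zero.1 hj), zero_mul,
          add_zero]
      rw [this]
      exact hdet' p hp
    · have hp' : p ∈ Ioo (0 : ℝ) 1 ×ˢ N := ⟨⟨h0, hp.1.2⟩, hp.2⟩
      rw [← hgK p hp']
      exact (scGram_det_pos (hNs hp.2) h0 (hχ _ hp.2) (hs p ⟨hp'.1, mem_univ _⟩)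
        (hpos p ⟨hp'.1, mem_univ _⟩)).ne'
  have hC := CongrMod.matrix_inv h1 hdet hdet'
  have hD := congrMod_frame hf hf0 hN hNs hsmooth hsupp hχ h1 hdet hdet'
  choose C hCs hC using fun a b => (hC a b).exists_eq
  choose D hDs hD using fun b => (hD b).exists_eq
  refine isDiffBNear_of_frame hsmooth hsupp (C := fun a b p => -C a b p) (c := fun b p => -D b p)
    (fun a b => (hCs a b).neg) (fun b => (hDs b).neg) fun u hu p hp => ?_
  have hp0 : p.1 ≠ 0 := hp.1.1.ne'
  have hpS : p ∈ Ico (0 : ℝ) 1 ×ˢ N := ⟨Ioo_subset_Ico_self hp.1, hp.2⟩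
  have h4 := laplaceBeltrami_warpedMetric_frame h hf hf0 hN hNs hsmooth hsupp hχ hu hp
  have h5 := laplaceBeltrami_frame hN hNs hsmooth hsupp hχ hs hpos hKs hgK hu.cyl hp
  refine (congrArg₂ (fun x y => (p.1 ^ (2 + j))⁻¹ * (x - y)) h5 h4).trans ?_
  simp only [hC _ _ p hpS, hD _ p hpS, neg_mul, Finset.sum_neg_distrib, add_mul,
    Finset.sum_add_distrib, mul_assoc, ← Finset.mul_sum]
  field_simp
  ring

end

end LocalOperators

/-! ### From local operators to the whole cylinder -/

section Globalization

open Filter Topology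

section

variable {E : Type*} [NormedAddCommGroup E] [NormedSpace ℝ E]
  {H : Type*} [TopologicalSpace H] {I : ModelWithCorners ℝ E H}
  {M : Type*} [TopologicalSpace M] [ChartedSpace H M] [IsManifold I ∞ M]
  {S : Set M} {ρ : M → ℝ} {m : ℕ} {P : (M → ℝ) → M → ℝ}

theorem isDiffB_of_fintype {ι : Type*} [Fintype ι] {a : ι → M → ℝ} {L : ι → List (VField I M)}
    (ha : ∀ i, ContMDiffOn I 𝓘(ℝ, ℝ) ∞ (a i) S)
    (hL : ∀ i, (L i).length ≤ m ∧ ∀ V ∈ L i, IsBField I S ρ V)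
    (hP : ∀ u : M → ℝ, IsSmoothInterior I S ρ u → ∀ x ∈ S, 0 < ρ x →
      P u x = ∑ i, a i x * (L i).foldr (fun V w => vfDeriv I V w) u x) : IsDiffB I S ρ m P := by
  let e := Fintype.equivFin ι
  refine ⟨Fintype.card ι, fun i => a (e.symm i), fun i => L (e.symm i), fun i => ha _, fun i => hL _,
    fun u hu x hx hx0 => ?_⟩
  rw [hP u hu x hx hx0]
  exact (Equiv.sum_comp e.symm
    (fun i => a i x * (L i).foldr (fun V w => vfDeriv I V w) u x)).symm

theorem IsDiffB.mul_left (h : IsDiffB I S ρ m P) {f : M → ℝ} (hf : ContMDiffOn I 𝓘(ℝ, ℝ) ∞ f S)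
    {Q : (M → ℝ) → M → ℝ} (hQ : ∀ u : M → ℝ, IsSmoothInterior I S ρ u → ∀ x ∈ S, 0 < ρ x →
      Q u x = f x * P u x) : IsDiffB I S ρ m Q := by
  obtain ⟨N, a, L, ha, hL, hP⟩ := h
  refine ⟨N, fun i x => f x * a i x, L, fun i => hf.mul (ha i), hL, fun u hu x hx hx0 => ?_⟩
  rw [hQ u hu x hx hx0, hP u hu x hx hx0, Finset.mul_sum]
  simp only [mul_assoc]

/-- Superfluous powers of ρ are smooth and go into the coefficients, so each weight j may be
established with any larger exponent. -/
theorem isWeightedDiffB_of_forall (hρ : ContMDiffOn I 𝓘(ℝ, ℝ) ∞ ρ S) {k : ℕ∞}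
    (h : ∀ j : ℕ, (j : ℕ∞) ≤ k → ∃ l : ℕ, j ≤ l ∧ IsDiffB I S ρ m (fun u x => (ρ x ^ l)⁻¹ * P u x)) :
    IsWeightedDiffB I S ρ k m P := by
  intro j hj
  obtain ⟨l, hjl, hl⟩ := h j hj
  refine ⟨fun u x => (ρ x ^ j)⁻¹ * P u x, hl.mul_left (hρ.pow (l - j)) fun u _ x _ hx0 => ?_,
    fun u _ x _ hx0 => ?_⟩
  · have : ρ x ^ l = ρ x ^ j * ρ x ^ (l - j) := by rw [← pow_add, Nat.add_sub_cancel' hjl]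
    rw [this]
    field_simp
  · field_simp

end

variable {n : ℕ} {Y : Type*} [TopologicalSpace Y] [ChartedSpace (EuclideanSpace ℝ (Fin n)) Y]
  [IsManifold (𝓡 n) ∞ Y]

/-- The partition of unity is taken on Y alone: its functions are constant in ρ, hence smooth up to
the boundary, and only multiply coefficients. The vector fields are already global. -/
theorem isDiffB_of_isDiffBNear [T2Space Y] [CompactSpace Y] {m : ℕ}
    {P : (ℝ × Y → ℝ) → ℝ × Y → ℝ}
    (h : ∀ θ₀ : Y, ∃ N : Set Y, IsOpen N ∧ θ₀ ∈ N ∧ IsDiffBNear n N m P) :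
    IsDiffB (cylModel n) (cyl Y) Prod.fst m P := by
  choose N hN hN0 hP using h
  obtain ⟨t, ht⟩ := CompactSpace.elim_nhds_subcover N fun θ => (hN θ).mem_nhds (hN0 θ)
  obtain ⟨f, hf⟩ := SmoothPartitionOfUnity.exists_isSubordinate (𝓡 n) isClosed_univ
    (fun i : t => N i) (fun i => hN i) (by
      rw [← Set.top_eq_univ, ← ht]
      exact iUnion₂_subset fun i hi => subset_iUnion (fun i : t => N i) ⟨i, hi⟩)
  choose ι hι a L ha hL hP using hP
  refine isDiffB_of_fintype (ι := Σ i : t, ι i) (a := fun i p => f i.1 p.2 * a i.1 i.2 p)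
    (L := fun i => L i.1 i.2) (fun i p hp => ?_) (fun i => hL _ _) fun u hu p hp hp0 => ?_
  · have h1 : ContMDiff (cylModel n) 𝓘(ℝ, ℝ) ∞ fun p : ℝ × Y => f i.1 p.2 :=
      (f i.1).contMDiff.comp contMDiff_snd
    by_cases hpN : p.2 ∈ N i.1
    · refine h1.contMDiffAt.contMDiffWithinAt.mul ?_
      refine (ha i.1 i.2 p ⟨hp.1, hpN⟩).mono_of_mem_nhdsWithin ?_
      filter_upwards [self_mem_nhdsWithin, mem_nhdsWithin_of_mem_nhds
        (((hN i.1).preimage continuous_snd).mem_nhds hpN)] with q hq hq'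
      exact ⟨hq.1, hq'⟩
    · have h2 : p.2 ∉ tsupport (f i.1) := fun h => hpN (hf i.1 h)
      have h3 : ∀ᶠ q : ℝ × Y in 𝓝 p, f i.1 q.2 = 0 :=
        (continuous_snd.tendsto p).eventually (notMem_tsupport_iff_eventuallyEq.1 h2)
      have h4 : ContMDiffAt (cylModel n) 𝓘(ℝ, ℝ) ∞ (fun q : ℝ × Y => f i.1 q.2 * a i.1 i.2 q) p :=
        (contMDiffAt_const (c := (0 : ℝ))).congr_of_eventuallyEq (by
          filter_upwards [h3] with q hq
          rw [hq, zero_mul])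
      exact h4.contMDiffWithinAt
  · have h1 : ∑ i : t, f i p.2 = 1 := by
      rw [← finsum_eq_sum_of_fintype]
      exact f.sum_eq_one (mem_univ _)
    rw [← one_mul (P u p), ← h1, Finset.sum_mul, Fintype.sum_sigma]
    refine Finset.sum_congr rfl fun i _ => ?_
    simp only [mul_assoc]
    rw [← Finset.mul_sum]
    by_cases hpN : p.2 ∈ N i
    · rw [hP i u hu p ⟨⟨hp0, hp.1.2⟩, hpN⟩]
    · have : f i p.2 = 0 := image_eq_zero_of_notMem_tsupport fun h => hpN (hf i h)
      rw [this, zero_mul, zero_mul]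

section

variable [T2Space Y] [CompactSpace Y] (h : Bundle.ContMDiffRiemannianMetric (𝓡 n) ∞ (EuclideanSpace ℝ (Fin n))
      (fun θ : Y => TangentSpace (𝓡 n) θ))
  {f : ℝ → ℝ} (hf : ContDiffOn ℝ ∞ f (Ico (0 : ℝ) 1)) (hf0 : ∀ s ∈ Ico (0 : ℝ) 1, 0 < f s)

include hf hf0

theorem isWeightedDiffB_laplaceBeltrami_warpedMetric :
    IsWeightedDiffB (cylModel n) (cyl Y) Prod.fst 2 2
      (laplaceBeltrami (cylModel n) (warpedMetric f h.inner)) := by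
  refine isWeightedDiffB_of_forall contMDiffOn_fst fun j hj => ⟨2, by exact_mod_cast hj,
    isDiffB_of_isDiffBNear fun θ₀ => ?_⟩
  obtain ⟨χ, N, hN, hN0, hNs, hχ, hsupp, hχ1⟩ := exists_bump (n := n) θ₀
  exact ⟨N, hN, hN0, isDiffBNear_laplaceBeltrami_warpedMetric h hf hf0 hN hNs hχ hsupp hχ1⟩

theorem isWeightedDiffB_laplaceBeltrami_sub {g κ : BilinField (cylModel n) (ℝ × Y)}
    (hs : ∀ p ∈ cylInterior Y, ∀ v w : TangentSpace (cylModel n) p, g p v w = g p w v)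
    (hpos : ∀ p ∈ cylInterior Y, ∀ v : TangentSpace (cylModel n) p, v ≠ 0 → 0 < g p v v)
    {c : ℝ → ℝ} {l : ℕ∞} (hl : 1 ≤ l) (hc : MemRhoSmooth 𝓘(ℝ, ℝ) (Ico (0 : ℝ) 1) id l c)
    (hκ : MemScSymTwo (cylModel n) (cyl Y) Prod.fst l κ)
    (hg : ∀ p ∈ cylInterior Y, g p = warpedMetric f h.inner p + c p.1 • drSq n Y p + κ p) :
    IsWeightedDiffB (cylModel n) (cyl Y) Prod.fst (2 + l) 2 (fun v p =>
      laplaceBeltrami (cylModel n) g v p -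
        laplaceBeltrami (cylModel n) (warpedMetric f h.inner) v p) := by
  -- The local comparison needs an exponent at least 1, and j - 2 is truncated; the maximum covers
  -- small j and is admissible because 1 ≤ l.
  refine isWeightedDiffB_of_forall contMDiffOn_fst fun j hj => ⟨2 + max (j - 2) 1, by omega,
    isDiffB_of_isDiffBNear fun θ₀ => ?_⟩
  obtain ⟨χ, N, hN, hN0, hNs, hχ, hsupp, hχ1⟩ := exists_bump (n := n) θ₀
  refine ⟨N, hN, hN0, isDiffBNear_laplaceBeltrami_sub h hf hf0 hN hNs hχ hsupp hχ1 hs hpos hc hκ hg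
    (le_max_right _ _) ?_⟩
  cases l with
  | top => exact le_top
  | coe l =>
    norm_cast at hl hj ⊢
    omega

end

namespace IsBoundaryCollar

variable {X : Type*} [TopologicalSpace X] [ChartedSpace (EuclideanHalfSpace (n + 1)) X]
  {φ : ℝ × Y → X} {ρ : X → ℝ}

theorem injOn (hφ : IsBoundaryCollar n φ ρ) : InjOn φ (cyl Y) := by
  obtain ⟨ψ, -, hψ⟩ := hφ.exists_inverse
  exact fun p hp q hq h => by rw [← hψ p hp, ← hψ q hq, h]

theorem zero_mem_cyl (θ : Y) : ((0 : ℝ), θ) ∈ cyl Y := ⟨⟨le_rfl, one_pos⟩, mem_univ _⟩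

/-- Y injects continuously into the Hausdorff space X as the boundary. -/
theorem t2Space [T2Space X] (hφ : IsBoundaryCollar n φ ρ) : T2Space Y := by
  have h1 : Continuous fun θ : Y => φ (0, θ) :=
    hφ.contMDiffOn.continuousOn.comp_continuous (by fun_prop) zero_mem_cyl
  exact T2Space.of_injective_continuous
    (fun θ θ' h => congrArg Prod.snd (hφ.injOn (zero_mem_cyl θ) (zero_mem_cyl θ') h)) h1

/-- The boundary is the zero set of ρ, closed in the compact space X; the inverse of the collar
followed by the projection maps it onto Y. -/
theorem compactSpace [CompactSpace X] (hφ : IsBoundaryCollar n φ ρ) : CompactSpace Y := by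
  obtain ⟨ψ, hψs, hψ⟩ := hφ.exists_inverse
  have h1 : IsCompact {x | ρ x = 0} :=
    (isClosed_eq hφ.rho_contMDiff.continuous continuous_const).isCompact
  have h2 : {x | ρ x = 0} = φ '' ({(0 : ℝ)} ×ˢ univ) := by
    rw [hφ.image_boundary]
    ext x
    exact hφ.rho_eq_zero_iff x
  have h3 : ({(0 : ℝ)} ×ˢ univ : Set (ℝ × Y)) ⊆ cyl Y := by
    rintro ⟨s, θ⟩ ⟨hs, -⟩
    rw [mem_singleton_iff] at hs
    subst hs
    exact zero_mem_cyl θ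
  have h4 : ContinuousOn (fun x => (ψ x).2) {x | ρ x = 0} :=
    continuous_snd.comp_continuousOn (hψs.continuousOn.mono (h2 ▸ image_mono h3))
  have h5 := h1.image_of_continuousOn h4
  refine ⟨h5.of_isClosed_subset isClosed_univ fun θ _ => ?_⟩
  refine ⟨φ (0, θ), ?_, ?_⟩
  · rw [h2]
    exact mem_image_of_mem _ ⟨rfl, mem_univ _⟩
  · change (ψ (φ (0, θ))).2 = θ
    rw [hψ _ (zero_mem_cyl θ)]

end IsBoundaryCollar

end Globalization

/-! ### Extending operators from the collar to X -/

section CollarExtension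

open Filter Topology

/-- A smooth cutoff function, equal to `1` on `(-∞, a]` and to `0` on `[b, ∞)`. -/
def realCutoff (a b s : ℝ) : ℝ := Real.smoothTransition ((b - s) / (b - a))

theorem contDiff_realCutoff (a b : ℝ) : ContDiff ℝ ∞ (realCutoff a b) :=
  Real.smoothTransition.contDiff.comp ((contDiff_const.sub contDiff_id).div_const _)

theorem realCutoff_eq_one {a b s : ℝ} (hab : a < b) (hs : s ≤ a) : realCutoff a b s = 1 :=
  Real.smoothTransition.one_of_one_le ((one_le_div (sub_pos.2 hab)).2 (by linarith))

theorem realCutoff_eq_zero {a b s : ℝ} (hab : a < b) (hs : b ≤ s) : realCutoff a b s = 0 :=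
  Real.smoothTransition.zero_of_nonpos (div_nonpos_of_nonpos_of_nonneg (by linarith) (by linarith))

theorem realCutoff_nonneg (a b s : ℝ) : 0 ≤ realCutoff a b s := Real.smoothTransition.nonneg _

theorem realCutoff_le_one (a b s : ℝ) : realCutoff a b s ≤ 1 := Real.smoothTransition.le_one _

section

variable {E : Type*} [NormedAddCommGroup E] [NormedSpace ℝ E]
  {H : Type*} [TopologicalSpace H] {I : ModelWithCorners ℝ E H}
  {M : Type*} [TopologicalSpace M] [ChartedSpace H M] [IsManifold I ∞ M]

theorem contMDiffOn_vfDeriv {O : Set M} (hO : IsOpen O) {V : VField I M}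
    (hV : ContMDiffOn I I.tangent ∞ (fun x => (⟨x, V x⟩ : TangentBundle I M)) O) {u : M → ℝ}
    (hu : ContMDiffOn I 𝓘(ℝ, ℝ) ∞ u O) : ContMDiffOn I 𝓘(ℝ, ℝ) ∞ (vfDeriv I V u) O :=
  (contMDiffOn_vfDerivWithin hO.uniqueMDiffOn hV hu).congr fun _ hx =>
    (vfDerivWithin_of_mem_nhds (hO.mem_nhds hx)).symm

theorem contMDiffOn_foldr_vfDeriv {O : Set M} (hO : IsOpen O) {L : List (VField I M)}
    (hL : ∀ V ∈ L, ContMDiffOn I I.tangent ∞ (fun x => (⟨x, V x⟩ : TangentBundle I M)) O) {u : M → ℝ}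
    (hu : ContMDiffOn I 𝓘(ℝ, ℝ) ∞ u O) :
    ContMDiffOn I 𝓘(ℝ, ℝ) ∞ (L.foldr (fun V w => vfDeriv I V w) u) O := by
  induction L with
  | nil => exact hu
  | cons V L ih =>
    exact contMDiffOn_vfDeriv hO (hL V List.mem_cons_self) (ih fun W hW => hL W (List.mem_cons_of_mem _ hW))

end

variable {n : ℕ} {Y : Type*} [TopologicalSpace Y] [ChartedSpace (EuclideanSpace ℝ (Fin n)) Y]
  {X : Type*} [TopologicalSpace X] [ChartedSpace (EuclideanHalfSpace (n + 1)) X]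
  {φ : ℝ × Y → X} {ρ : X → ℝ} [IsManifold (𝓡 n) ∞ Y]

namespace IsBoundaryCollar

/-- An inverse of the collar embedding. -/
def inverse (hφ : IsBoundaryCollar n φ ρ) : X → ℝ × Y := hφ.exists_inverse.choose

variable (hφ : IsBoundaryCollar n φ ρ)

theorem contMDiffOn_inverse : ContMDiffOn (𝓡∂ (n + 1)) (cylModel n) ∞ hφ.inverse (φ '' cyl Y) :=
  hφ.exists_inverse.choose_spec.1

theorem inverse_apply {p : ℝ × Y} (hp : p ∈ cyl Y) : hφ.inverse (φ p) = p :=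
  hφ.exists_inverse.choose_spec.2 p hp

theorem inverse_mem {x : X} (hx : x ∈ φ '' cyl Y) : hφ.inverse x ∈ cyl Y := by
  obtain ⟨p, hp, rfl⟩ := hx
  rwa [hφ.inverse_apply hp]

theorem apply_inverse {x : X} (hx : x ∈ φ '' cyl Y) : φ (hφ.inverse x) = x := by
  obtain ⟨p, hp, rfl⟩ := hx
  rw [hφ.inverse_apply hp]

include hφ in
theorem isClosed_image [T2Space X] [CompactSpace X] {c : ℝ} (hc : c < 1) :
    IsClosed (φ '' (Icc (0 : ℝ) c ×ˢ univ)) := by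
  have := hφ.compactSpace
  exact ((isCompact_Icc.prod isCompact_univ).image_of_continuousOn (hφ.contMDiffOn.continuousOn.mono
    (prod_mono (Icc_subset_Ico_right hc) le_rfl))).isClosed

include hφ in
-- The image of [0,c] × Y is compact, hence closed in X. Near a point outside the collar only its
-- part {ρ ≥ c} can appear, where cut off objects vanish; so extension by zero is smooth there.
theorem eventually_of_notMem [T2Space X] [CompactSpace X] {c : ℝ} (hc : c < 1) {x : X}
    (hx : x ∉ φ '' cyl Y) : ∀ᶠ y in 𝓝 x, ∀ p ∈ cyl Y, φ p = y → c ≤ p.1 := by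
  have h1 : x ∉ φ '' (Icc (0 : ℝ) c ×ˢ univ) := fun h =>
    hx (image_mono (prod_mono (Icc_subset_Ico_right hc) le_rfl) h)
  filter_upwards [(hφ.isClosed_image hc).isOpen_compl.mem_nhds h1] with y hy p hp hpy
  by_contra! h2
  exact hy ⟨p, ⟨⟨hp.1.1, h2.le⟩, mem_univ _⟩, hpy⟩

open Classical in
/-- Extension by zero of a function on the collar to `X`. -/
def extendFun (a : ℝ × Y → ℝ) (x : X) : ℝ := if x ∈ φ '' cyl Y then a (hφ.inverse x) else 0

theorem extendFun_apply (a : ℝ × Y → ℝ) {p : ℝ × Y} (hp : p ∈ cyl Y) :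
    hφ.extendFun a (φ p) = a p := by
  rw [extendFun, if_pos (mem_image_of_mem _ hp), hφ.inverse_apply hp]

theorem extendFun_of_notMem (a : ℝ × Y → ℝ) {x : X} (hx : x ∉ φ '' cyl Y) : hφ.extendFun a x = 0 :=
  if_neg hx

theorem contMDiff_extendFun [T2Space X] [CompactSpace X] {a : ℝ × Y → ℝ}
    (ha : ContMDiffOn (cylModel n) 𝓘(ℝ, ℝ) ∞ a (cyl Y)) {c : ℝ} (hc : c < 1)
    (h0 : ∀ p : ℝ × Y, c ≤ p.1 → a p = 0) : ContMDiff (𝓡∂ (n + 1)) 𝓘(ℝ, ℝ) ∞ (hφ.extendFun a) := by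
  intro x
  by_cases hx : x ∈ φ '' cyl Y
  · have h1 : ContMDiffOn (𝓡∂ (n + 1)) 𝓘(ℝ, ℝ) ∞ (fun y => a (hφ.inverse y)) (φ '' cyl Y) :=
      ha.comp hφ.contMDiffOn_inverse fun y hy => hφ.inverse_mem hy
    exact (h1.congr fun y hy => if_pos hy).contMDiffAt (hφ.isOpen_image.mem_nhds hx)
  · refine (contMDiffAt_const (c := (0 : ℝ))).congr_of_eventuallyEq ?_
    filter_upwards [hφ.eventually_of_notMem hc hx] with y hy
    by_cases hy' : y ∈ φ '' cyl Y
    · obtain ⟨p, hp, rfl⟩ := hy'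
      rw [hφ.extendFun_apply a hp, h0 p (hy p hp rfl)]
    · exact hφ.extendFun_of_notMem a hy'

open Classical in
/-- Pushforward to `X`, extended by zero, of a vector field on the collar. -/
def pushField (V : VField (cylModel n) (ℝ × Y)) : VField (𝓡∂ (n + 1)) X := fun x =>
  if x ∈ φ '' cyl Y then
    (mfderivWithin (cylModel n) (𝓡∂ (n + 1)) φ (cyl Y) (hφ.inverse x) (V (hφ.inverse x)) :
      EuclideanSpace ℝ (Fin (n + 1)))
  else (0 : EuclideanSpace ℝ (Fin (n + 1)))

theorem pushField_apply (V : VField (cylModel n) (ℝ × Y)) {p : ℝ × Y} (hp : p ∈ cyl Y) :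
    hφ.pushField V (φ p) = mfderivWithin (cylModel n) (𝓡∂ (n + 1)) φ (cyl Y) p (V p) :=
  (if_pos (mem_image_of_mem _ hp)).trans (congrArg (fun q =>
    (mfderivWithin (cylModel n) (𝓡∂ (n + 1)) φ (cyl Y) q (V q) : EuclideanSpace ℝ (Fin (n + 1))))
    (hφ.inverse_apply hp))

theorem pushField_of_notMem (V : VField (cylModel n) (ℝ × Y)) {x : X} (hx : x ∉ φ '' cyl Y) :
    hφ.pushField V x = 0 :=
  if_neg hx

variable [IsManifold (𝓡∂ (n + 1)) ∞ X]

theorem contMDiff_pushField [T2Space X] [CompactSpace X] {V : VField (cylModel n) (ℝ × Y)}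
    (hV : ContMDiffOn (cylModel n) (cylModel n).tangent ∞
      (fun p => (⟨p, V p⟩ : TangentBundle (cylModel n) (ℝ × Y))) (cyl Y)) {c : ℝ} (hc : c < 1)
    (h0 : ∀ p : ℝ × Y, c ≤ p.1 → V p = 0) :
    ContMDiff (𝓡∂ (n + 1)) (𝓡∂ (n + 1)).tangent ∞
      (fun x => (⟨x, hφ.pushField V x⟩ : TangentBundle (𝓡∂ (n + 1)) X)) := by
  have : IsManifold (cylModel n) 1 (ℝ × Y) := IsManifold.of_le (n := ∞) ENat.LEInfty.out
  have : IsManifold (𝓡∂ (n + 1)) 1 X := IsManifold.of_le (n := ∞) ENat.LEInfty.out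
  have hT : ContMDiffOn (cylModel n).tangent (𝓡∂ (n + 1)).tangent ∞
      (tangentMapWithin (cylModel n) (𝓡∂ (n + 1)) φ (cyl Y)) (Bundle.TotalSpace.proj ⁻¹' cyl Y) :=
    hφ.contMDiffOn.contMDiffOn_tangentMapWithin (by simp) (uniqueMDiffOn_Ico_prod isOpen_univ)
  intro x
  by_cases hx : x ∈ φ '' cyl Y
  · have h1 := (hT.comp hV fun p hp => hp).comp hφ.contMDiffOn_inverse fun y hy => hφ.inverse_mem hy
    refine (h1.congr fun y hy => ?_).contMDiffAt (hφ.isOpen_image.mem_nhds hx)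
    obtain ⟨p, hp, rfl⟩ := hy
    rw [hφ.pushField_apply V hp]
    exact (congrArg (fun q => tangentMapWithin (cylModel n) (𝓡∂ (n + 1)) φ (cyl Y) ⟨q, V q⟩)
      (hφ.inverse_apply hp)).symm
  · have h1 : ContMDiff (𝓡∂ (n + 1)) (𝓡∂ (n + 1)).tangent ∞
        (fun x => (⟨x, 0⟩ : TangentBundle (𝓡∂ (n + 1)) X)) :=
      Bundle.contMDiff_zeroSection ℝ (TangentSpace (𝓡∂ (n + 1)) : X → Type _)
    refine (h1 x).congr_of_eventuallyEq ?_
    filter_upwards [hφ.eventually_of_notMem hc hx] with y hy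
    by_cases hy' : y ∈ φ '' cyl Y
    · obtain ⟨p, hp, rfl⟩ := hy'
      rw [hφ.pushField_apply V hp, h0 p (hy p hp rfl), map_zero]
    · rw [hφ.pushField_of_notMem V hy']

/-- Tangency transfers because ρ ∘ φ is the first coordinate, so dρ of the pushed field is the
radial component of V. -/
theorem isBField_pushField [T2Space X] [CompactSpace X] {V : VField (cylModel n) (ℝ × Y)}
    (hV : IsBField (cylModel n) (cyl Y) Prod.fst V) {c : ℝ} (hc : c < 1)
    (h0 : ∀ p : ℝ × Y, c ≤ p.1 → V p = 0) :
    IsBField (𝓡∂ (n + 1)) univ ρ (hφ.pushField V) where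
  contMDiffOn := (hφ.contMDiff_pushField hV.contMDiffOn hc h0).contMDiffOn
  tangent x _ hx0 := by
    have hx : x ∈ φ '' ({(0 : ℝ)} ×ˢ univ) := by
      rw [hφ.image_boundary]
      exact (hφ.rho_eq_zero_iff x).1 hx0
    obtain ⟨p, ⟨hp0, -⟩, rfl⟩ := hx
    rw [mem_singleton_iff] at hp0
    have hp : p ∈ cyl Y := ⟨⟨hp0.ge, hp0 ▸ one_pos⟩, mem_univ _⟩
    have hS : UniqueMDiffWithinAt (cylModel n) (cyl Y) p := uniqueMDiffOn_Ico_prod isOpen_univ p hp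
    rw [mfderivWithin_univ, hφ.pushField_apply V hp]
    have h1 := mfderiv_comp_mfderivWithin p (hφ.rho_contMDiff.mdifferentiableAt (by simp))
      ((hφ.contMDiffOn p hp).mdifferentiableWithinAt (by simp)) hS
    have h2 := mfderivWithin_congr (I := cylModel n) (I' := 𝓘(ℝ, ℝ)) (f₁ := ρ ∘ φ)
      (f := (Prod.fst : ℝ × Y → ℝ)) (s := cyl Y)
      (fun q hq => hφ.rho_collar q hq) (hφ.rho_collar p hp)
    have h3 := hV.tangent p hp hp0
    have h4 := congrArg (fun A : (ℝ × EuclideanSpace ℝ (Fin n)) →L[ℝ] ℝ => A (V p)) (h1.symm.trans h2)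
    exact h4.trans h3

/-- Each pushed field is φ-related to the original where the cutoff is 1. The induction needs
equality on an open set, as the next derivative uses a whole neighbourhood. -/
theorem foldr_pushField {c c' : ℝ} (hcc : c < c') (hc' : c' < 1) {L : List (VField (cylModel n) (ℝ × Y))}
    {W : VField (cylModel n) (ℝ × Y) → VField (cylModel n) (ℝ × Y)}
    (hL : ∀ V ∈ L, ∀ p : ℝ × Y, p.1 < c → W V p = V p)
    (hLs : ∀ V ∈ L, ContMDiff (𝓡∂ (n + 1)) (𝓡∂ (n + 1)).tangent ∞
      (fun x => (⟨x, hφ.pushField (W V) x⟩ : TangentBundle (𝓡∂ (n + 1)) X)))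
    {u : X → ℝ} (hu : IsSmoothInterior (𝓡∂ (n + 1)) univ ρ u) :
    ∀ p : ℝ × Y, 0 < p.1 → p.1 < c →
      (L.map fun V => hφ.pushField (W V)).foldr (fun V w => vfDeriv (𝓡∂ (n + 1)) V w) u (φ p) =
        L.foldr (fun V w => vfDeriv (cylModel n) V w) (u ∘ φ) p := by
  have hO : IsOpen {x ∈ (univ : Set X) | 0 < ρ x} := by
    simpa using isOpen_lt continuous_const hφ.rho_contMDiff.continuous
  induction L with
  | nil => exact fun p _ _ => rfl
  | cons V L ih =>
    intro p hp0 hpc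
    have hp : p ∈ cyl Y := ⟨⟨hp0.le, hpc.trans (hcc.trans hc')⟩, mem_univ _⟩
    have hnhds : cyl Y ∈ 𝓝 p := prod_mem_nhds (Ico_mem_nhds hp0 hp.1.2) univ_mem
    have ih' := ih (fun W hW => hL W (List.mem_cons_of_mem _ hW))
      (fun W hW => hLs W (List.mem_cons_of_mem _ hW))
    simp only [List.map_cons, List.foldr_cons]
    set w := (L.map fun V => hφ.pushField (W V)).foldr (fun V w => vfDeriv (𝓡∂ (n + 1)) V w) u
      with hw_def
    set w' := L.foldr (fun V w => vfDeriv (cylModel n) V w) (u ∘ φ)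
    have hw : ContMDiffOn (𝓡∂ (n + 1)) 𝓘(ℝ, ℝ) ∞ w {x ∈ (univ : Set X) | 0 < ρ x} := by
      refine contMDiffOn_foldr_vfDeriv hO (fun V' hV' => ?_) hu
      obtain ⟨V'', hV'', rfl⟩ := List.mem_map.1 hV'
      exact (hLs V'' (List.mem_cons_of_mem _ hV'')).contMDiffOn
    have hφp : φ p ∈ {x ∈ (univ : Set X) | 0 < ρ x} := ⟨mem_univ _, by rwa [hφ.rho_collar p hp]⟩
    have h1 := mfderiv_comp p (((hw.contMDiffAt (hO.mem_nhds hφp))).mdifferentiableAt (by simp))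
      ((hφ.contMDiffOn.contMDiffAt hnhds).mdifferentiableAt (by simp))
    have h2 : w ∘ φ =ᶠ[𝓝 p] w' := by
      filter_upwards [(isOpen_Ioo.prod isOpen_univ : IsOpen (Ioo 0 c ×ˢ (univ : Set Y))).mem_nhds
        (⟨⟨hp0, hpc⟩, mem_univ _⟩ : p ∈ Ioo 0 c ×ˢ (univ : Set Y))] with q hq
      exact ih' q hq.1.1 hq.1.2
    have h3 := h2.mfderiv_eq (I := cylModel n) (I' := 𝓘(ℝ, ℝ))
    have h4 : hφ.pushField (W V) (φ p) = mfderiv (cylModel n) (𝓡∂ (n + 1)) φ p (V p) := by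
      rw [hφ.pushField_apply _ hp, mfderivWithin_of_mem_nhds hnhds, hL V List.mem_cons_self p hpc]
    have h5 := congrArg (fun A : (ℝ × EuclideanSpace ℝ (Fin n)) →L[ℝ] ℝ => A (V p)) (h1.symm.trans h3)
    unfold vfDeriv
    rw [h4]
    exact h5

include hφ in
theorem isSmoothInterior_comp {u : X → ℝ} (hu : IsSmoothInterior (𝓡∂ (n + 1)) univ ρ u) :
    IsSmoothInterior (cylModel n) (cyl Y) Prod.fst (u ∘ φ) :=
  ContMDiffOn.comp hu (hφ.contMDiffOn.mono fun _ hp => hp.1) fun p hp =>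
    ⟨mem_univ _, by rw [hφ.rho_collar p hp.1]; exact hp.2⟩

include hφ in
-- Coefficients and vector fields are cut off separately. The operator on X is fixed before the
-- weight j is chosen, so one extension serves all weights, including k = ∞.
theorem isCollarWeightedDiffB [T2Space X] [CompactSpace X] {k : ℕ∞} {m : ℕ}
    {P : (ℝ × Y → ℝ) → ℝ × Y → ℝ} (hP : IsWeightedDiffB (cylModel n) (cyl Y) Prod.fst k m P) :
    IsCollarWeightedDiffB n φ ρ k m P := by
  refine ⟨hP, fun c hc => ?_⟩
  -- With c < c₁ < c₂ < c₃ < 1, coefficients are cut off on [c, c₁] and fields on [c₂, c₃]. Thus the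
  -- fields are unchanged wherever a coefficient is nonzero.
  obtain ⟨c₁, hc₁, hc₁'⟩ := exists_between hc
  obtain ⟨c₂, hc₂, hc₂'⟩ := exists_between hc₁'
  obtain ⟨c₃, hc₃, hc₃'⟩ := exists_between hc₂'
  refine ⟨fun u => hφ.extendFun fun p => realCutoff c c₁ p.1 * P (u ∘ φ) p, ?_, fun u hu s hs θ => ?_⟩
  swap
  · have hp : (s, θ) ∈ cyl Y := ⟨⟨hs.1.le, hs.2.trans hc⟩, mem_univ _⟩
    refine Eq.trans ?_ (hφ.extendFun_apply _ hp).symm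
    rw [realCutoff_eq_one hc₁ hs.2.le, one_mul]
  intro j hj
  obtain ⟨Q, ⟨N, a, L, ha, hL, hQ⟩, hPQ⟩ := hP j hj
  let W : VField (cylModel n) (ℝ × Y) → VField (cylModel n) (ℝ × Y) := fun V p =>
    realCutoff c₂ c₃ p.1 • V p
  have hcut : ∀ a b : ℝ, ContMDiff (cylModel n) 𝓘(ℝ, ℝ) ∞ fun p : ℝ × Y => realCutoff a b p.1 :=
    fun a b => (contDiff_realCutoff a b).contMDiff.comp contMDiff_fst
  have hW0 : ∀ V, ∀ p : ℝ × Y, c₃ ≤ p.1 → W V p = 0 := fun V p hp => by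
    simp only [W, realCutoff_eq_zero hc₃ hp, zero_smul]
  have hW : ∀ V, IsBField (cylModel n) (cyl Y) Prod.fst V →
      IsBField (cylModel n) (cyl Y) Prod.fst (W V) := fun V hV =>
    ⟨ContMDiffOn.smul_section (hcut _ _).contMDiffOn hV.contMDiffOn, fun p hp hp0 => by
      rw [map_smul, hV.tangent p hp hp0]; exact smul_zero (A := ℝ) _⟩
  have hWp : ∀ V, IsBField (cylModel n) (cyl Y) Prod.fst V →
      IsBField (𝓡∂ (n + 1)) univ ρ (hφ.pushField (W V)) := fun V hV =>
    hφ.isBField_pushField (hW V hV) hc₃' (hW0 V)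
  set A : Fin N → X → ℝ := fun i => hφ.extendFun fun p => realCutoff c c₁ p.1 * a i p with hA_def
  refine ⟨fun u x => ∑ i, A i x *
    ((L i).map fun V => hφ.pushField (W V)).foldr (fun V w => vfDeriv (𝓡∂ (n + 1)) V w) u x,
    ⟨N, A, fun i => (L i).map fun V => hφ.pushField (W V), fun i => ?_, fun i => ⟨?_, fun V hV => ?_⟩,
      fun u _ x _ _ => rfl⟩, fun u hu x _ hx0 => ?_⟩
  · exact (hφ.contMDiff_extendFun ((hcut _ _).contMDiffOn.mul (ha i)) hc₁' fun p hp =>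
      (congrArg (· * a i p) (realCutoff_eq_zero hc₁ hp)).trans (zero_mul _)).contMDiffOn
  · rw [List.length_map]
    exact (hL i).1
  · obtain ⟨V', hV', rfl⟩ := List.mem_map.1 hV
    exact hWp V' ((hL i).2 V' hV')
  · by_cases hx : x ∈ φ '' cyl Y
    · obtain ⟨p, hp, rfl⟩ := hx
      rw [hφ.rho_collar p hp] at hx0 ⊢
      have hup := hφ.isSmoothInterior_comp hu
      simp only [hA_def, hφ.extendFun_apply _ hp]
      rcases lt_or_ge p.1 c₁ with hpc | hpc
      · rw [hPQ _ hup p hp hx0, hQ _ hup p hp hx0, mul_left_comm, Finset.mul_sum]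
        refine congrArg (fun x => p.1 ^ j * x) (Finset.sum_congr rfl fun i _ => ?_)
        rw [hφ.foldr_pushField hc₃ hc₃' (L := L i) (W := W) (fun V _ q hq => ?_)
          (fun V hV => contMDiffOn_univ.1 (hWp V ((hL i).2 V hV)).contMDiffOn) hu p hx0 (hpc.trans hc₂),
          mul_assoc]
        simp only [W, realCutoff_eq_one hc₃ hq.le, one_smul]
      · simp only [realCutoff_eq_zero hc₁ hpc, zero_mul, Finset.sum_const_zero, mul_zero]
    · simp only [hA_def, hφ.extendFun_of_notMem _ hx, zero_mul, Finset.sum_const_zero, mul_zero]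

end IsBoundaryCollar

end CollarExtension

/-! ### Separation of variables for a(r)dr² + r²H -/

section WarpedFlat

open Filter Topology Matrix

variable {F : Type*} [NormedAddCommGroup F] [NormedSpace ℝ F]
  {ι : Type*} [Fintype ι] [DecidableEq ι]

theorem fderiv_apply_inl {f : ℝ × F → ℝ} {z : ℝ × F} (hf : DifferentiableAt ℝ f z) :
    fderiv ℝ f z (1, 0) = deriv (fun r => f (r, z.2)) z.1 := by
  have h1 : HasDerivAt (fun r : ℝ => (r, z.2)) ((1 : ℝ), (0 : F)) z.1 :=
    (hasDerivAt_id z.1).prodMk (hasDerivAt_const _ _)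
  exact (hf.hasFDerivAt.comp_hasDerivAt z.1 h1).deriv.symm

theorem fderiv_apply_inr {f : ℝ × F → ℝ} {z : ℝ × F} (hf : DifferentiableAt ℝ f z) (w : F) :
    fderiv ℝ f z (0, w) = fderiv ℝ (fun y => f (z.1, y)) z.2 w := by
  have h1 : HasFDerivAt (fun y : F => (z.1, y)) (ContinuousLinearMap.inr ℝ ℝ F) z.2 :=
    hasFDerivAt_prodMk_right _ _
  have h2 := (hf.hasFDerivAt.comp z.2 h1).fderiv
  exact (congrArg (fun A : F →L[ℝ] ℝ => A w) h2).symm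

/-- The Gram matrix of `a(r) dr² + r² H`. -/
def warpedBlock (a : ℝ → ℝ) (H : F → Matrix ι ι ℝ) (z : ℝ × F) : Matrix (Unit ⊕ ι) (Unit ⊕ ι) ℝ :=
  Matrix.fromBlocks (Matrix.of fun _ _ => a z.1) 0 0 (z.1 ^ 2 • H z.2)

theorem det_warpedBlock (a : ℝ → ℝ) (H : F → Matrix ι ι ℝ) (z : ℝ × F) :
    (warpedBlock a H z).det = a z.1 * ((z.1 ^ 2) ^ Fintype.card ι * (H z.2).det) := by
  rw [warpedBlock, Matrix.det_fromBlocks_zero₂₁, Matrix.det_smul, Matrix.det_unique]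
  rfl

theorem inv_warpedBlock {a : ℝ → ℝ} {H : F → Matrix ι ι ℝ} {z : ℝ × F} (ha : a z.1 ≠ 0)
    (hz : z.1 ≠ 0) (hH : (H z.2).det ≠ 0) :
    (warpedBlock a H z)⁻¹ =
      Matrix.fromBlocks (Matrix.of fun _ _ => (a z.1)⁻¹) 0 0 ((z.1 ^ 2)⁻¹ • (H z.2)⁻¹) := by
  apply Matrix.inv_eq_right_inv
  rw [warpedBlock, Matrix.fromBlocks_multiply]
  have h1 : (Matrix.of fun _ _ => a z.1 : Matrix Unit Unit ℝ) * (Matrix.of fun _ _ => (a z.1)⁻¹) = 1 := by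
    ext i j
    simp [Matrix.mul_apply, ha]
  have h2 : z.1 ^ 2 • H z.2 * (z.1 ^ 2)⁻¹ • (H z.2)⁻¹ = 1 := by
    rw [Matrix.smul_mul, Matrix.mul_smul, smul_smul, mul_inv_cancel₀ (pow_ne_zero 2 hz), one_smul,
      Matrix.mul_nonsing_inv _ hH.isUnit]
  rw [h1, h2]
  simp

/-- The matrix is block diagonal and its volume density is the product of √a r^N and √(det H). In
the tangential divergence the radial density cancels, leaving r⁻² times the Laplacian of H; in the
radial one the tangential density cancels, leaving an ordinary derivative in r. -/
theorem flatLaplacian_warpedBlock (b : ι → F) {b' : Unit ⊕ ι → ℝ × F}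
    (hb : ∀ i, b' (Sum.inl i) = (1, 0)) (hb' : ∀ i, b' (Sum.inr i) = (0, b i))
    {a : ℝ → ℝ} {H : F → Matrix ι ι ℝ} {u : ℝ × F → ℝ} {r : ℝ} {y : F} (hr : 0 < r)
    (ha : DifferentiableAt ℝ a r) (ha0 : 0 < a r)
    (hH : ∀ i j, DifferentiableAt ℝ (fun x => H x i j) y) (hH0 : 0 < (H y).det)
    (hu : ContDiffAt ℝ 2 u (r, y)) :
    flatLaplacian b' (warpedBlock a H) u (r, y) =
      -((a r)⁻¹ * (iteratedDeriv 2 (fun t => u (t, y)) r +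
        Fintype.card ι / r * deriv (fun t => u (t, y)) r)) +
      2⁻¹ * deriv a r * (a r ^ 2)⁻¹ * deriv (fun t => u (t, y)) r +
      (r ^ 2)⁻¹ * flatLaplacian b H (fun x => u (r, x)) y := by
  set N := Fintype.card ι with hN
  set q : F → ℝ := fun x => Real.sqrt (H x).det with hq
  set c : ℝ → ℝ := fun t => Real.sqrt (a t) * t ^ N with hc
  have hdetH : DifferentiableAt ℝ (fun x => (H x).det) y := differentiableAt_det hH
  have hqd : DifferentiableAt ℝ q y := hdetH.sqrt hH0.ne'
  have hq0 : q y ≠ 0 := (Real.sqrt_pos.2 hH0).ne'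
  have hHinv : ∀ i j, DifferentiableAt ℝ (fun x => (H x)⁻¹ i j) y := fun i j =>
    differentiableAt_matrix_inv hH hH0.ne' i j
  have e1 : ∀ᶠ z : ℝ × F in 𝓝 (r, y), 0 < z.1 := (continuous_fst.tendsto (r, y)).eventually (lt_mem_nhds hr)
  have e2 : ∀ᶠ z : ℝ × F in 𝓝 (r, y), 0 < a z.1 := (continuous_fst.tendsto (r, y)).eventually
    (ha.continuousAt.eventually (lt_mem_nhds ha0))
  have e3 : ∀ᶠ z : ℝ × F in 𝓝 (r, y), 0 < (H z.2).det := (continuous_snd.tendsto (r, y)).eventually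
    (hdetH.continuousAt.eventually (lt_mem_nhds hH0))
  have hsqrt : ∀ z : ℝ × F, 0 < z.1 → 0 < a z.1 →
      Real.sqrt (warpedBlock a H z).det = c z.1 * q z.2 := fun z h1 h2 => by
    rw [det_warpedBlock, Real.sqrt_mul h2.le, Real.sqrt_mul (by positivity), ← pow_mul, mul_comm 2 _,
      pow_mul, Real.sqrt_sq (by positivity), ← mul_assoc]
  have hsigma : 0 < Real.sqrt (a r) := Real.sqrt_pos.2 ha0
  have hcd : DifferentiableAt ℝ c r := (ha.sqrt ha0.ne').mul (differentiableAt_pow N)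
  have hc0 : c r ≠ 0 := by positivity
  have hu1 : ∀ᶠ z in 𝓝 (r, y), DifferentiableAt ℝ u z :=
    (hu.eventually (by simp)).mono fun z hz => hz.differentiableAt (by simp)
  have hud : ∀ w, DifferentiableAt ℝ (fun z => fderiv ℝ u z w) (r, y) := fun w =>
    ((hu.fderiv_right (m := 1) (by norm_num)).differentiableAt one_ne_zero).clm_apply
      (differentiableAt_const w)
  have hfst : ∀ {f : ℝ → ℝ}, DifferentiableAt ℝ f r →
      DifferentiableAt ℝ (fun z : ℝ × F => f z.1) (r, y) := fun hf =>
    DifferentiableAt.fun_comp' (r, y) hf differentiableAt_fst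
  have hsnd : ∀ {f : F → ℝ}, DifferentiableAt ℝ f y →
      DifferentiableAt ℝ (fun z : ℝ × F => f z.2) (r, y) := fun hf =>
    DifferentiableAt.fun_comp' (r, y) hf differentiableAt_snd
  -- the radial part
  have hinl : fderiv ℝ (fun z : ℝ × F => ∑ j, Real.sqrt (warpedBlock a H z).det *
      (warpedBlock a H z)⁻¹ (Sum.inl ()) j * fderiv ℝ u z (b' j)) (r, y) (b' (Sum.inl ())) =
      q y * deriv (fun t => c t * (a t)⁻¹ * deriv (fun t => u (t, y)) t) r := by
    have h1 : (fun z : ℝ × F => ∑ j, Real.sqrt (warpedBlock a H z).det *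
        (warpedBlock a H z)⁻¹ (Sum.inl ()) j * fderiv ℝ u z (b' j)) =ᶠ[𝓝 (r, y)]
        fun z => q z.2 * (c z.1 * (a z.1)⁻¹ * fderiv ℝ u z (1, 0)) := by
      filter_upwards [e1, e2, e3] with z h1 h2 h3
      rw [Fintype.sum_sum_type, inv_warpedBlock h2.ne' h1.ne' h3.ne', hsqrt z h1 h2]
      simp [hb]
      ring
    have h2 : DifferentiableAt ℝ (fun z : ℝ × F => c z.1 * (a z.1)⁻¹ * fderiv ℝ u z (1, 0)) (r, y) :=
      ((hfst hcd).mul (hfst (ha.inv ha0.ne'))).mul (hud _)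
    rw [h1.fderiv_eq, hb, fderiv_apply_inl ((hsnd hqd).fun_mul h2)]
    have h3 : DifferentiableAt ℝ (fun t : ℝ => c t * (a t)⁻¹ * fderiv ℝ u (t, y) (1, 0)) r :=
      DifferentiableAt.fun_comp' r h2 (f := fun t : ℝ => (t, y))
        (differentiableAt_id.prodMk (differentiableAt_const _))
    refine (deriv_const_mul (q y) h3).trans ?_
    refine congrArg (fun x => q y * x) (Filter.EventuallyEq.deriv_eq ?_)
    have h4 : Tendsto (fun t : ℝ => (t, y)) (𝓝 r) (𝓝 (r, y)) :=
      (Continuous.prodMk_left y).tendsto r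
    filter_upwards [h4.eventually hu1] with t ht
    rw [fderiv_apply_inl ht]
  -- the tangential part
  have hinr : ∀ i, fderiv ℝ (fun z : ℝ × F => ∑ j, Real.sqrt (warpedBlock a H z).det *
      (warpedBlock a H z)⁻¹ (Sum.inr i) j * fderiv ℝ u z (b' j)) (r, y) (b' (Sum.inr i)) =
      c r * (r ^ 2)⁻¹ * fderiv ℝ (fun x => ∑ j, Real.sqrt (H x).det * (H x)⁻¹ i j *
        fderiv ℝ (fun x => u (r, x)) x (b j)) y (b i) := by
    intro i
    have h1 : (fun z : ℝ × F => ∑ j, Real.sqrt (warpedBlock a H z).det *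
        (warpedBlock a H z)⁻¹ (Sum.inr i) j * fderiv ℝ u z (b' j)) =ᶠ[𝓝 (r, y)]
        fun z => c z.1 * (z.1 ^ 2)⁻¹ * ∑ j, q z.2 * (H z.2)⁻¹ i j * fderiv ℝ u z (0, b j) := by
      filter_upwards [e1, e2, e3] with z h1 h2 h3
      rw [Fintype.sum_sum_type, inv_warpedBlock h2.ne' h1.ne' h3.ne', hsqrt z h1 h2, Finset.mul_sum]
      simp only [Matrix.fromBlocks_apply₂₁, Matrix.zero_apply, mul_zero, zero_mul,
        Finset.sum_const_zero, zero_add, Matrix.fromBlocks_apply₂₂, Matrix.smul_apply, smul_eq_mul, hb']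
      exact Finset.sum_congr rfl fun j _ => by ring
    have h2 : DifferentiableAt ℝ (fun z : ℝ × F => ∑ j, q z.2 * (H z.2)⁻¹ i j *
        fderiv ℝ u z (0, b j)) (r, y) :=
      DifferentiableAt.fun_sum fun j _ => ((hsnd hqd).mul (hsnd (hHinv i j))).mul (hud _)
    have h3 : DifferentiableAt ℝ (fun t : ℝ => c t * (t ^ 2)⁻¹) r :=
      hcd.mul ((differentiableAt_pow 2).inv (by positivity))
    rw [h1.fderiv_eq, hb', fderiv_apply_inr ((hfst h3).fun_mul h2)]
    have h4 : DifferentiableAt ℝ (fun x : F => ∑ j, q x * (H x)⁻¹ i j *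
        fderiv ℝ u (r, x) (0, b j)) y :=
      DifferentiableAt.fun_comp' y h2 (f := fun x : F => (r, x))
        ((differentiableAt_const _).prodMk differentiableAt_id)
    refine (congrArg (fun A : F →L[ℝ] ℝ => A (b i))
      (fderiv_const_mul h4 (c r * (r ^ 2)⁻¹))).trans ?_
    refine congrArg (fun x => c r * (r ^ 2)⁻¹ * x) (congrArg (fun A : F →L[ℝ] ℝ => A (b i))
      (Filter.EventuallyEq.fderiv_eq ?_))
    have h5 : Tendsto (fun x : F => (r, x)) (𝓝 y) (𝓝 (r, y)) := (Continuous.prodMk_right r).tendsto y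
    filter_upwards [h5.eventually hu1] with x hx
    exact Finset.sum_congr rfl fun j _ => by rw [fderiv_apply_inr hx]
  have hline : ContDiffAt ℝ 2 (fun t => u (t, y)) r :=
    ContDiffAt.comp r hu (contDiffAt_id.prodMk contDiffAt_const)
  have hderiv : HasDerivAt (fun t => deriv (fun t => u (t, y)) t)
      (iteratedDeriv 2 (fun t => u (t, y)) r) r := by
    have h1 : DifferentiableAt ℝ (deriv fun t => u (t, y)) r := by
      exact ((hline.fderiv_right (m := 1) (by norm_num)).differentiableAt one_ne_zero).clm_apply
        (differentiableAt_const (1 : ℝ))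
    rw [iteratedDeriv_succ, iteratedDeriv_one]
    exact h1.hasDerivAt
  have hk : HasDerivAt (fun t => c t * (a t)⁻¹ * deriv (fun t => u (t, y)) t) _ r :=
    (((ha.hasDerivAt.sqrt ha0.ne').mul (hasDerivAt_pow N r)).mul (ha.hasDerivAt.inv ha0.ne')).mul hderiv
  rw [hk.deriv] at hinl
  -- Removes the truncated exponent N - 1, including the case N = 0 of a zero-dimensional cross
  -- section.
  have hNr : (N : ℝ) * r ^ (N - 1) = N / r * r ^ N := by
    rcases N with _ | N
    · simp
    · rw [Nat.add_sub_cancel, pow_succ]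
      field_simp
  unfold flatLaplacian
  rw [Fintype.sum_sum_type, hsqrt (r, y) hr ha0, Fintype.sum_unique,
    show (default : Unit) = () from rfl, hinl]
  simp only [hinr, ← Finset.mul_sum]
  have hsq : Real.sqrt (a r) ^ 2 = a r := Real.sq_sqrt ha0.le
  have hqy : Real.sqrt (H y).det = q y := rfl
  rw [hNr, hqy]
  simp only [hc, Pi.mul_apply, Pi.inv_apply]
  generalize (∑ i, fderiv ℝ (fun x => ∑ j, Real.sqrt (H x).det * (H x)⁻¹ i j *
    fderiv ℝ (fun x => u (r, x)) x (b j)) y (b i)) = T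
  generalize deriv (fun t => u (t, y)) r = u1
  generalize iteratedDeriv 2 (fun t => u (t, y)) r = u2
  generalize deriv a r = a1 at *
  generalize q y = q0 at *
  generalize Real.sqrt (a r) = σ at *
  -- Writing a(r) as the square of its root makes the remaining identity rational.
  rw [← hsq]
  field_simp
  ring

end WarpedFlat

/-! ### Warped Laplacians in the variable r = 1/ρ -/

section RadialFormula

open Filter Topology

variable {n : ℕ} {Y : Type*} [TopologicalSpace Y] [ChartedSpace (EuclideanSpace ℝ (Fin n)) Y]
  [IsManifold (𝓡 n) ∞ Y]

theorem warpedMetric_coordField (f : ℝ → ℝ) (h : BilinField (𝓡 n) Y) {θ₀ : Y} {p : ℝ × Y}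
    (hp : p.2 ∈ (extChartAt (𝓡 n) θ₀).source) (w w' : ℝ × EuclideanSpace ℝ (Fin n)) :
    warpedMetric f h p (coordField θ₀ w p) (coordField θ₀ w' p) =
      f p.1 * ((p.1 ^ 4)⁻¹ * (w.1 * w'.1)) +
        (p.1 ^ 2)⁻¹ * h p.2 (chartField θ₀ w.2 p.2) (chartField θ₀ w'.2 p.2) := by
  have h1 : ∀ w, (coordField θ₀ w p : ℝ × EuclideanSpace ℝ (Fin n)).1 = w.1 := fun w =>
    (mfderiv_fst_apply p _).symm.trans (mfderiv_fst_coordField hp w)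
  have h2 := mfderiv_snd_coordField hp w
  have h3 := mfderiv_snd_coordField hp w'
  have h4 : drSq n Y p (coordField θ₀ w p) (coordField θ₀ w' p) = (p.1 ^ 4)⁻¹ * (w.1 * w'.1) := by
    refine (drSq_apply p _ _).trans ?_
    rw [h1, h1]
  rw [warpedMetric_apply, h4]
  refine congrArg (fun x => f p.1 * ((p.1 ^ 4)⁻¹ * (w.1 * w'.1)) + (p.1 ^ 2)⁻¹ * x) ?_
  exact congrArg₂ (fun a b => (h p.2 : EuclideanSpace ℝ (Fin n) →L[ℝ]
    EuclideanSpace ℝ (Fin n) →L[ℝ] ℝ) a b) h2 h3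

theorem mfderivWithin_extChartAt_symm_apply {θ₀ : Y} {y : EuclideanSpace ℝ (Fin n)}
    (hy : y ∈ (extChartAt (𝓡 n) θ₀).target) (w : EuclideanSpace ℝ (Fin n)) :
    (mfderivWithin 𝓘(ℝ, EuclideanSpace ℝ (Fin n)) (𝓡 n) (extChartAt (𝓡 n) θ₀).symm
      (range (𝓡 n)) y w : EuclideanSpace ℝ (Fin n)) =
      chartField θ₀ w ((extChartAt (𝓡 n) θ₀).symm y) := by
  unfold chartField
  rw [(extChartAt (𝓡 n) θ₀).right_inv hy, ModelWithCorners.range_eq_univ, mfderivWithin_univ]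

theorem gramInChart_eq (h : BilinField (𝓡 n) Y) {θ₀ : Y} {y : EuclideanSpace ℝ (Fin n)}
    (hy : y ∈ (extChartAt (𝓡 n) θ₀).target) (i j) :
    gramInChart (𝓡 n) h θ₀ y i j = h ((extChartAt (𝓡 n) θ₀).symm y)
      (chartField θ₀ (Module.finBasis ℝ (EuclideanSpace ℝ (Fin n)) i) ((extChartAt (𝓡 n) θ₀).symm y))
      (chartField θ₀ (Module.finBasis ℝ (EuclideanSpace ℝ (Fin n)) j)
        ((extChartAt (𝓡 n) θ₀).symm y)) :=
  congrArg₂ (fun a b => (h ((extChartAt (𝓡 n) θ₀).symm y) : EuclideanSpace ℝ (Fin n) →L[ℝ]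
    EuclideanSpace ℝ (Fin n) →L[ℝ] ℝ) a b) (mfderivWithin_extChartAt_symm_apply hy _)
    (mfderivWithin_extChartAt_symm_apply hy _)

theorem chartField_ne_zero {θ₀ θ : Y} (hθ : θ ∈ (extChartAt (𝓡 n) θ₀).source)
    {w : EuclideanSpace ℝ (Fin n)} (hw : w ≠ 0) : chartField θ₀ w θ ≠ 0 := by
  intro h0
  have h1 : ((0 : ℝ), w) ≠ 0 := fun h => hw (congrArg Prod.snd h)
  have h2 : ((1 : ℝ), θ).2 ∈ (extChartAt (𝓡 n) θ₀).source := hθ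
  refine coordField_ne_zero h2 h1 (Prod.ext ?_ ?_)
  · exact (mfderiv_fst_apply ((1 : ℝ), θ) _).symm.trans (mfderiv_fst_coordField h2 _)
  · exact (mfderiv_snd_apply ((1 : ℝ), θ) _).symm.trans ((mfderiv_snd_coordField h2 _).trans h0)

/-- With ρ = 1/r one has (dρ/dr)² = r⁻⁴ = ρ⁴, which cancels the ρ⁻⁴ of dr², while ρ⁻² becomes r². -/
theorem pullbackForm_cylParam_inv (f : ℝ → ℝ) (h : BilinField (𝓡 n) Y) {θ₀ : Y}
    {z : ℝ × EuclideanSpace ℝ (Fin n)} (hz : z.2 ∈ (extChartAt (𝓡 n) θ₀).target) (hz1 : z.1 ≠ 0) :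
    gramMatrix (cylBasis n) (pullbackForm 𝓘(ℝ, ℝ × EuclideanSpace ℝ (Fin n)) (cylModel n)
      (cylParam (·⁻¹) θ₀) (warpedMetric f h) z) =
    warpedBlock (fun r => f r⁻¹) (gramInChart (𝓡 n) h θ₀) z := by
  have h1 := mfderiv_cylParam (θ₀ := θ₀) (contDiffAt_inv ℝ hz1) hz
  have h2 : (cylParam (·⁻¹) θ₀ z).2 ∈ (extChartAt (𝓡 n) θ₀).source := by
    rw [cylParam_apply]
    exact (extChartAt (𝓡 n) θ₀).map_target hz
  ext a b
  have h3 : gramMatrix (cylBasis n) (pullbackForm 𝓘(ℝ, ℝ × EuclideanSpace ℝ (Fin n)) (cylModel n)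
      (cylParam (·⁻¹) θ₀) (warpedMetric f h) z) a b = warpedMetric f h (cylParam (·⁻¹) θ₀ z)
      (coordField θ₀ (deriv (·⁻¹) z.1 * (cylBasis n a).1, (cylBasis n a).2) (cylParam (·⁻¹) θ₀ z))
      (coordField θ₀ (deriv (·⁻¹) z.1 * (cylBasis n b).1, (cylBasis n b).2) (cylParam (·⁻¹) θ₀ z)) :=
    congrArg₂ (fun a b => (warpedMetric f h (cylParam (·⁻¹) θ₀ z) :
      (ℝ × EuclideanSpace ℝ (Fin n)) →L[ℝ] (ℝ × EuclideanSpace ℝ (Fin n)) →L[ℝ] ℝ) a b)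
      (h1 (cylBasis n a)) (h1 (cylBasis n b))
  have hzero : ∀ θ : Y, chartField θ₀ (0 : EuclideanSpace ℝ (Fin n)) θ = 0 := fun θ =>
    map_zero (mfderiv 𝓘(ℝ, EuclideanSpace ℝ (Fin n)) (𝓡 n) (extChartAt (𝓡 n) θ₀).symm
      (extChartAt (𝓡 n) θ₀ θ))
  rw [h3, warpedMetric_coordField f h h2, cylParam_apply, warpedBlock]
  rcases a with a | a <;> rcases b with b | b
  · simp only [cylBasis_inl, hzero, map_zero, mul_zero, add_zero, mul_one, deriv_inv,
      Matrix.fromBlocks_apply₁₁, Matrix.of_apply]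
    field_simp
  · simp only [cylBasis_inl, cylBasis_inr, hzero, map_zero, _root_.zero_apply, mul_zero, add_zero,
      Matrix.fromBlocks_apply₁₂, Matrix.zero_apply]
  · simp only [cylBasis_inl, cylBasis_inr, hzero, map_zero, mul_zero, zero_mul, add_zero,
      Matrix.fromBlocks_apply₂₁, Matrix.zero_apply]
  · simp only [cylBasis_inr, mul_zero, zero_add, Matrix.fromBlocks_apply₂₂, Matrix.smul_apply,
      gramInChart_eq h hz, smul_eq_mul]
    field_simp

variable (h : Bundle.ContMDiffRiemannianMetric (𝓡 n) ∞ (EuclideanSpace ℝ (Fin n))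
      (fun θ : Y => TangentSpace (𝓡 n) θ))

/-- Near θ the cutoff is 1, and the entries coincide with the angular entries of the globally smooth
`sliceGram`. -/
theorem differentiableAt_gramInChart [T2Space Y] (θ : Y) (i j) :
    DifferentiableAt ℝ (fun y => gramInChart (𝓡 n) h.inner θ y i j) (extChartAt (𝓡 n) θ θ) := by
  obtain ⟨χ, N, hN, hN0, hNs, hχ, hsupp, hχ1⟩ := exists_bump (n := n) θ
  have ht : (extChartAt (𝓡 n) θ).target ∈ 𝓝 (extChartAt (𝓡 n) θ θ) := extChartAt_target_mem_nhds θ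
  have hs : ContMDiffAt 𝓘(ℝ, EuclideanSpace ℝ (Fin n)) (𝓡 n) ∞ (extChartAt (𝓡 n) θ).symm
      (extChartAt (𝓡 n) θ θ) := (contMDiffOn_extChartAt_symm θ).contMDiffAt ht
  have h1 : ContMDiffAt 𝓘(ℝ, EuclideanSpace ℝ (Fin n)) 𝓘(ℝ, ℝ) ∞
      (fun y => sliceGram h χ θ ((1 : ℝ), (extChartAt (𝓡 n) θ).symm y) (Sum.inr i) (Sum.inr j))
      (extChartAt (𝓡 n) θ θ) :=
    ContMDiffAt.comp _ (contMDiff_sliceGram h hχ hsupp (Sum.inr i) (Sum.inr j)).contMDiffAt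
      (contMDiffAt_const.prodMk hs)
  refine ((contMDiffAt_iff_contDiffAt.1 h1).differentiableAt (by simp)).congr_of_eventuallyEq ?_
  have h2 : ∀ᶠ y in 𝓝 (extChartAt (𝓡 n) θ θ), (extChartAt (𝓡 n) θ).symm y ∈ N := by
    refine hs.continuousAt.eventually (hN.mem_nhds ?_)
    rwa [extChartAt_to_inv]
  filter_upwards [ht, h2] with y hy hyN
  have h3 : ∀ i, (mfderiv (cylModel n) (𝓡 n) (Prod.snd : ℝ × Y → Y)
      ((1 : ℝ), (extChartAt (𝓡 n) θ).symm y)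
      (collarField χ θ (Sum.inr i) ((1 : ℝ), (extChartAt (𝓡 n) θ).symm y)) :
        EuclideanSpace ℝ (Fin n)) =
      chartField θ (Module.finBasis ℝ (EuclideanSpace ℝ (Fin n)) i) ((extChartAt (𝓡 n) θ).symm y) := by
    intro i
    have h4 := mfderiv_snd_coordField (p := ((1 : ℝ), (extChartAt (𝓡 n) θ).symm y))
      ((extChartAt (𝓡 n) θ).map_target hy) (cylBasis n (Sum.inr i))
    rw [cylBasis_inr] at h4
    have h5 : collarField χ θ (Sum.inr i) ((1 : ℝ), (extChartAt (𝓡 n) θ).symm y) =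
        coordField θ (0, Module.finBasis ℝ (EuclideanSpace ℝ (Fin n)) i)
          ((1 : ℝ), (extChartAt (𝓡 n) θ).symm y) := by
      rw [collarField, hχ1 _ hyN, one_mul, cylBasis_inr]
      exact one_smul ℝ _
    rw [h5]
    exact h4
  rw [gramInChart_eq h.inner hy]
  exact (congrArg₂ (fun a b => (h.inner ((extChartAt (𝓡 n) θ).symm y) : EuclideanSpace ℝ (Fin n) →L[ℝ]
    EuclideanSpace ℝ (Fin n) →L[ℝ] ℝ) a b) (h3 i) (h3 j)).symm

theorem det_gramInChart_pos (θ : Y) :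
    0 < (gramInChart (𝓡 n) h.inner θ (extChartAt (𝓡 n) θ θ)).det := by
  let L : EuclideanSpace ℝ (Fin n) →L[ℝ] EuclideanSpace ℝ (Fin n) :=
    mfderivWithin 𝓘(ℝ, EuclideanSpace ℝ (Fin n)) (𝓡 n) (extChartAt (𝓡 n) θ).symm
      (range (𝓡 n)) (extChartAt (𝓡 n) θ θ)
  let hθ : EuclideanSpace ℝ (Fin n) →L[ℝ] EuclideanSpace ℝ (Fin n) →L[ℝ] ℝ :=
    h.inner ((extChartAt (𝓡 n) θ).symm (extChartAt (𝓡 n) θ θ))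
  refine gramMatrix_det_pos (Module.finBasis ℝ (EuclideanSpace ℝ (Fin n)))
    ((ContinuousLinearMap.precomp ℝ L).comp (hθ.comp L)) (fun v w => h.symm _ (L v) (L w))
    fun v hv => h.pos _ (L v) ?_
  have h1 : L v = chartField θ v ((extChartAt (𝓡 n) θ).symm (extChartAt (𝓡 n) θ θ)) :=
    mfderivWithin_extChartAt_symm_apply (mem_extChartAt_target θ) v
  rw [h1]
  refine chartField_ne_zero ?_ hv
  rw [extChartAt_to_inv]
  exact mem_extChartAt_source θ

/-- The function f occurs only in terms with derivatives in r; the angular term is the same for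
every f. For f = 1 this is the conic formula, and subtracting two instances leaves a purely radial
operator. -/
theorem laplaceBeltrami_warpedMetric_radial [T2Space Y] {f : ℝ → ℝ} {s : ℝ} (hs : 0 < s)
    (hf : ContDiffAt ℝ ∞ f s) (hf0 : 0 < f s) {v : ℝ × Y → ℝ} {θ : Y}
    (hv : ContMDiffAt (cylModel n) 𝓘(ℝ, ℝ) ∞ v (s, θ)) :
    laplaceBeltrami (cylModel n) (warpedMetric f h.inner) v (s, θ) =
      -((f s)⁻¹ * (iteratedDeriv 2 (fun r => v (r⁻¹, θ)) s⁻¹ +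
        n / s⁻¹ * deriv (fun r => v (r⁻¹, θ)) s⁻¹)) +
      2⁻¹ * deriv (fun r => f r⁻¹) s⁻¹ * (f s ^ 2)⁻¹ * deriv (fun r => v (r⁻¹, θ)) s⁻¹ +
      (s⁻¹ ^ 2)⁻¹ * laplaceBeltrami (𝓡 n) h.inner (fun θ' => v (s, θ')) θ := by
  have hγ := localInverse_inv hs
  have hp : ((s, θ) : ℝ × Y).2 ∈ (extChartAt (𝓡 n) θ).source := mem_extChartAt_source θ
  have hsi : 0 < s⁻¹ := inv_pos.2 hs
  have hz0 : cylCoord (n := n) (·⁻¹) θ (s, θ) = (s⁻¹, extChartAt (𝓡 n) θ θ) := rfl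
  have hfd : DifferentiableAt ℝ (fun r => f r⁻¹) s⁻¹ := by
    refine DifferentiableAt.fun_comp' s⁻¹ ?_ (differentiableAt_inv hsi.ne')
    rw [inv_inv]
    exact hf.differentiableAt (by simp)
  have hgram : ∀ᶠ z in 𝓝 (cylCoord (n := n) (·⁻¹) θ (s, θ)),
      gramMatrix (cylBasis n) (pullbackForm 𝓘(ℝ, ℝ × EuclideanSpace ℝ (Fin n)) (cylModel n)
        (cylParam (·⁻¹) θ) (warpedMetric f h.inner) z) =
      warpedBlock (fun r => f r⁻¹) (gramInChart (𝓡 n) h.inner θ) z := by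
    filter_upwards [eventually_cylCoord_mem_target hγ hp,
      (continuous_fst.tendsto (s⁻¹, extChartAt (𝓡 n) θ θ)).eventually (lt_mem_nhds hsi)] with z h1 h2
    exact pullbackForm_cylParam_inv f h.inner h1 h2.ne'
  have hfpos : ∀ᶠ p : ℝ × Y in 𝓝 (s, θ), 0 < p.1 ∧ 0 < f p.1 :=
    (continuous_fst.tendsto (s, θ)).eventually
      ((lt_mem_nhds hs).and (hf.continuousAt.eventually (lt_mem_nhds hf0)))
  have hH := differentiableAt_gramInChart h θ
  have hblock : ∀ a b, DifferentiableAt ℝ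
      (fun z => warpedBlock (fun r => f r⁻¹) (gramInChart (𝓡 n) h.inner θ) z a b)
      (s⁻¹, extChartAt (𝓡 n) θ θ) := by
    rintro (a | a) (b | b)
    · exact DifferentiableAt.comp (g := fun r => f r⁻¹) (s⁻¹, extChartAt (𝓡 n) θ θ) hfd
        differentiableAt_fst
    · exact differentiableAt_const _
    · exact differentiableAt_const _
    · exact (differentiableAt_fst.pow 2).mul
        (DifferentiableAt.comp (g := fun y => gramInChart (𝓡 n) h.inner θ y a b)
          (s⁻¹, extChartAt (𝓡 n) θ θ) (hH a b) differentiableAt_snd)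
  have hu : ContDiffAt ℝ 2 (fun z => v (cylParam (·⁻¹) θ z)) (cylCoord (n := n) (·⁻¹) θ (s, θ)) :=
    (contDiffAt_comp_cylParam hγ hp le_rfl hv).of_le ENat.LEInfty.out
  rw [laplaceBeltrami_cylParam hγ hp (Eventually.of_forall fun p => warpedMetric_symm f h.symm p)
    (hfpos.mono fun p hp => warpedMetric_pos h.pos hp.1 hp.2)
    (fun a b => (hblock a b).congr_of_eventuallyEq (hgram.mono fun z hz =>
      congrArg (fun M : Matrix (CylIndex n) (CylIndex n) ℝ => M a b) hz)) hv,
    flatLaplacian_congr _ hgram (EventuallyEq.refl _ _), hz0,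
    flatLaplacian_warpedBlock (Module.finBasis ℝ (EuclideanSpace ℝ (Fin n))) (cylBasis_inl n)
      (cylBasis_inr n) hsi hfd (by rwa [inv_inv]) hH (det_gramInChart_pos h θ) hu]
  -- The coordinates on Y are those of the chart at θ itself, so the angular term is by definition
  -- the Laplace–Beltrami operator of h at θ.
  simp only [cylParam_apply, extChartAt_to_inv, inv_inv, Fintype.card_fin, finrank_euclideanSpace]
  rfl

end RadialFormula

/-! ### The radial operator A and the cutoff of F -/

section RadialOperator

open Filter Topology

/-- The b-vector field `ρ ∂_ρ` on `[0,1)`. -/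
def eulerField : VField 𝓘(ℝ, ℝ) ℝ := fun s => (s : ℝ)

theorem isBField_eulerField : IsBField 𝓘(ℝ, ℝ) (Ico (0 : ℝ) 1) id eulerField where
  contMDiffOn s _ := contMDiffWithinAt_vectorSpace_iff_contDiffWithinAt.2 contDiffWithinAt_id
  tangent s _ h0 := by
    have h1 : eulerField s = 0 := h0
    rw [h1]
    exact map_zero (mfderivWithin 𝓘(ℝ, ℝ) 𝓘(ℝ, ℝ) (id : ℝ → ℝ) (Ico (0 : ℝ) 1) s)

theorem vfDeriv_eulerField (w : ℝ → ℝ) :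
    vfDeriv 𝓘(ℝ, ℝ) eulerField w = fun s => s * deriv w s := by
  funext s
  unfold vfDeriv
  rw [mfderiv_eq_fderiv]
  exact fderiv_eq_smul_deriv s

theorem deriv_comp_inv {w : ℝ → ℝ} {r : ℝ} (hr : r ≠ 0) (hw : DifferentiableAt ℝ w r⁻¹) :
    deriv (fun t => w t⁻¹) r = -(deriv w r⁻¹ * (r ^ 2)⁻¹) := by
  have h1 := (hw.hasDerivAt.comp r (hasDerivAt_inv hr)).deriv
  refine h1.trans ?_
  ring

theorem iteratedDeriv_comp_inv {w : ℝ → ℝ} {r : ℝ} (hr : r ≠ 0) (hw : ContDiffAt ℝ 2 w r⁻¹) :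
    iteratedDeriv 2 (fun t => w t⁻¹) r =
      deriv (deriv w) r⁻¹ * (r ^ 4)⁻¹ + 2 * deriv w r⁻¹ * (r ^ 3)⁻¹ := by
  have h1 : deriv (fun t => w t⁻¹) =ᶠ[𝓝 r] fun t => -(deriv w t⁻¹ * (t ^ 2)⁻¹) := by
    filter_upwards [(continuousAt_inv₀ hr).eventually (hw.eventually (by simp)),
      isOpen_ne.mem_nhds hr] with t ht ht0
    exact deriv_comp_inv ht0 (ht.differentiableAt (by simp))
  have h2 : DifferentiableAt ℝ (deriv w) r⁻¹ :=
    ((hw.fderiv_right (m := 1) (by norm_num)).differentiableAt one_ne_zero).clm_apply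
      (differentiableAt_const (1 : ℝ))
  have h3 := ((h2.hasDerivAt.comp r (hasDerivAt_inv hr)).mul
    ((hasDerivAt_pow 2 r).inv (pow_ne_zero 2 hr))).neg
  rw [iteratedDeriv_succ, iteratedDeriv_one, h1.deriv_eq]
  refine h3.deriv.trans ?_
  simp only [Function.comp, Pi.inv_apply]
  field_simp
  push_cast
  ring

/-- The difference of the radial parts of the Laplace--Beltrami operators of `f dr² + r² h` and of
`dr² + r² h`. -/
def radialDifference (n : ℕ) (f : ℝ → ℝ) (w : ℝ → ℝ) (s : ℝ) : ℝ :=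
  -(((f s)⁻¹ - 1) * (iteratedDeriv 2 (fun r => w r⁻¹) s⁻¹ + n / s⁻¹ * deriv (fun r => w r⁻¹) s⁻¹)) +
    2⁻¹ * deriv (fun r => f r⁻¹) s⁻¹ * (f s ^ 2)⁻¹ * deriv (fun r => w r⁻¹) s⁻¹

/-- Put E = ρ∂_ρ. Then ∂_r = -ρE, so ∂_r² + (n/r)∂_r = ρ²(E² + (1-n)E). Moreover 1/f - 1 = -ρ^j c/f
and Ef = ρ^j(jc + ρc′), so every term carries ρ^{2+j}; this determines the two coefficients. -/
theorem isDiffB_radialDifference (n : ℕ) {f c : ℝ → ℝ} {j : ℕ}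
    (hf : ContDiffOn ℝ ∞ f (Ico (0 : ℝ) 1)) (hf0 : ∀ s ∈ Ico (0 : ℝ) 1, 0 < f s)
    (hc : ContDiffOn ℝ ∞ c (Ico (0 : ℝ) 1)) (hfc : ∀ s ∈ Ioo (0 : ℝ) 1, f s = 1 + s ^ j * c s) :
    IsDiffB 𝓘(ℝ, ℝ) (Ico (0 : ℝ) 1) id 2
      (fun w s => (id s ^ (2 + j))⁻¹ * radialDifference n f w s) := by
  have hU : UniqueDiffOn ℝ (Ico (0 : ℝ) 1) := uniqueDiffOn_Ico 0 1
  have hinv : ContDiffOn ℝ ∞ (fun s => (f s)⁻¹) (Ico (0 : ℝ) 1) := hf.inv fun s hs => (hf0 s hs).ne'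
  have hc' : ContDiffOn ℝ ∞ (derivWithin c (Ico (0 : ℝ) 1)) (Ico (0 : ℝ) 1) :=
    hc.derivWithin hU (by simp)
  -- The coefficients of E² and of E. The derivative of c is taken within [0,1) so that the second
  -- one is smooth at ρ = 0.
  refine ⟨2, ![fun s => c s * (f s)⁻¹, fun s => (1 - n) * (c s * (f s)⁻¹) + 2⁻¹ *
      ((j * c s + s * derivWithin c (Ico (0 : ℝ) 1) s) * ((f s)⁻¹ * (f s)⁻¹))],
    ![[eulerField, eulerField], [eulerField]], ?_, ?_, ?_⟩
  · rw [Fin.forall_fin_two]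
    exact ⟨(hc.mul hinv).contMDiffOn, ((contDiffOn_const.mul (hc.mul hinv)).add (contDiffOn_const.mul
      (((contDiffOn_const.mul hc).add (contDiffOn_id.mul hc')).mul (hinv.mul hinv)))).contMDiffOn⟩
  · rw [Fin.forall_fin_two]
    refine ⟨⟨le_rfl, fun V hV => ?_⟩, ⟨one_le_two, fun V hV => ?_⟩⟩
    · have : V = eulerField := by simpa using hV
      exact this ▸ isBField_eulerField
    · have : V = eulerField := by simpa using hV
      exact this ▸ isBField_eulerField
  · intro w hw s hs hs0
    have hs0 : 0 < s := hs0
    have hsI : s ∈ Ioo (0 : ℝ) 1 := ⟨hs0, hs.2⟩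
    have hn : Ico (0 : ℝ) 1 ∈ 𝓝 s := Ico_mem_nhds hs0 hs.2
    have hw2 : ContDiffAt ℝ 2 w s := by
      have h1 : ContMDiffAt 𝓘(ℝ, ℝ) 𝓘(ℝ, ℝ) ∞ w s := hw.contMDiffAt
        (mem_of_superset (isOpen_Ioo.mem_nhds hsI) fun t ht => ⟨Ioo_subset_Ico_self ht, ht.1⟩)
      exact (contMDiffAt_iff_contDiffAt.1 h1).of_le ENat.LEInfty.out
    have hsi : s⁻¹ ≠ 0 := (inv_pos.2 hs0).ne'
    have hw1 : DifferentiableAt ℝ (deriv w) s :=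
      ((hw2.fderiv_right (m := 1) (by norm_num)).differentiableAt one_ne_zero).clm_apply
        (differentiableAt_const (1 : ℝ))
    have h1 : deriv (fun t => t * deriv w t) s = deriv w s + s * deriv (deriv w) s := by
      have := ((hasDerivAt_id s).mul hw1.hasDerivAt).deriv
      refine this.trans ?_
      simp
    have hcd : HasDerivAt c (derivWithin c (Ico (0 : ℝ) 1) s) s := by
      rw [derivWithin_of_mem_nhds hn]
      exact ((hc.contDiffAt hn).differentiableAt (by simp)).hasDerivAt
    have hfd : deriv f s = j * s ^ (j - 1) * c s + s ^ j * derivWithin c (Ico (0 : ℝ) 1) s := by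
      have h2 : f =ᶠ[𝓝 s] fun t => 1 + t ^ j * c t := by
        filter_upwards [isOpen_Ioo.mem_nhds hsI] with t ht
        exact hfc t ht
      rw [h2.deriv_eq]
      exact (((hasDerivAt_pow j s).mul hcd).const_add 1).deriv
    have hjs : s * (j * s ^ (j - 1)) = j * s ^ j := by
      rcases j with _ | j
      · simp
      · rw [Nat.add_sub_cancel, pow_succ]
        ring
    have hw' := deriv_comp_inv (w := w) hsi (by rw [inv_inv]; exact hw2.differentiableAt (by simp))
    have hf' := deriv_comp_inv (w := f) hsi
      (by rw [inv_inv]; exact (hf.contDiffAt hn).differentiableAt (by simp))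
    have hw'' := iteratedDeriv_comp_inv (w := w) hsi (by rwa [inv_inv])
    rw [inv_inv] at hw' hf' hw''
    have hf1 := hf0 s hs
    have hsf : s * deriv f s = s ^ j * (j * c s + s * derivWithin c (Ico (0 : ℝ) 1) s) := by
      rw [hfd]
      linear_combination c s * hjs
    have hf2 : (f s)⁻¹ - 1 = -(s ^ j * (c s * (f s)⁻¹)) := by
      have := hfc s hsI
      field_simp
      linarith
    simp only [Fin.sum_univ_two, Matrix.cons_val_zero, Matrix.cons_val_one, List.foldr_cons,
      List.foldr_nil, vfDeriv_eulerField, id]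
    rw [h1, radialDifference, hw', hf', hw'', hf2]
    have hf3 : deriv f s = s⁻¹ * (s ^ j * (j * c s + s * derivWithin c (Ico (0 : ℝ) 1) s)) := by
      rw [← hsf]
      field_simp
    rw [hf3]
    have := hs0.ne'
    field_simp
    ring

theorem isWeightedDiffB_radialDifference (n : ℕ) {f : ℝ → ℝ} {l : ℕ∞}
    (hf : ContDiffOn ℝ ∞ f (Ico (0 : ℝ) 1)) (hf0 : ∀ s ∈ Ico (0 : ℝ) 1, 0 < f s)
    (hfl : MemRhoSmooth 𝓘(ℝ, ℝ) (Ico (0 : ℝ) 1) id l (fun s => f s - 1)) :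
    IsWeightedDiffB 𝓘(ℝ, ℝ) (Ico (0 : ℝ) 1) id (2 + l) 2 (radialDifference n f) := by
  refine isWeightedDiffB_of_forall contMDiffOn_id fun j hj => ⟨2 + (j - 2), by omega, ?_⟩
  have hj' : ((j - 2 : ℕ) : ℕ∞) ≤ l := by
    cases l with
    | top => exact le_top
    | coe l =>
      norm_cast at hj ⊢
      omega
  obtain ⟨c, hc, hfc⟩ := hfl (j - 2) hj'
  refine isDiffB_radialDifference n hf hf0 hc.contDiffOn fun s hs => ?_
  have := hfc s (Ioo_subset_Ico_self hs) hs.1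
  simp only [id] at this
  linarith

/-- A function in `ρ C^∞` may be cut off to a function with small values, without changing it near
the boundary. -/
theorem exists_small_cutoff {F : ℝ → ℝ} {l : ℕ∞} (hl : 1 ≤ l)
    (hF : MemRhoSmooth 𝓘(ℝ, ℝ) (Ico (0 : ℝ) 1) id l F) :
    ∃ f : ℝ → ℝ, ContDiffOn ℝ ∞ f (Ico (0 : ℝ) 1) ∧ (∀ s ∈ Ico (0 : ℝ) 1, 0 < f s) ∧
      MemRhoSmooth 𝓘(ℝ, ℝ) (Ico (0 : ℝ) 1) id l (fun s => f s - 1) ∧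
      MemRhoSmooth 𝓘(ℝ, ℝ) (Ico (0 : ℝ) 1) id ⊤ (fun s => 1 + F s - f s) := by
  -- F is prescribed only for ρ > 0; the product s · a(s) is its smooth extension to s = 0, where it
  -- vanishes.
  obtain ⟨a, ha, hFa⟩ := hF 1 (by exact_mod_cast hl)
  simp only [id, pow_one] at hFa
  have ha' : ContDiffOn ℝ ∞ a (Ico (0 : ℝ) 1) := ha.contDiffOn
  have hprod : ContDiffOn ℝ ∞ (fun s => s * a s) (Ico (0 : ℝ) 1) := contDiffOn_id.mul ha'
  have h0 : (0 : ℝ) ∈ Ico (0 : ℝ) 1 := ⟨le_rfl, one_pos⟩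
  have hcont : Tendsto (fun s => s * a s) (𝓝[Ico (0 : ℝ) 1] 0) (𝓝 0) := by
    have := (hprod.continuousOn 0 h0).tendsto
    simpa using this
  -- By continuity |F| < 1/2 for 0 < s < ε, so 1 plus the cut off function stays positive.
  obtain ⟨ε, hε, hεF⟩ := Metric.mem_nhdsWithin_iff.1
    (hcont (Metric.ball_mem_nhds (0 : ℝ) (by norm_num : (0 : ℝ) < 1 / 2)))
  have hε2 : ε / 2 < ε := half_lt_self hε
  have hcut : ∀ s, ContDiffOn ℝ ∞ (realCutoff (ε / 2) ε) s := fun s =>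
    (contDiff_realCutoff _ _).contDiffOn
  refine ⟨fun s => 1 + realCutoff (ε / 2) ε s * (s * a s), contDiffOn_const.add ((hcut _).mul hprod),
    fun s hs => ?_, fun j hj => ?_, fun j _ => ?_⟩
  · change 0 < 1 + realCutoff (ε / 2) ε s * (s * a s)
    rcases le_or_gt ε s with h | h
    · rw [realCutoff_eq_zero hε2 h]
      simp
    · have h1 : |s * a s| < 1 / 2 := by
        have : s * a s ∈ Metric.ball (0 : ℝ) (1 / 2) :=
          hεF ⟨by rwa [Metric.mem_ball, Real.dist_eq, sub_zero, abs_of_nonneg hs.1], hs⟩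
        rwa [Metric.mem_ball, Real.dist_eq, sub_zero] at this
      have h2 : |realCutoff (ε / 2) ε s * (s * a s)| < 1 := by
        rw [abs_mul, abs_of_nonneg (realCutoff_nonneg _ _ _)]
        have := realCutoff_le_one (ε / 2) ε s
        have := realCutoff_nonneg (ε / 2) ε s
        have := abs_nonneg (s * a s)
        nlinarith
      have := (abs_lt.1 h2).1
      linarith
  · obtain ⟨b, hb, hFb⟩ := hF j hj
    refine ⟨fun s => realCutoff (ε / 2) ε s * b s, ((hcut _).mul hb.contDiffOn).contMDiffOn,
      fun s hs hs0 => ?_⟩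
    have h1 := hFb s hs hs0
    have h2 := hFa s hs hs0
    simp only [id] at h1 ⊢
    rw [← h2, h1]
    ring
  -- The factor 1 minus the cutoff vanishes for s ≤ ε/2, so division by any power of s stays smooth
  -- at 0.
  · refine ⟨fun s => (1 - realCutoff (ε / 2) ε s) * (s * a s) * (s ^ j)⁻¹, ?_, fun s hs hs0 => ?_⟩
    · refine ContDiffOn.contMDiffOn fun s hs => ?_
      rcases hs.1.eq_or_lt with h | h
      · refine (contDiffAt_const (c := (0 : ℝ))).congr_of_eventuallyEq ?_ |>.contDiffWithinAt
        filter_upwards [gt_mem_nhds (show s < ε / 2 by rw [← h]; exact half_pos hε)] with t ht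
        rw [realCutoff_eq_one hε2 ht.le, sub_self, zero_mul, zero_mul]
      · exact ((contDiffWithinAt_const.sub (hcut _ s hs)).mul (hprod s hs)).mul
          ((contDiffWithinAt_id.pow j).inv (pow_pos h j).ne')
    · have hs0 : 0 < s := hs0
      have h2 := hFa s hs hs0
      simp only [id]
      rw [h2]
      field_simp
      ring

end RadialOperator

/-! ### Pulling the metric of X back to the collar -/

section CollarPullback

open Filter Topology

variable {n : ℕ} {Y : Type*} [TopologicalSpace Y] [ChartedSpace (EuclideanSpace ℝ (Fin n)) Y]
  [IsManifold (𝓡 n) ∞ Y]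
  {X : Type*} [TopologicalSpace X] [ChartedSpace (EuclideanHalfSpace (n + 1)) X]
  [IsManifold (𝓡∂ (n + 1)) ∞ X]
  {φ : ℝ × Y → X} {ρ : X → ℝ}

theorem cyl_mem_nhds {p : ℝ × Y} (hp : p ∈ cylInterior Y) : cyl Y ∈ 𝓝 p :=
  prod_mem_nhds (Ico_mem_nhds hp.1.1 hp.1.2) univ_mem

namespace IsBoundaryCollar

variable (hφ : IsBoundaryCollar n φ ρ)

include hφ

theorem mem_interior {x : X} (hx : 0 < ρ x) : x ∈ (𝓡∂ (n + 1)).interior X := by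
  rw [← ModelWithCorners.compl_boundary]
  exact fun h => hx.ne' ((hφ.rho_eq_zero_iff x).2 h)

theorem rho_pos {p : ℝ × Y} (hp : p ∈ cylInterior Y) : 0 < ρ (φ p) := by
  rw [hφ.rho_collar p ⟨Ioo_subset_Ico_self hp.1, hp.2⟩]
  exact hp.1.1

theorem contMDiffAt {p : ℝ × Y} (hp : p ∈ cylInterior Y) :
    ContMDiffAt (cylModel n) (𝓡∂ (n + 1)) ∞ φ p :=
  hφ.contMDiffOn.contMDiffAt (cyl_mem_nhds hp)

theorem contMDiffAt_inverse {p : ℝ × Y} (hp : p ∈ cylInterior Y) :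
    ContMDiffAt (𝓡∂ (n + 1)) (cylModel n) ∞ hφ.inverse (φ p) :=
  hφ.contMDiffOn_inverse.contMDiffAt (hφ.isOpen_image.mem_nhds
    (mem_image_of_mem _ (mem_of_mem_nhds (cyl_mem_nhds hp))))

theorem mfderiv_ne_zero {p : ℝ × Y} (hp : p ∈ cylInterior Y) {v : TangentSpace (cylModel n) p}
    (hv : v ≠ 0) : mfderiv (cylModel n) (𝓡∂ (n + 1)) φ p v ≠ 0 := by
  intro h0
  refine hv ?_
  have h1 : ∀ᶠ z in 𝓝 p, hφ.inverse (φ z) = z := by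
    filter_upwards [cyl_mem_nhds hp] with z hz
    exact hφ.inverse_apply hz
  have h2 := mfderiv_comp_leftInverse ((hφ.contMDiffAt hp).mdifferentiableAt (by simp))
    ((hφ.contMDiffAt_inverse hp).mdifferentiableAt (by simp)) h1 v
  refine h2.symm.trans ?_
  rw [h0]
  exact map_zero (mfderiv (𝓡∂ (n + 1)) (cylModel n) hφ.inverse (φ p))

variable {g : BilinField (𝓡∂ (n + 1)) X}
  (hg : IsRiemannianOn (𝓡∂ (n + 1)) g ((𝓡∂ (n + 1)).interior X))

include hg

theorem pullbackForm_symm {p : ℝ × Y} (hp : p ∈ cylInterior Y) (v w : TangentSpace (cylModel n) p) :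
    pullbackForm (cylModel n) (𝓡∂ (n + 1)) φ g p v w =
      pullbackForm (cylModel n) (𝓡∂ (n + 1)) φ g p w v :=
  hg.symm _ (hφ.mem_interior (hφ.rho_pos hp)) _ _

theorem pullbackForm_pos {p : ℝ × Y} (hp : p ∈ cylInterior Y) (v : TangentSpace (cylModel n) p)
    (hv : v ≠ 0) : 0 < pullbackForm (cylModel n) (𝓡∂ (n + 1)) φ g p v v :=
  hg.pos _ (hφ.mem_interior (hφ.rho_pos hp)) _ (hφ.mfderiv_ne_zero hp hv)

/-- The tangent map of φ takes V and W to smooth sections along φ, which are then paired by the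
smooth section g of the bundle of forms over the interior. -/
theorem contMDiffAt_pullbackForm {V W : VField (cylModel n) (ℝ × Y)}
    (hV : ContMDiff (cylModel n) (cylModel n).tangent ∞
      (fun p => (⟨p, V p⟩ : TangentBundle (cylModel n) (ℝ × Y))))
    (hW : ContMDiff (cylModel n) (cylModel n).tangent ∞
      (fun p => (⟨p, W p⟩ : TangentBundle (cylModel n) (ℝ × Y)))) {p : ℝ × Y} (hp : p ∈ cylInterior Y) :
    ContMDiffAt (cylModel n) 𝓘(ℝ, ℝ) ∞
      (fun p => (pullbackForm (cylModel n) (𝓡∂ (n + 1)) φ g p (V p) (W p) : ℝ)) p := by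
  have : IsManifold (cylModel n) 1 (ℝ × Y) := IsManifold.of_le (n := ∞) ENat.LEInfty.out
  have : IsManifold (𝓡∂ (n + 1)) 1 X := IsManifold.of_le (n := ∞) ENat.LEInfty.out
  have hopen : IsOpen (cylInterior Y) := isOpen_Ioo.prod isOpen_univ
  have hT : ContMDiffOn (cylModel n).tangent (𝓡∂ (n + 1)).tangent ∞
      (tangentMapWithin (cylModel n) (𝓡∂ (n + 1)) φ (cylInterior Y))
      (Bundle.TotalSpace.proj ⁻¹' cylInterior Y) :=
    (hφ.contMDiffOn.mono (prod_mono Ioo_subset_Ico_self le_rfl)).contMDiffOn_tangentMapWithin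
      (by simp) hopen.uniqueMDiffOn
  have hU : ∀ {V : VField (cylModel n) (ℝ × Y)}, ContMDiff (cylModel n) (cylModel n).tangent ∞
      (fun p => (⟨p, V p⟩ : TangentBundle (cylModel n) (ℝ × Y))) →
      ContMDiffOn (cylModel n) (𝓡∂ (n + 1)).tangent ∞ (fun p : ℝ × Y =>
      (Bundle.TotalSpace.mk' (EuclideanSpace ℝ (Fin (n + 1)))
        (E := fun x : X => TangentSpace (𝓡∂ (n + 1)) x) (φ p)
        (mfderiv (cylModel n) (𝓡∂ (n + 1)) φ p (V p)))) (cylInterior Y) := fun hV => by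
    refine (hT.comp hV.contMDiffOn fun p hp => hp).congr fun p hp => ?_
    simp only [Function.comp, tangentMapWithin]
    rw [mfderivWithin_of_isOpen hopen hp]
  have hh := hg.contMDiffOn.comp (hφ.contMDiffOn.mono (prod_mono Ioo_subset_Ico_self le_rfl))
    fun p hp => hφ.mem_interior (hφ.rho_pos hp)
  have h1 := ContMDiffOn.clm_bundle_apply₂ (F₁ := EuclideanSpace ℝ (Fin (n + 1)))
    (F₂ := EuclideanSpace ℝ (Fin (n + 1))) (F₃ := ℝ) (E₃ := Bundle.Trivial X ℝ) hh (hU hV) (hU hW)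
  exact (Bundle.contMDiffAt_totalSpace.1 (h1.contMDiffAt (hopen.mem_nhds hp))).2

/-- Over ρ > 0 the collar map is a local diffeomorphism between interior points, so naturality
applies, in the coordinates (log ρ, θ). -/
theorem laplaceBeltrami_comp [T2Space Y] {u : X → ℝ}
    (hu : ContMDiffOn (𝓡∂ (n + 1)) 𝓘(ℝ, ℝ) ∞ u (φ '' cylInterior Y)) {p : ℝ × Y}
    (hp : p ∈ cylInterior Y) :
    laplaceBeltrami (𝓡∂ (n + 1)) g u (φ p) =
      laplaceBeltrami (cylModel n) (pullbackForm (cylModel n) (𝓡∂ (n + 1)) φ g) (u ∘ φ) p := by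
  have hγ := localInverse_exp_log hp.1.1
  have hps : p.2 ∈ (extChartAt (𝓡 n) p.2).source := mem_extChartAt_source p.2
  -- Replaces the coordinate frame by globally smooth fields equal to it near p, to which smoothness
  -- of the pulled back metric can be applied.
  obtain ⟨χ, N, hN, hN0, hNs, hχ, hsupp, hχ1⟩ := exists_bump (n := n) p.2
  have hint : ∀ᶠ x in 𝓝 (φ p), x ∈ (𝓡∂ (n + 1)).interior X := by
    filter_upwards [hφ.rho_contMDiff.continuous.continuousAt.eventually
      (lt_mem_nhds (hφ.rho_pos hp))] with x hx
    exact hφ.mem_interior hx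
  have hcyl : cyl Y ∈ 𝓝 p := cyl_mem_nhds hp
  have hu' : ContMDiffAt (cylModel n) 𝓘(ℝ, ℝ) ∞ (u ∘ φ) p :=
    (hu.comp (hφ.contMDiffOn.mono (prod_mono Ioo_subset_Ico_self le_rfl))
      fun q hq => mem_image_of_mem _ hq).contMDiffAt ((isOpen_Ioo.prod isOpen_univ).mem_nhds hp)
  refine laplaceBeltrami_pullback (cylBasis n) BoundarylessManifold.isInteriorPoint
    (hφ.mem_interior (hφ.rho_pos hp)) (hφ.contMDiffAt hp) (hφ.contMDiffAt_inverse hp)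
    ?_ ?_ (contMDiffAt_cylCoord hγ.right hps) (contMDiffAt_cylParam_cylCoord hγ hps)
    (eventually_cylParam_cylCoord hγ hps) (eventually_cylCoord_cylParam hγ hps)
    (hint.mono fun x hx => hg.symm x hx) (hint.mono fun x hx => hg.pos x hx) (fun a b => ?_)
    ((contDiffAt_comp_cylParam hγ hps le_rfl hu').of_le ENat.LEInfty.out)
  · filter_upwards [hcyl] with z hz
    exact hφ.inverse_apply hz
  · filter_upwards [hφ.isOpen_image.mem_nhds (mem_image_of_mem _ (mem_of_mem_nhds hcyl))] with x hx
    exact hφ.apply_inverse hx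
  · have h1 := hφ.contMDiffAt_pullbackForm hg (contMDiff_collarField hχ hsupp a)
      (contMDiff_collarField hχ hsupp b) hp
    refine ((contDiffAt_comp_cylParam hγ hps le_rfl h1).differentiableAt
      (by simp)).congr_of_eventuallyEq ?_
    have h2 : ∀ᶠ z in 𝓝 (cylCoord (n := n) Real.log p.2 p), (cylParam Real.exp p.2 z).2 ∈ N :=
      (tendsto_cylParam hγ hps).eventually ((hN.preimage continuous_snd).mem_nhds hN0)
    filter_upwards [eventually_cylCoord_mem_target hγ hps, h2] with z hz hzN
    exact pullbackForm_cylParam_exp hz (hχ1 _ hzN) _ a b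

end IsBoundaryCollar

end CollarPullback

end

/-! ### The main theorem -/

theorem mainTheorem10 {n : ℕ}
    {X : Type*} [TopologicalSpace X] [T2Space X] [CompactSpace X]
    [ChartedSpace (EuclideanHalfSpace (n + 1)) X] [IsManifold (𝓡∂ (n + 1)) ∞ X]
    {Y : Type*} [TopologicalSpace Y] [ChartedSpace (EuclideanSpace ℝ (Fin n)) Y]
    [IsManifold (𝓡 n) ∞ Y]
    (φ : ℝ × Y → X) (ρ : X → ℝ) (hφ : IsBoundaryCollar n φ ρ)
    (h : Bundle.ContMDiffRiemannianMetric (𝓡 n) ∞ (EuclideanSpace ℝ (Fin n))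
      (fun θ : Y => TangentSpace (𝓡 n) θ))
    (g : BilinField (𝓡∂ (n + 1)) X)
    (hg : IsRiemannianOn (𝓡∂ (n + 1)) g ((𝓡∂ (n + 1)).interior X))
    (k k₀ : ℕ∞) (hk₀ : 1 ≤ k₀)
    (F : ℝ → ℝ) (hF : MemRhoSmooth 𝓘(ℝ, ℝ) (Ico (0 : ℝ) 1) id (1 + k) F)
    (κ : BilinField (cylModel n) (ℝ × Y))
    (hκ : MemScSymTwo (cylModel n) (cyl Y) Prod.fst (1 + k₀) κ)
    (hdecay : ∀ p ∈ cylInterior Y,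
      pullbackForm (cylModel n) (𝓡∂ (n + 1)) φ g p =
        conicMetric h.inner p + F p.1 • drSq n Y p + κ p) :
    (∀ v : ℝ × Y → ℝ, IsSmoothInterior (cylModel n) (cyl Y) Prod.fst v →
      ∀ s ∈ Ioo (0 : ℝ) 1, ∀ θ : Y,
        laplaceBeltrami (cylModel n) (conicMetric h.inner) v (s, θ) =
          -iteratedDeriv 2 (fun r : ℝ => v (r⁻¹, θ)) s⁻¹
            - (n : ℝ) / s⁻¹ * deriv (fun r : ℝ => v (r⁻¹, θ)) s⁻¹
            + 1 / s⁻¹ ^ 2 * laplaceBeltrami (𝓡 n) h.inner (fun θ' : Y => v (s, θ')) θ) ∧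
    IsCollarWeightedDiffB n φ ρ 2 2
      (laplaceBeltrami (cylModel n) (conicMetric (Y := Y) h.inner)) ∧
    ∃ (A : (ℝ → ℝ) → ℝ → ℝ) (B : (ℝ × Y → ℝ) → ℝ × Y → ℝ),
      IsWeightedDiffB 𝓘(ℝ, ℝ) (Ico (0 : ℝ) 1) id (3 + k) 2 A ∧
      IsCollarWeightedDiffB n φ ρ (3 + k₀) 2 B ∧
      ∀ u : X → ℝ, ContMDiffOn (𝓡∂ (n + 1)) 𝓘(ℝ, ℝ) ∞ u (φ '' cylInterior Y) →
        ∀ s ∈ Ioo (0 : ℝ) 1, ∀ θ : Y,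
          laplaceBeltrami (𝓡∂ (n + 1)) g u (φ (s, θ))
              - laplaceBeltrami (cylModel n) (conicMetric h.inner) (u ∘ φ) (s, θ) =
            A (fun t : ℝ => u (φ (t, θ))) s + B (u ∘ φ) (s, θ) := by 
  have := hφ.t2Space
  have := hφ.compactSpace
  have hint : ∀ {v : ℝ × Y → ℝ}, ContMDiffOn (cylModel n) 𝓘(ℝ, ℝ) ∞ v (cylInterior Y) →
      ∀ s ∈ Ioo (0 : ℝ) 1, ∀ θ : Y, ContMDiffAt (cylModel n) 𝓘(ℝ, ℝ) ∞ v (s, θ) := fun hv s hs θ =>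
    hv.contMDiffAt ((isOpen_Ioo.prod isOpen_univ).mem_nhds ⟨hs, mem_univ _⟩)
  refine ⟨fun v hv s hs θ => ?_, ?_, ?_⟩
  · rw [conicMetric_eq_warpedMetric, laplaceBeltrami_warpedMetric_radial h hs.1 contDiffAt_const one_pos
      (hint hv.cyl s hs θ)]
    simp only [deriv_const]
    ring
  · rw [conicMetric_eq_warpedMetric]
    exact hφ.isCollarWeightedDiffB (isWeightedDiffB_laplaceBeltrami_warpedMetric h contDiffOn_const
      fun _ _ => one_pos)
  -- Positivity of 1 + F is not guaranteed away from the boundary, since only the full metric g is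
  -- positive there; f agrees with 1 + F near ρ = 0 and is positive throughout.
  obtain ⟨f, hf, hf0, hf1, hFf⟩ := exists_small_cutoff (le_self_add : (1 : ℕ∞) ≤ 1 + k) hF
  have h3 : ∀ l : ℕ∞, 3 + l = 2 + (1 + l) := fun l => by rw [← add_assoc]; norm_num
  -- A compares the metric f dr² + r²h with the conic one, and B compares the pullback of g with f
  -- dr² + r²h.
  refine ⟨radialDifference n f, fun v p =>
    laplaceBeltrami (cylModel n) (pullbackForm (cylModel n) (𝓡∂ (n + 1)) φ g) v p -
      laplaceBeltrami (cylModel n) (warpedMetric f h.inner) v p, ?_, ?_, fun u hu s hs θ => ?_⟩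
  · rw [h3]
    exact isWeightedDiffB_radialDifference n hf hf0 hf1
  · rw [h3]
    refine hφ.isCollarWeightedDiffB (isWeightedDiffB_laplaceBeltrami_sub h hf hf0
      (fun p hp => hφ.pullbackForm_symm hg hp) (fun p hp => hφ.pullbackForm_pos hg hp)
      le_self_add (c := fun s => 1 + F s - f s) (fun j _ => hFf j le_top) hκ fun p hp => ?_)
    -- Rewrites g as the warped metric plus (1 + F - f)dr² + κ. Since 1 + F - f lies in every ρ^j
    -- C^∞, the new radial error does not lower the weight of κ.
    have hmodule : ∀ (D P K : (ℝ × EuclideanSpace ℝ (Fin n)) →L[ℝ]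
        (ℝ × EuclideanSpace ℝ (Fin n)) →L[ℝ] ℝ) (a b : ℝ),
        D + P + a • D + K = b • D + P + (1 + a - b) • D + K := fun D P K a b => by module
    rw [hdecay p hp]
    exact hmodule _ _ _ _ _
  · have hp : (s, θ) ∈ cylInterior Y := ⟨hs, mem_univ _⟩
    have hv : ContMDiffAt (cylModel n) 𝓘(ℝ, ℝ) ∞ (u ∘ φ) (s, θ) :=
      hint (hu.comp (hφ.contMDiffOn.mono (prod_mono Ioo_subset_Ico_self le_rfl))
        fun q hq => mem_image_of_mem _ hq) s hs θ
    have hsI : s ∈ Ico (0 : ℝ) 1 := Ioo_subset_Ico_self hs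
    change _ = radialDifference n f (fun t => u (φ (t, θ))) s +
      (laplaceBeltrami (cylModel n) (pullbackForm (cylModel n) (𝓡∂ (n + 1)) φ g) (u ∘ φ) (s, θ) -
        laplaceBeltrami (cylModel n) (warpedMetric f h.inner) (u ∘ φ) (s, θ))
    -- After Δ_g is moved to the collar, the radial formula for f and for 1 makes the angular terms
    -- cancel, leaving `radialDifference`.
    rw [hφ.laplaceBeltrami_comp hg hu hp, conicMetric_eq_warpedMetric,
      laplaceBeltrami_warpedMetric_radial h hs.1 contDiffAt_const one_pos hv,
      laplaceBeltrami_warpedMetric_radial h hs.1 (hf.contDiffAt (Ico_mem_nhds hs.1 hs.2)) (hf0 s hsI) hv]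
    simp only [radialDifference, deriv_const, Function.comp]
    ring
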